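/- Let $d\ge 1$. For a finite set $\Lambda\subset\mathbb Z^d$, $U\in\mathbb R$ and $\omega\in\{0,1\}^\Lambda$ let $$H_\Lambda(\omega)=-\sum_{x,y\in\Lambda,\ |x-y|=1}a_x^\dagger a_y-U\sum_{x\in\Lambda}\omega_x a_x^\dagger a_x$$ be the spinless Falicov–Kimball Hamiltonian on the fermionic Fock space over $\Lambda$, let $N_{\rm c}(\omega)=\sum_{x\in\Lambda}\omega_x$, and let $E_\Lambda(N,\omega)$ be the lowest eigenvalue of $H_\Lambda(\omega)$ in the $N$-electron subspace. For $\omega\in\{0,1\}^\Lambda$ let $D(\omega)=\{x\in\Lambda:\omega_x=1\}$ and $$B_\Lambda(\omega)=\#\{(x,y): x\in D(\omega),\ y\in\mathbb Z^d\setminus D(\omega),\ |x-y|=1\}.$$ For a configuration $\omega$ on $\mathbb Z^d$ that is periodic in all $d$ lattice directions and for $\rho\in[0,1]$, put $$\rho_{\rm c}(\omega)=\lim_{\Lambda}\tfrac1{|\Lambda|}N_{\rm c}(\omega|_\Lambda),\qquad e(\rho,\omega)=\lim_{\Lambda}\tfrac1{|\Lambda|}E_\Lambda(\lfloor\rho|\Lambda|\rfloor,\omega|_\Lambda),$$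 where $\Lambda$ runs over cubes whose side tends to infinity; for $U>4d$ these limits exist. Write $\omega\equiv0$ and $\omega\equiv1$ for the empty and the full configuration; $e(\rho,\omega\equiv0)$ does not depend on $U$. A mixture with densities $(\rho_{\rm e},\rho_{\rm c})$ is a finite family of pairwise distinct pairs $(\omega^{(i)},\rho_{\rm e}^{(i)})$, with $\omega^{(i)}$ periodic and $\rho_{\rm e}^{(i)}\in[0,1]$, and of weights $\alpha_i>0$, such that $\sum_i\alpha_i=1$, $\sum_i\alpha_i\rho_{\rm e}^{(i)}=\rho_{\rm e}$ and $\sum_i\alpha_i\rho_{\rm c}(\omega^{(i)})=\rho_{\rm c}$ (periodic configurations are the mixtures with one component). Its energy per site is $\sum_i\alpha_i e(\rho_{\rm e}^{(i)},\omega^{(i)})$. Let $e(\rho_{\rm e},\rho_{\rm c})$ be the infimum of these energies; a ground state for $(\rho_{\rm e},\rho_{\rm c})$ is a mixture with these densities whose energy is $e(\rho_{\rm e},\rho_{\rm c})$. The segregated state consists of $\omega\equiv0$ with weight $1-\rho_{\rm c}$ and $\omega\equiv1$ with weight $\rho_{\rm c}$ (a component of weight zero being omitted); the respective electronic densities are $0$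 and $\rho_{\rm e}/\rho_{\rm c}$ if $\rho_{\rm e}<\rho_{\rm c}$, and $(\rho_{\rm e}-\rho_{\rm c})/(1-\rho_{\rm c})$ and $1$ if $\rho_{\rm e}>\rho_{\rm c}$. **Theorem.** There are functions $a$ and $\gamma$, depending only on $d$, with $a(\rho)=a(1-\rho)$ for $0\le\rho\le1$, $a(\rho)>0$ for $0<\rho<1$, and $U\gamma(U)\to8d^2$ as $U\to\infty$, such that the following holds. (a) For every finite box $\Lambda\subset\mathbb Z^d$, every $U>4d$, every $\omega\in\{0,1\}^\Lambda$ and every integer $0\le N_{\rm e}\le N_{\rm c}=N_{\rm c}(\omega)$, $$\tfrac1{2d}\bigl|e(\tfrac{N_{\rm e}}{N_{\rm c}},\omega\equiv0)\bigr|\,B_\Lambda(\omega)\ \ge\ E_\Lambda(N_{\rm e},\omega)-N_{\rm c}\,e(\tfrac{N_{\rm e}}{N_{\rm c}},\omega\equiv1)\ \ge\ \Bigl[a(\tfrac{N_{\rm e}}{N_{\rm c}})-\gamma(U)\Bigr]B_\Lambda(\omega)$$ (if $N_{\rm c}=0$, then $N_{\rm e}/N_{\rm c}$ is read as $0$). (b)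 Let $0<\rho_{\rm e}<\rho_{\rm c}\le1$ and $\tilde\rho=\rho_{\rm e}/\rho_{\rm c}$, or let $0<\rho_{\rm c}<\rho_{\rm e}<1$ and $\tilde\rho=(1-\rho_{\rm e})/(1-\rho_{\rm c})$. If $U>4d$ and $a(\tilde\rho)>\gamma(U)$, which holds for all sufficiently large $U$, then the segregated state is the unique ground state for $(\rho_{\rm e},\rho_{\rm c})$. Moreover, if there are periodic configurations with density $\rho_{\rm c}$, then $e(\rho_{\rm e},\rho_{\rm c})$ is the infimum of $e(\rho_{\rm e},\omega)$ over these configurations. -/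

import Mathlib

open Filter Topology

namespace FalicovKimball

noncomputable section

/-- Sites of the lattice `ℤ^d`. -/
abbrev Site (d : ℕ) := Fin d → ℤ

/-- Nearest neighbours: `|x - y| = 1`. -/
def Adjacent {d : ℕ} (x y : Site d) : Prop := ∑ i, |x i - y i| = 1

instance {d : ℕ} (x y : Site d) : Decidable (Adjacent x y) :=
  inferInstanceAs (Decidable (∑ i, |x i - y i| = 1))

/-! ### Fermions on a finite set of sites -/

section Fock

variable {ι : Type*} [Fintype ι] [DecidableEq ι]

/-- Complex functions of `N` variables in `ι`. -/
abbrev WaveFn (ι : Type*) (N : ℕ) := (Fin N → ι) → ℂ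

/-- `Ψ` is antisymmetric, i.e. belongs to the `N`-particle space. -/
def Antisymmetric {N : ℕ} (Ψ : WaveFn ι N) : Prop :=
  ∀ (σ : Equiv.Perm (Fin N)) (z : Fin N → ι),
    Ψ (fun i => z (σ i)) = ((Equiv.Perm.sign σ : ℤ) : ℂ) * Ψ z

/-- The inner product of `ℓ²(ι^N)`. -/
def innerProd {N : ℕ} (Φ Ψ : WaveFn ι N) : ℂ := ∑ z, star (Φ z) * Ψ z

/-- The annihilation operator `a_x`, from `N + 1` particles to `N` particles. -/
def annihilate (x : ι) {N : ℕ} (Ψ : WaveFn ι (N + 1)) : WaveFn ι N :=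
  fun z => (Real.sqrt (N + 1) : ℂ) * Ψ (Fin.cons x z)

/-- The creation operator `a†_x`, from `N` particles to `N + 1` particles. -/
def create (x : ι) {N : ℕ} (Ψ : WaveFn ι N) : WaveFn ι (N + 1) :=
  fun z => (1 / (Real.sqrt (N + 1) : ℂ)) *
    ∑ j : Fin (N + 1), (-1) ^ (j : ℕ) * if z j = x then Ψ (fun i => z (j.succAbove i)) else 0

/-- The operator `a†_x a_y` on the `N`-particle space (zero on the vacuum sector). -/
def createAnnihilate (x y : ι) : {N : ℕ} → WaveFn ι N → WaveFn ι N
  | 0, _ => 0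
  | _ + 1, Ψ => create x (annihilate y Ψ)

end Fock

/-! ### The Hamiltonian and the canonical ground state energy in a finite volume -/

section Finite

variable {d : ℕ}

/-- Configurations of classical particles in `Λ` (`true` means that the site is occupied). -/
abbrev BoxConfig (Λ : Finset (Site d)) := Λ → Bool

/-- The number `N_c(ω)` of classical particles. -/
def numClassical {Λ : Finset (Site d)} (ω : BoxConfig Λ) : ℕ :=
  (Finset.univ.filter fun x => ω x = true).card

/-- The Falicov-Kimball Hamiltonian
`-∑_{|x-y|=1} a†_x a_y - U ∑_x ω_x a†_x a_x` on the `N`-electron space. -/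
def hamiltonian (U : ℝ) {Λ : Finset (Site d)} (ω : BoxConfig Λ) {N : ℕ} (Ψ : WaveFn Λ N) :
    WaveFn Λ N :=
  - (∑ x : Λ, ∑ y : Λ, if Adjacent (x : Site d) (y : Site d) then createAnnihilate x y Ψ else 0)
    - (U : ℂ) • ∑ x : Λ, if ω x = true then createAnnihilate x x Ψ else 0

/-- The ground state energy `E_Λ(N, ω)`: the infimum of `⟨Ψ, H_Λ(ω) Ψ⟩` over normalized
antisymmetric functions of `N` variables in `Λ`. -/
def groundEnergy (U : ℝ) {Λ : Finset (Site d)} (N : ℕ) (ω : BoxConfig Λ) : ℝ :=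
  sInf {E | ∃ Ψ : WaveFn Λ N, Antisymmetric Ψ ∧ innerProd Ψ Ψ = 1 ∧
    E = (innerProd Ψ (hamiltonian U ω Ψ)).re}

/-- The occupied domain, as a subset of the lattice. -/
def occupied {Λ : Finset (Site d)} (ω : BoxConfig Λ) : Set (Site d) :=
  {x | ∃ h : x ∈ Λ, ω ⟨x, h⟩ = true}

/-- The size of the boundary of the occupied domain: the number of pairs of nearest neighbours
in `ℤ^d`, the first site being in the domain and the second one outside. -/
def boundarySize {Λ : Finset (Site d)} (ω : BoxConfig Λ) : ℕ :=
  Set.ncard {p : Site d × Site d | p.1 ∈ occupied ω ∧ p.2 ∉ occupied ω ∧ Adjacent p.1 p.2}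

end Finite

/-! ### Infinite volume -/

section Infinite

variable {d : ℕ}

/-- Configurations of classical particles on the whole lattice. -/
abbrev Config (d : ℕ) := Site d → Bool

/-- The configuration `ω ≡ 0`. -/
def emptyConfig (d : ℕ) : Config d := fun _ => false

/-- The configuration `ω ≡ 1`. -/
def fullConfig (d : ℕ) : Config d := fun _ => true

/-- Restriction of a configuration to a finite volume. -/
def restrict (Λ : Finset (Site d)) (ω : Config d) : BoxConfig Λ := fun x => ω x

/-- The cube with lower corner `c` and `L + 1` sites on each edge. -/
def cube (c : Site d) (L : ℕ) : Finset (Site d) := Finset.Icc c (fun i => c i + L)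

/-- The filter on cubes (given by their corner and size) along which the size tends to infinity,
irrespective of the positions of the cubes. -/
def cubeFilter (d : ℕ) : Filter (Site d × ℕ) := comap Prod.snd atTop

/-- Periodicity in all lattice directions. -/
def Periodic (ω : Config d) : Prop :=
  ∀ i : Fin d, ∃ p : ℕ, 0 < p ∧ ∀ x, ω (x + Pi.single i (p : ℤ)) = ω x

/-- Number of classical particles per site in a cube. -/
def boxDensity (ω : Config d) (Q : Site d × ℕ) : ℝ :=
  (numClassical (restrict (cube Q.1 Q.2) ω) : ℝ) / ((cube Q.1 Q.2).card : ℝ)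

/-- Ground state energy per site in a cube `Λ`, with `⌊ρ |Λ|⌋` electrons. -/
def boxEnergy (U ρ : ℝ) (ω : Config d) (Q : Site d × ℕ) : ℝ :=
  groundEnergy U ⌊ρ * ((cube Q.1 Q.2).card : ℝ)⌋₊ (restrict (cube Q.1 Q.2) ω) /
    ((cube Q.1 Q.2).card : ℝ)

/-- The density `ρ_c(ω)` of classical particles. -/
def classicalDensity (ω : Config d) : ℝ := limUnder (cubeFilter d) (boxDensity ω)

/-- The energy per site `e(ρ, ω)` in the infinite volume limit. -/
def energyDensity (U ρ : ℝ) (ω : Config d) : ℝ := limUnder (cubeFilter d) (boxEnergy U ρ ω)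

/-! ### Mixtures and canonical ground states -/

/-- `IsState ρe ρc m`: `m` is a mixture with densities `ρe` of electrons and `ρc` of classical
particles. A mixture gives a weight to each of finitely many pairs, consisting of a periodic
configuration and an electronic density; a periodic configuration is a mixture with a single
component. -/
structure IsState (ρe ρc : ℝ) (m : (Config d × ℝ) →₀ ℝ) : Prop where
  nonneg : ∀ p, 0 ≤ m p
  total : m.sum (fun _ w => w) = 1
  periodic : ∀ p ∈ m.support, Periodic p.1
  mem_Icc : ∀ p ∈ m.support, p.2 ∈ Set.Icc (0 : ℝ) 1
  electrons : m.sum (fun p w => w * p.2) = ρe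
  classical : m.sum (fun p w => w * classicalDensity p.1) = ρc

/-- The energy per site of a mixture. -/
def stateEnergy (U : ℝ) (m : (Config d × ℝ) →₀ ℝ) : ℝ :=
  m.sum (fun p w => w * energyDensity U p.2 p.1)

/-- The absolute ground state energy density `e(ρe, ρc)`, as an infimum over mixtures. -/
def absoluteEnergy (d : ℕ) (U ρe ρc : ℝ) : ℝ :=
  sInf {E | ∃ m : (Config d × ℝ) →₀ ℝ, IsState ρe ρc m ∧ E = stateEnergy U m}

/-- The set of canonical ground states for the densities `ρe`, `ρc`. -/
def canonicalGroundStates (d : ℕ) (U ρe ρc : ℝ) : Set ((Config d × ℝ) →₀ ℝ) :=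
  {m | IsState ρe ρc m ∧ stateEnergy U m = absoluteEnergy d U ρe ρc}

/-- Energies per site, for the electronic density `ρe`, of the periodic configurations with
density `ρc`. -/
def periodicEnergies (d : ℕ) (U ρe ρc : ℝ) : Set ℝ :=
  {E | ∃ ω : Config d, Periodic ω ∧ classicalDensity ω = ρc ∧ E = energyDensity U ρe ω}

/-- The segregated state for `ρe < ρc`: the empty configuration without electrons, and the full
configuration with electronic density `ρe / ρc`, in proportions `1 - ρc` and `ρc`. -/
def segregatedBelow (d : ℕ) (ρe ρc : ℝ) : (Config d × ℝ) →₀ ℝ :=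
  Finsupp.single (emptyConfig d, 0) (1 - ρc) + Finsupp.single (fullConfig d, ρe / ρc) ρc

/-- The segregated state for `ρe > ρc` (the image of the previous one under the particle-hole
transformation): the empty configuration with electronic density `(ρe - ρc) / (1 - ρc)`, and the
full configuration filled with electrons, in proportions `1 - ρc` and `ρc`. -/
def segregatedAbove (d : ℕ) (ρe ρc : ℝ) : (Config d × ℝ) →₀ ℝ :=
  Finsupp.single (emptyConfig d, (ρe - ρc) / (1 - ρc)) (1 - ρc) +
    Finsupp.single (fullConfig d, 1) ρc

end Infinite

end

end FalicovKimball

/-!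
# Segregation in the spinless Falicov-Kimball model

For fixed classical particles the electrons are free, so everything can be expressed by one-particle
density matrices `0 ≤ γ ≤ 1`: by the Pauli principle and the variational principle for Slater
determinants, `E_Λ(N, ω)` is the minimum of `Tr H_Λ(ω) γ` over `γ` with trace `N`
(`isLeast_secondQuantize`, `groundEnergy_eq_minEnergy`).

*Upper bound.* The Fermi sea of the full lattice, cut off to the occupied domain `D`, is a density
matrix; it loses precisely one nearest-neighbour correlation, `|e(ρ)| / 2d`, for each pair of
neighbours in the boundary (`minEnergy_le_bulk`).

*Lower bound for electrons confined to `D`.* Let `s` be the Fermi level for the density `ρ`, and let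
`P(s) = ∫ (s - ε)₊` over the momentum torus, with `ε` the dispersion relation. In momentum space
the quantity `Tr h γ - s Tr γ + P(s) |D|` is an integral of nonnegative terms. As `γ² ≤ γ` and
`(1 - γ)² ≤ 1 - γ`, it is at least the sum over `y ∈ D` of the squared distances between the `y`-th
columns of `γ` and of the Fermi sea, with the weight `|ε - s|` (`sum_integral_columnDist_le`). If
`y` has a neighbour `x ∉ D`, the entry `(y, x)` of `γ` vanishes while that of the Fermi sea is
`|e(ρ)| / 2d > 0`, so the columns are at a positive distance; the weight cannot spoil this, because
the level sets of `ε` are null sets and thin shells around them have small measure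
(`exists_le_integral_columnDist`). Each boundary site thus costs a positive energy that is uniform
in `D` and `γ` (`exists_boundary_constant`).

*Finite `U > 4d`.* Electrons on the empty sites are separated by a gap from those on `D`, and by
Cauchy-Schwarz the hopping across the boundary gains at most `2d / (U - 4d)` per pair
(`le_energy_of_restrict`). This gives the two bounds in a finite volume (`groundEnergy_bounds`).

*Infinite volume.* Large cubes are almost filled by translates of smaller ones by periods, so the
ground state energies are almost subadditive and have limits (`exists_translates`,
`tendsto_boxEnergy`); on the constant configurations the two bounds identify them
(`energyDensity_full`).

*Ground states.* Dividing the lower bound by the volume, `e(r, ω) ≥ (s - U) r - P(s) ρ_c(ω)` for all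
periodic `ω`, strictly unless `ω` is constant, since otherwise its boundary has a positive density
(`le_energyDensity`, `lt_energyDensity`). The right-hand side is affine in the densities and hence
has the same value in all mixtures. With `s` the Fermi level for `ρ_e / ρ_c` it is attained by the
segregated state and by no other mixture (`isUniqueGroundState_segregatedBelow`). Thick periodic
slabs show that the infimum over periodic configurations is the same
(`isGLB_periodicEnergies_below`). The case of more electrons than classical particles follows by
the particle-hole transformation, which acts on mixtures by `(ω, r) ↦ (1 - ω, 1 - r)`
(`IsUniqueGroundState.hole`).
-/

set_option linter.unusedSectionVars false

namespace FalicovKimball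

noncomputable section

/-! ### One-particle density matrices and the canonical ground state energy -/

/-- A one-particle density matrix on the finite set `A`: a real symmetric kernel that vanishes
outside `A × A` and satisfies `0 ≤ γ ≤ 1` as a quadratic form. Real kernels are sufficient since
all the hopping matrices are real. -/
structure IsDensityMatrix {ι : Type*} (A : Finset ι) (γ : ι → ι → ℝ) : Prop where
  symm : ∀ x y, γ x y = γ y x
  supp : ∀ x y, x ∉ A → γ x y = 0
  nonneg : ∀ φ : ι → ℝ, 0 ≤ ∑ x ∈ A, ∑ y ∈ A, φ x * γ x y * φ y
  le_one : ∀ φ : ι → ℝ, ∑ x ∈ A, ∑ y ∈ A, φ x * γ x y * φ y ≤ ∑ x ∈ A, φ x ^ 2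

section Fock

variable {ι : Type*} [Fintype ι]

lemma innerProd_eq_dotProduct {N : ℕ} (Φ Ψ : WaveFn ι N) :
    innerProd Φ Ψ = dotProduct (star Φ) Ψ := rfl

lemma innerProd_self {N : ℕ} (Ψ : WaveFn ι N) :
    innerProd Ψ Ψ = ((∑ z, ‖Ψ z‖ ^ 2 : ℝ) : ℂ) := by
  simp only [innerProd, Complex.ofReal_sum]
  refine Finset.sum_congr rfl fun z _ => ?_
  simp [Complex.conj_mul']

/-- The second quantization of the projection onto `φ` (up to the factor `‖φ‖²`), restricted to
the `j`-th particle. -/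
def rankOne (φ : ι → ℝ) {N : ℕ} (j : Fin N) (Ψ : WaveFn ι N) : WaveFn ι N :=
  fun z => (φ (z j) : ℂ) * ∑ y, (φ y : ℂ) * Ψ (Function.update z j y)

/-- Exchanging the position of the `j`-th particle with a summation variable. -/
lemma sum_update_swap {N : ℕ} (j : Fin N) (F : (Fin N → ι) → ι → ℂ) :
    ∑ z, ∑ y, F z y = ∑ z, ∑ y, F (Function.update z j y) (z j) := by
  rw [← Finset.sum_product', ← Finset.sum_product']
  refine Finset.sum_nbij' (fun p => (Function.update p.1 j p.2, p.1 j))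
    (fun p => (Function.update p.1 j p.2, p.1 j)) ?_ ?_ ?_ ?_ ?_ <;> simp

lemma innerProd_rankOne (φ : ι → ℝ) {N : ℕ} (j : Fin N) (Φ Ψ : WaveFn ι N) :
    innerProd (rankOne φ j Φ) Ψ = innerProd Φ (rankOne φ j Ψ) := by
  simp only [innerProd, rankOne, star_mul', star_sum, Finset.mul_sum, Finset.sum_mul]
  rw [sum_update_swap j]
  refine Finset.sum_congr rfl fun z _ => Finset.sum_congr rfl fun y _ => ?_
  simp
  ring

lemma rankOne_rankOne_self (φ : ι → ℝ) {N : ℕ} (j : Fin N) (Ψ : WaveFn ι N) :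
    rankOne φ j (rankOne φ j Ψ) = ((∑ x, φ x ^ 2 : ℝ) : ℂ) • rankOne φ j Ψ := by
  funext z
  simp only [rankOne, Pi.smul_apply, smul_eq_mul, Function.update_self, Function.update_idem]
  push_cast
  simp only [← mul_assoc, ← Finset.sum_mul]
  simp only [← pow_two]
  ring

/-- Two particles in an antisymmetric state cannot both occupy `φ`. -/
lemma rankOne_rankOne_of_ne (φ : ι → ℝ) {N : ℕ} {i j : Fin N} (hij : i ≠ j) {Ψ : WaveFn ι N}
    (hΨ : Antisymmetric Ψ) : rankOne φ i (rankOne φ j Ψ) = 0 := by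
  funext z
  simp only [rankOne, Pi.zero_apply, Function.update_of_ne hij.symm, Finset.mul_sum]
  set S := ∑ y, ∑ y', (φ (z i) : ℂ) * ((φ y : ℂ) * ((φ (z j) : ℂ) * ((φ y' : ℂ) *
    Ψ (Function.update (Function.update z i y) j y')))) with hS
  have h : S = -S := by
    conv_lhs => rw [hS, Finset.sum_comm]
    rw [hS, ← Finset.sum_neg_distrib]
    refine Finset.sum_congr rfl fun y _ => ?_
    rw [← Finset.sum_neg_distrib]
    refine Finset.sum_congr rfl fun y' _ => ?_
    have h1 := hΨ (Equiv.swap i j) (Function.update (Function.update z i y) j y')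
    have h2 : (fun k => Function.update (Function.update z i y) j y' (Equiv.swap i j k)) =
        Function.update (Function.update z i y') j y := by
      funext k
      rcases eq_or_ne k i with rfl | hki
      · simp [Function.update_of_ne hij]
      · rcases eq_or_ne k j with rfl | hkj
        · simp [Function.update_of_ne hij]
        · simp [Equiv.swap_apply_of_ne_of_ne hki hkj, Function.update_of_ne hki,
            Function.update_of_ne hkj]
    rw [h2, Equiv.Perm.sign_swap hij] at h1
    rw [h1]
    push_cast
    ring
  have : (2 : ℂ) * S = 0 := by linear_combination h
  simpa using this

variable [DecidableEq ι]

/-- On antisymmetric functions, `a†_x a_y` moves one of the particles from `y` to `x`. -/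
lemma createAnnihilate_apply (x y : ι) {N : ℕ} {Ψ : WaveFn ι N} (hΨ : Antisymmetric Ψ)
    (z : Fin N → ι) :
    createAnnihilate x y Ψ z = ∑ j, if z j = x then Ψ (Function.update z j y) else 0 := by
  cases N with
  | zero => simp [createAnnihilate]
  | succ n =>
    simp only [createAnnihilate, create, annihilate, Finset.mul_sum]
    refine Finset.sum_congr rfl fun j _ => ?_
    split_ifs with h
    · have key : (Fin.cons y (fun i => z (j.succAbove i)) : Fin (n + 1) → ι) =
          fun i => Function.update z j y (j.cycleRange.symm i) := by
        rw [← Fin.insertNth_comp_cycleRange_symm (p := j)]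
        funext i
        simp only [Function.comp]
        exact congrFun (Fin.insertNth_removeNth j y z) _
      -- Moving the new particle from the front to position `j` costs the sign `(-1) ^ j`.
      rw [key, hΨ, Equiv.Perm.sign_symm, Fin.sign_cycleRange]
      have h1 : (Real.sqrt ((n : ℝ) + 1) : ℂ) ≠ 0 := by
        norm_cast
        positivity
      push_cast
      have h2 : ((-1 : ℂ) ^ (j : ℕ)) * (-1) ^ (j : ℕ) = 1 := by
        rw [← mul_pow]; simp
      field_simp
      linear_combination (Ψ (Function.update z j y)) * h2
    · simp

/-- The one-particle density matrix of an `N`-particle function. The real part suffices, because it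
is paired with real symmetric matrices only. -/
def reducedMatrix {N : ℕ} (Ψ : WaveFn ι N) (x y : ι) : ℝ :=
  (innerProd Ψ (createAnnihilate x y Ψ)).re

lemma quadForm_reducedMatrix {N : ℕ} {Ψ : WaveFn ι N} (hΨ : Antisymmetric Ψ) (φ : ι → ℝ) :
    ∑ x, ∑ y, φ x * reducedMatrix Ψ x y * φ y =
      (innerProd Ψ (∑ j, rankOne φ j Ψ)).re := by
  have h : ∀ x y, φ x * reducedMatrix Ψ x y * φ y =
      (∑ z, ∑ j, if z j = x then
        star (Ψ z) * ((φ x : ℂ) * ((φ y : ℂ) * Ψ (Function.update z j y))) else 0).re := by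
    intro x y
    have : φ x * reducedMatrix Ψ x y * φ y =
        (((φ x * φ y : ℝ) : ℂ) * innerProd Ψ (createAnnihilate x y Ψ)).re := by
      rw [Complex.re_ofReal_mul, reducedMatrix]; ring
    rw [this]
    congr 1
    simp only [innerProd, createAnnihilate_apply x y hΨ, Finset.mul_sum]
    refine Finset.sum_congr rfl fun z _ => Finset.sum_congr rfl fun j _ => ?_
    split_ifs
    · push_cast; ring
    · simp
  simp only [h, ← Complex.re_sum]
  congr 1
  simp only [innerProd, Finset.sum_apply, rankOne, Finset.mul_sum]
  calc _ = ∑ x, ∑ z, ∑ y, ∑ j : Fin N, (if z j = x then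
        star (Ψ z) * ((φ x : ℂ) * ((φ y : ℂ) * Ψ (Function.update z j y))) else 0) :=
        Finset.sum_congr rfl fun x _ => Finset.sum_comm
    _ = ∑ z, ∑ x, ∑ y, ∑ j : Fin N, (if z j = x then
        star (Ψ z) * ((φ x : ℂ) * ((φ y : ℂ) * Ψ (Function.update z j y))) else 0) :=
        Finset.sum_comm
    _ = _ := by
        refine Finset.sum_congr rfl fun z _ => ?_
        calc _ = ∑ x, ∑ j : Fin N, ∑ y, (if z j = x then
              star (Ψ z) * ((φ x : ℂ) * ((φ y : ℂ) * Ψ (Function.update z j y))) else 0) :=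
              Finset.sum_congr rfl fun x _ => Finset.sum_comm
          _ = _ := by
              rw [Finset.sum_comm]
              refine Finset.sum_congr rfl fun j _ => ?_
              rw [Finset.sum_comm]
              refine Finset.sum_congr rfl fun y _ => ?_
              simp

lemma reducedMatrix_symm {N : ℕ} {Ψ : WaveFn ι N} (hΨ : Antisymmetric Ψ) (x y : ι) :
    reducedMatrix Ψ x y = reducedMatrix Ψ y x := by
  have h : innerProd Ψ (createAnnihilate x y Ψ) =
      star (innerProd Ψ (createAnnihilate y x Ψ)) := by
    have e : ∀ x y : ι, innerProd Ψ (createAnnihilate x y Ψ) = ∑ j : Fin N, ∑ z, ∑ w,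
        (if z j = x ∧ w = y then star (Ψ z) * Ψ (Function.update z j w) else 0) := by
      intro x y
      simp only [innerProd, createAnnihilate_apply x y hΨ, Finset.mul_sum]
      rw [Finset.sum_comm]
      refine Finset.sum_congr rfl fun j _ => Finset.sum_congr rfl fun z _ => ?_
      by_cases hz : z j = x <;> simp [hz]
    rw [e x y, e y x, star_sum]
    refine Finset.sum_congr rfl fun j _ => ?_
    rw [sum_update_swap j]
    simp only [star_sum]
    refine Finset.sum_congr rfl fun z _ => Finset.sum_congr rfl fun w _ => ?_
    by_cases h1 : z j = y
    · subst h1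
      by_cases h2 : w = x <;> simp [h2, mul_comm]
    · simp [h1]
  rw [reducedMatrix, h, reducedMatrix]
  simp

lemma sum_reducedMatrix_self {N : ℕ} {Ψ : WaveFn ι N} (hΨ : Antisymmetric Ψ)
    (h1 : innerProd Ψ Ψ = 1) : ∑ x, reducedMatrix Ψ x x = N := by
  have h : ∑ x, innerProd Ψ (createAnnihilate x x Ψ) = N := by
    simp only [innerProd, createAnnihilate_apply _ _ hΨ]
    rw [Finset.sum_comm]
    have : ∀ z : Fin N → ι, ∑ x, star (Ψ z) *
        (∑ j, if z j = x then Ψ (Function.update z j x) else 0) = N * (star (Ψ z) * Ψ z) := by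
      intro z
      rw [← Finset.mul_sum, Finset.sum_comm]
      simp
      ring
    rw [Finset.sum_congr rfl fun z _ => this z, ← Finset.mul_sum]
    change (N : ℂ) * innerProd Ψ Ψ = N
    rw [h1, mul_one]
  simp only [reducedMatrix, ← Complex.re_sum, h]
  simp

/-- The Pauli principle: the density matrix of an antisymmetric function is bounded by `1`. With
`T` the second quantization of `|φ⟩⟨φ|` one has `T² = ‖φ‖² T`. -/
lemma isDensityMatrix_reducedMatrix {N : ℕ} {Ψ : WaveFn ι N} (hΨ : Antisymmetric Ψ)
    (h1 : innerProd Ψ Ψ = 1) : IsDensityMatrix Finset.univ (reducedMatrix Ψ) := by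
  have key : ∀ φ : ι → ℝ, 0 < ∑ x, φ x ^ 2 →
      0 ≤ ∑ x, ∑ y, φ x * reducedMatrix Ψ x y * φ y ∧
      ∑ x, ∑ y, φ x * reducedMatrix Ψ x y * φ y ≤ ∑ x, φ x ^ 2 := by
    intro φ hs
    rw [quadForm_reducedMatrix hΨ]
    set s : ℝ := ∑ x, φ x ^ 2 with hsdef
    set T := ∑ j, rankOne φ j Ψ with hT
    -- The products of two different `rankOne` vanish, hence `T` is `s` times a projection.
    have hTT : innerProd T T = s * innerProd Ψ T := by
      have : ∀ i, innerProd (rankOne φ i Ψ) T = s * innerProd Ψ (rankOne φ i Ψ) := by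
        intro i
        have : ∀ j, innerProd (rankOne φ i Ψ) (rankOne φ j Ψ) =
            if i = j then s * innerProd Ψ (rankOne φ i Ψ) else 0 := by
          intro j
          rw [innerProd_rankOne]
          split_ifs with hij
          · subst hij
            rw [rankOne_rankOne_self, innerProd_eq_dotProduct, dotProduct_smul]
            rfl
          · rw [rankOne_rankOne_of_ne φ hij hΨ, innerProd_eq_dotProduct, dotProduct_zero]
        rw [hT, innerProd_eq_dotProduct, dotProduct_sum]
        simp only [← innerProd_eq_dotProduct, this]
        simp
      conv_lhs => rw [hT]
      rw [innerProd_eq_dotProduct, star_sum, sum_dotProduct]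
      simp only [← innerProd_eq_dotProduct]
      rw [← hT, Finset.sum_congr rfl fun i _ => this i, ← Finset.mul_sum]
      conv_rhs => rw [hT, innerProd_eq_dotProduct, dotProduct_sum]
      rfl
    have hsym : innerProd T Ψ = innerProd Ψ T := by
      rw [hT, innerProd_eq_dotProduct, star_sum, sum_dotProduct, innerProd_eq_dotProduct,
        dotProduct_sum]
      exact Finset.sum_congr rfl fun j _ => innerProd_rankOne φ j Ψ Ψ
    have hpos : ∀ Φ : WaveFn ι N, 0 ≤ (innerProd Φ Φ).re := by
      intro Φ
      rw [innerProd_self, Complex.ofReal_re]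
      positivity
    have p1 := hpos T
    rw [hTT, Complex.re_ofReal_mul] at p1
    -- `‖s Ψ - T‖² = s (s - ⟨Ψ, T⟩)` gives the bound from above.
    have p2 := hpos ((s : ℂ) • Ψ - T)
    have e2 : innerProd ((s : ℂ) • Ψ - T) ((s : ℂ) • Ψ - T) = (s : ℂ) * (s - innerProd Ψ T) := by
      simp only [innerProd_eq_dotProduct, star_sub, star_smul, sub_dotProduct, dotProduct_sub,
        smul_dotProduct, dotProduct_smul]
      simp only [← innerProd_eq_dotProduct, h1, hTT, hsym]
      simp
    rw [e2, Complex.re_ofReal_mul] at p2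
    have p2' := nonneg_of_mul_nonneg_right p2 hs
    rw [Complex.sub_re, Complex.ofReal_re] at p2'
    exact ⟨nonneg_of_mul_nonneg_right p1 hs, by linarith⟩
  have key' : ∀ φ : ι → ℝ, ¬ 0 < ∑ x, φ x ^ 2 → φ = 0 := by
    intro φ h
    have h0 : ∑ x, φ x ^ 2 = 0 := le_antisymm (not_lt.1 h) (by positivity)
    funext x
    have := (Finset.sum_eq_zero_iff_of_nonneg (fun i _ => sq_nonneg (φ i))).1 h0 x
      (Finset.mem_univ x)
    simpa using this
  refine ⟨reducedMatrix_symm hΨ, by simp, fun φ => ?_, fun φ => ?_⟩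
  · by_cases h : 0 < ∑ x, φ x ^ 2
    · exact (key φ h).1
    · simp [key' φ h]
  · by_cases h : 0 < ∑ x, φ x ^ 2
    · exact (key φ h).2
    · simp [key' φ h]

/-! #### Slater determinants and the variational principle -/

/-- The spectral theorem in coordinates: orthonormality, completeness and the eigenvalue
equation. -/
lemma exists_eigenbasis {h : Matrix ι ι ℝ} (hh : h.IsHermitian) :
    ∃ (φ : ι → ι → ℝ) (ev : ι → ℝ),
      (∀ i j, ∑ x, φ i x * φ j x = if i = j then 1 else 0) ∧
      (∀ x y, ∑ j, φ j x * φ j y = if x = y then 1 else 0) ∧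
      ∀ j x, ∑ y, h x y * φ j y = ev j * φ j x := by
  refine ⟨fun j x => hh.eigenvectorUnitary.1 x j, hh.eigenvalues, fun i j => ?_, fun x y => ?_,
    fun j x => ?_⟩
  · have := congrFun (congrFun (Matrix.mem_unitaryGroup_iff'.1 hh.eigenvectorUnitary.2) i) j
    simpa [Matrix.mul_apply, Matrix.one_apply, Matrix.star_apply] using this
  · have := congrFun (congrFun (Matrix.mem_unitaryGroup_iff.1 hh.eigenvectorUnitary.2) x) y
    simpa [Matrix.mul_apply, Matrix.one_apply, Matrix.star_apply] using this
  · have := congrFun (hh.mulVec_eigenvectorBasis j) x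
    simpa [Matrix.mulVec, dotProduct, Matrix.IsHermitian.eigenvectorUnitary_apply] using this

/-- The (unnormalized) Slater determinant of the orbitals `φ i`. -/
def slater {N : ℕ} (φ : Fin N → ι → ℝ) : WaveFn ι N :=
  fun z => Matrix.det (Matrix.of fun i k => (φ i (z k) : ℂ))

lemma slater_apply {N : ℕ} (φ : Fin N → ι → ℝ) (z : Fin N → ι) :
    slater φ z = ∑ σ : Equiv.Perm (Fin N), ((Equiv.Perm.sign σ : ℤ) : ℂ) *
      ∏ i, (φ (σ i) (z i) : ℂ) := by
  simp [slater, Matrix.det_apply']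

lemma antisymmetric_slater {N : ℕ} (φ : Fin N → ι → ℝ) : Antisymmetric (slater φ) := by
  intro σ z
  exact Matrix.det_permute' σ (Matrix.of fun i k => (φ i (z k) : ℂ))

lemma slater_ne_zero {N : ℕ} {φ : Fin N → ι → ℝ}
    (hφ : ∀ i j, ∑ x, φ i x * φ j x = if i = j then 1 else 0) : slater φ ≠ 0 := by
  intro h0
  have h1 : ∑ z, (∏ i, (φ i (z i) : ℂ)) * slater φ z = 1 := by
    simp only [slater_apply, Finset.mul_sum]
    rw [Finset.sum_comm]
    rw [← Matrix.det_one (n := Fin N) (R := ℂ), Matrix.det_apply']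
    refine Finset.sum_congr rfl fun σ _ => ?_
    have h2 : ∏ i, ∑ x, ((φ i x : ℂ) * (φ (σ i) x : ℂ)) =
        ∏ i, (1 : Matrix (Fin N) (Fin N) ℂ) (σ i) i := by
      refine Finset.prod_congr rfl fun i _ => ?_
      have := hφ i (σ i)
      rw [Matrix.one_apply]
      have h3 : ((∑ x, φ i x * φ (σ i) x : ℝ) : ℂ) = if σ i = i then 1 else 0 := by
        rw [this]
        by_cases hi : σ i = i
        · rw [if_pos hi, if_pos hi.symm, Complex.ofReal_one]
        · rw [if_neg hi, if_neg (Ne.symm hi), Complex.ofReal_zero]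
      push_cast at h3
      exact h3
    rw [← h2, Finset.prod_univ_sum, Finset.mul_sum, Fintype.piFinset_univ]
    refine Finset.sum_congr rfl fun z _ => ?_
    rw [Finset.prod_mul_distrib]
    ring
  simp [h0] at h1

/-- The operator `∑ h x y a†_x a_y`. -/
def secondQuantize (h : ι → ι → ℝ) {N : ℕ} (Ψ : WaveFn ι N) : WaveFn ι N :=
  ∑ x, ∑ y, (h x y : ℂ) • createAnnihilate x y Ψ

lemma secondQuantize_apply (h : ι → ι → ℝ) {N : ℕ} {Ψ : WaveFn ι N} (hΨ : Antisymmetric Ψ)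
    (z : Fin N → ι) :
    secondQuantize h Ψ z = ∑ j, ∑ y, (h (z j) y : ℂ) * Ψ (Function.update z j y) := by
  simp only [secondQuantize, Finset.sum_apply, Pi.smul_apply, createAnnihilate_apply _ _ hΨ,
    smul_eq_mul, Finset.mul_sum]
  calc _ = ∑ x, ∑ j : Fin N, ∑ y, (h x y : ℂ) *
        (if z j = x then Ψ (Function.update z j y) else 0) :=
        Finset.sum_congr rfl fun x _ => Finset.sum_comm
    _ = _ := by
        rw [Finset.sum_comm]
        refine Finset.sum_congr rfl fun j _ => ?_
        rw [Finset.sum_comm]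
        refine Finset.sum_congr rfl fun y _ => ?_
        simp

lemma re_innerProd_secondQuantize (h : ι → ι → ℝ) {N : ℕ} (Ψ : WaveFn ι N) :
    (innerProd Ψ (secondQuantize h Ψ)).re = ∑ x, ∑ y, h x y * reducedMatrix Ψ x y := by
  simp only [secondQuantize, innerProd_eq_dotProduct, dotProduct_sum, dotProduct_smul,
    Complex.re_sum, smul_eq_mul, Complex.re_ofReal_mul]
  rfl

lemma secondQuantize_slater {h : ι → ι → ℝ} {N : ℕ} {φ : Fin N → ι → ℝ} {ev : Fin N → ℝ}
    (hev : ∀ j x, ∑ y, h x y * φ j y = ev j * φ j x) :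
    secondQuantize h (slater φ) = ((∑ j, ev j : ℝ) : ℂ) • slater φ := by
  funext z
  rw [secondQuantize_apply h (antisymmetric_slater φ), Pi.smul_apply, smul_eq_mul]
  simp only [slater_apply, Finset.mul_sum]
  have step : ∀ (σ : Equiv.Perm (Fin N)) (j : Fin N),
      ∑ y, (h (z j) y : ℂ) * (((Equiv.Perm.sign σ : ℤ) : ℂ) *
        ∏ i, (φ (σ i) (Function.update z j y i) : ℂ)) =
      (ev (σ j) : ℂ) * (((Equiv.Perm.sign σ : ℤ) : ℂ) * ∏ i, (φ (σ i) (z i) : ℂ)) := by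
    intro σ j
    have h1 : ∀ y, ∏ i, (φ (σ i) (Function.update z j y i) : ℂ) =
        (φ (σ j) y : ℂ) * ∏ i ∈ Finset.univ.erase j, (φ (σ i) (z i) : ℂ) := by
      intro y
      rw [← Finset.mul_prod_erase _ _ (Finset.mem_univ j), Function.update_self]
      congr 1
      refine Finset.prod_congr rfl fun i hi => ?_
      rw [Function.update_of_ne (Finset.ne_of_mem_erase hi)]
    have h2 : ∑ y, (h (z j) y : ℂ) * (φ (σ j) y : ℂ) = (ev (σ j) : ℂ) * (φ (σ j) (z j) : ℂ) := by
      have := congrArg (fun r : ℝ => (r : ℂ)) (hev (σ j) (z j))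
      push_cast at this
      exact this
    rw [← Finset.mul_prod_erase _ _ (Finset.mem_univ j)]
    calc _ = (∑ y, (h (z j) y : ℂ) * (φ (σ j) y : ℂ)) * (((Equiv.Perm.sign σ : ℤ) : ℂ) *
          ∏ i ∈ Finset.univ.erase j, (φ (σ i) (z i) : ℂ)) := by
          rw [Finset.sum_mul]
          refine Finset.sum_congr rfl fun y _ => ?_
          rw [h1]; ring
      _ = _ := by rw [h2]; ring
  calc _ = ∑ j, ∑ σ : Equiv.Perm (Fin N), ∑ y, (h (z j) y : ℂ) * (((Equiv.Perm.sign σ : ℤ) : ℂ) *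
        ∏ i, (φ (σ i) (Function.update z j y i) : ℂ)) :=
        Finset.sum_congr rfl fun j _ => Finset.sum_comm
    _ = ∑ σ : Equiv.Perm (Fin N), ∑ j, (ev (σ j) : ℂ) *
        (((Equiv.Perm.sign σ : ℤ) : ℂ) * ∏ i, (φ (σ i) (z i) : ℂ)) := by
        simp only [step]
        exact Finset.sum_comm
    _ = _ := by
        refine Finset.sum_congr rfl fun σ _ => ?_
        rw [← Finset.sum_mul, Equiv.sum_comp σ (fun j => (ev j : ℂ))]
        push_cast
        rfl

/-- The bathtub principle: among the weights in `[0, 1]` with sum `N`, the indicator function of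
some set of cardinality `N` minimizes `∑ ev x * w x`. -/
lemma exists_bathtub (ev : ι → ℝ) {N : ℕ} (hN : N ≤ Fintype.card ι) :
    ∃ e : Fin N → ι, Function.Injective e ∧ ∀ w : ι → ℝ, (∀ x, 0 ≤ w x) → (∀ x, w x ≤ 1) →
      ∑ x, w x = N → ∑ i, ev (e i) ≤ ∑ x, ev x * w x := by
  obtain ⟨J, hJ, hmin⟩ := Finset.exists_min_image (Finset.powersetCard N (Finset.univ : Finset ι))
    (fun J => ∑ x ∈ J, ev x) (Finset.powersetCard_nonempty.2 (by simpa using hN))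
  have hJc : J.card = N := (Finset.mem_powersetCard.1 hJ).2
  have hex : ∀ i ∈ J, ∀ j ∉ J, ev i ≤ ev j := by
    intro i hi j hj
    have hj' : j ∉ J.erase i := fun h => hj (Finset.mem_of_mem_erase h)
    have := hmin (insert j (J.erase i)) (Finset.mem_powersetCard.2 ⟨Finset.subset_univ _, by
      rw [Finset.card_insert_of_notMem hj', Finset.card_erase_add_one hi, hJc]⟩)
    rw [Finset.sum_insert hj', ← Finset.add_sum_erase J ev hi] at this
    linarith
  -- A level that separates the `N` lowest values from the other ones.
  obtain ⟨m, hm1, hm2⟩ : ∃ m : ℝ, (∀ i ∈ J, ev i ≤ m) ∧ ∀ j ∉ J, m ≤ ev j := by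
    rcases J.eq_empty_or_nonempty with rfl | hne
    · by_cases hι : (Finset.univ : Finset ι).Nonempty
      · obtain ⟨b, -, hb⟩ := Finset.exists_min_image Finset.univ ev hι
        exact ⟨ev b, by simp, fun j _ => hb j (Finset.mem_univ j)⟩
      · exact ⟨0, by simp, fun j _ => (hι ⟨j, Finset.mem_univ j⟩).elim⟩
    · obtain ⟨b, hbJ, hb⟩ := Finset.exists_max_image J ev hne
      exact ⟨ev b, hb, fun j hj => hex b hbJ j hj⟩
  let eq := (Finset.equivFinOfCardEq hJc).symm
  refine ⟨fun i => (eq i : ι), Subtype.val_injective.comp eq.injective, fun w h0 h1 hw => ?_⟩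
  have hs : ∑ i, ev (eq i : ι) = ∑ x ∈ J, ev x := by
    rw [Equiv.sum_comp eq (fun x : J => ev x), Finset.sum_coe_sort J ev]
  rw [hs]
  have hpt : ∑ x, (if x ∈ J then ev x - m else 0) ≤ ∑ x, (ev x - m) * w x := by
    refine Finset.sum_le_sum fun x _ => ?_
    split_ifs with hx
    · nlinarith [hm1 x hx, h1 x]
    · exact mul_nonneg (sub_nonneg.2 (hm2 x hx)) (h0 x)
  simp only [sub_mul, Finset.sum_sub_distrib, ← Finset.mul_sum, hw, Finset.sum_ite_mem,
    Finset.univ_inter, Finset.sum_const, hJc, nsmul_eq_mul] at hpt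
  linarith

/-- The canonical ground state energy is the minimum of `Tr h γ` over the density matrices `γ` with
trace `N`. -/
theorem isLeast_secondQuantize {h : ι → ι → ℝ} (hh : ∀ x y, h x y = h y x) {N : ℕ}
    (hN : N ≤ Fintype.card ι) :
    IsLeast {E | ∃ γ, IsDensityMatrix Finset.univ γ ∧ ∑ x, γ x x = N ∧
        E = ∑ x, ∑ y, h x y * γ x y}
      (sInf {E | ∃ Ψ : WaveFn ι N, Antisymmetric Ψ ∧ innerProd Ψ Ψ = 1 ∧
        E = (innerProd Ψ (secondQuantize h Ψ)).re}) := by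
  obtain ⟨φ, ev, ho, hc, hev⟩ := exists_eigenbasis (h := Matrix.of h)
    (Matrix.IsHermitian.ext fun x y => by simp [hh x y])
  simp only [Matrix.of_apply] at hev
  obtain ⟨e, he, hbt⟩ := exists_bathtub ev hN
  have hspec : ∀ x y, h x y = ∑ j, ev j * (φ j x * φ j y) := by
    intro x y
    calc h x y = ∑ z, h x z * ∑ j, φ j z * φ j y := by simp [hc]
      _ = ∑ j, (∑ z, h x z * φ j z) * φ j y := by
        simp only [Finset.mul_sum, Finset.sum_mul]
        rw [Finset.sum_comm]
        exact Finset.sum_congr rfl fun j _ => Finset.sum_congr rfl fun z _ => by ring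
      _ = _ := by
        simp only [hev]
        exact Finset.sum_congr rfl fun j _ => by ring
  have hlow : ∀ γ, IsDensityMatrix Finset.univ γ → ∑ x, γ x x = N →
      ∑ i, ev (e i) ≤ ∑ x, ∑ y, h x y * γ x y := by
    intro γ hγ htr
    have hre : ∀ c : ι → ℝ, ∑ x, ∑ y, (∑ j, c j * (φ j x * φ j y)) * γ x y =
        ∑ j, c j * ∑ x, ∑ y, φ j x * γ x y * φ j y := by
      intro c
      simp only [Finset.mul_sum, Finset.sum_mul]
      calc _ = ∑ x, ∑ j, ∑ y, c j * (φ j x * φ j y) * γ x y :=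
            Finset.sum_congr rfl fun x _ => Finset.sum_comm
        _ = _ := by
            rw [Finset.sum_comm]
            exact Finset.sum_congr rfl fun j _ => Finset.sum_congr rfl fun x _ =>
              Finset.sum_congr rfl fun y _ => by ring
    have e1 := hre ev
    have e2 := hre 1
    simp only [← hspec] at e1
    simp only [Pi.one_apply, one_mul, hc, ite_mul, zero_mul] at e2
    rw [e1]
    refine hbt _ (fun j => hγ.nonneg (φ j)) (fun j => (hγ.le_one (φ j)).trans ?_) ?_
    · have := ho j j
      simp only [if_true, ← pow_two] at this
      exact this.le
    · rw [← e2, ← htr]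
      simp
  have hred : ∀ Ψ : WaveFn ι N, Antisymmetric Ψ → innerProd Ψ Ψ = 1 →
      ∑ i, ev (e i) ≤ (innerProd Ψ (secondQuantize h Ψ)).re := by
    intro Ψ h1 h2
    rw [re_innerProd_secondQuantize]
    exact hlow _ (isDensityMatrix_reducedMatrix h1 h2) (sum_reducedMatrix_self h1 h2)
  obtain ⟨Ψ, hΨa, hΨ1, hΨE⟩ : ∃ Ψ : WaveFn ι N, Antisymmetric Ψ ∧ innerProd Ψ Ψ = 1 ∧
      (innerProd Ψ (secondQuantize h Ψ)).re = ∑ i, ev (e i) := by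
    set S := slater (fun i => φ (e i)) with hS
    have hne : S ≠ 0 := slater_ne_zero fun i j => by
      rw [ho]; simp [he.eq_iff]
    set n : ℝ := ∑ z, ‖S z‖ ^ 2 with hn
    have hnpos : 0 < n := by
      obtain ⟨z, hz⟩ := Function.ne_iff.1 hne
      exact Finset.sum_pos' (fun z _ => by positivity) ⟨z, Finset.mem_univ z, by
        have : 0 < ‖S z‖ := norm_pos_iff.2 hz
        positivity⟩
    have hSS : innerProd S S = (n : ℂ) := innerProd_self S
    set c : ℝ := (Real.sqrt n)⁻¹ with hcdef
    have hcn : c * c * n = 1 := by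
      have : Real.sqrt n * Real.sqrt n = n := Real.mul_self_sqrt hnpos.le
      have h0 : Real.sqrt n ≠ 0 := (Real.sqrt_pos.2 hnpos).ne'
      rw [hcdef]
      field_simp
      nlinarith
    have hanti : Antisymmetric ((c : ℂ) • S) := by
      intro σ z
      have := antisymmetric_slater (fun i => φ (e i)) σ z
      simp only [Pi.smul_apply, smul_eq_mul, hS, this]
      ring
    have hnorm : innerProd ((c : ℂ) • S) ((c : ℂ) • S) = 1 := by
      simp only [innerProd_eq_dotProduct, star_smul, smul_dotProduct, dotProduct_smul]
      rw [← innerProd_eq_dotProduct, hSS]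
      simp only [smul_eq_mul, Complex.star_def, Complex.conj_ofReal]
      rw [← mul_assoc]
      exact_mod_cast hcn
    refine ⟨(c : ℂ) • S, hanti, hnorm, ?_⟩
    have hq : secondQuantize h ((c : ℂ) • S) =
        ((∑ i, ev (e i) : ℝ) : ℂ) • ((c : ℂ) • S) := by
      have h1 : secondQuantize h S = ((∑ i, ev (e i) : ℝ) : ℂ) • S :=
        secondQuantize_slater fun j x => hev (e j) x
      rw [smul_comm, ← h1]
      funext z
      rw [secondQuantize_apply h hanti, Pi.smul_apply,
        secondQuantize_apply h (antisymmetric_slater _)]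
      simp only [Pi.smul_apply, smul_eq_mul, Finset.mul_sum]
      exact Finset.sum_congr rfl fun j _ => Finset.sum_congr rfl fun y _ => by ring
    rw [hq, innerProd_eq_dotProduct, dotProduct_smul, ← innerProd_eq_dotProduct, hnorm]
    simp
  have hmin : IsLeast {E | ∃ Ψ : WaveFn ι N, Antisymmetric Ψ ∧ innerProd Ψ Ψ = 1 ∧
      E = (innerProd Ψ (secondQuantize h Ψ)).re} (∑ i, ev (e i)) := by
    refine ⟨⟨Ψ, hΨa, hΨ1, hΨE.symm⟩, ?_⟩
    rintro E ⟨Φ, h1, h2, rfl⟩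
    exact hred Φ h1 h2
  rw [hmin.csInf_eq]
  refine ⟨⟨reducedMatrix Ψ, isDensityMatrix_reducedMatrix hΨa hΨ1,
    sum_reducedMatrix_self hΨa hΨ1, ?_⟩, ?_⟩
  · rw [← hΨE, re_innerProd_secondQuantize]
  · rintro E ⟨γ, h1, h2, rfl⟩
    exact hlow γ h1 h2

end Fock

/-! ### Constructions of density matrices -/

section DensityMatrix

variable {ι : Type*}

lemma sum_sum_subset {A B : Finset ι} (hAB : A ⊆ B) {F : ι → ι → ℝ}
    (h1 : ∀ x y, x ∉ A → F x y = 0) (h2 : ∀ x y, y ∉ A → F x y = 0) :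
    ∑ x ∈ B, ∑ y ∈ B, F x y = ∑ x ∈ A, ∑ y ∈ A, F x y := by
  symm
  calc _ = ∑ x ∈ A, ∑ y ∈ B, F x y := Finset.sum_congr rfl fun x _ =>
        Finset.sum_subset hAB fun y _ hy => h2 x y hy
    _ = _ := Finset.sum_subset hAB fun x _ hx => Finset.sum_eq_zero fun y _ => h1 x y hx

namespace IsDensityMatrix

lemma supp' {A : Finset ι} {γ : ι → ι → ℝ} (h : IsDensityMatrix A γ) (x y : ι) (hy : y ∉ A) :
    γ x y = 0 := by rw [h.symm, h.supp y x hy]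

lemma zero (A : Finset ι) : IsDensityMatrix A (fun _ _ => 0) :=
  ⟨by simp, by simp, by simp, fun φ => by
    simpa using Finset.sum_nonneg fun x _ => sq_nonneg (φ x)⟩

lemma combine {A : Finset ι} {γ γ' : ι → ι → ℝ} (h : IsDensityMatrix A γ)
    (h' : IsDensityMatrix A γ') {s t : ℝ} (hs : 0 ≤ s) (ht : 0 ≤ t) (hst : s + t = 1) :
    IsDensityMatrix A (fun x y => s * γ x y + t * γ' x y) := by
  have e : ∀ φ : ι → ℝ, ∑ x ∈ A, ∑ y ∈ A, φ x * (s * γ x y + t * γ' x y) * φ y =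
      s * ∑ x ∈ A, ∑ y ∈ A, φ x * γ x y * φ y + t * ∑ x ∈ A, ∑ y ∈ A, φ x * γ' x y * φ y := by
    intro φ
    simp only [Finset.mul_sum, ← Finset.sum_add_distrib]
    exact Finset.sum_congr rfl fun x _ => Finset.sum_congr rfl fun y _ => by ring
  refine ⟨fun x y => by rw [h.symm, h'.symm],
    fun x y hx => by simp [h.supp x y hx, h'.supp x y hx], fun φ => ?_, fun φ => ?_⟩
  · rw [e]
    have := h.nonneg φ
    have := h'.nonneg φ
    positivity
  · rw [e]
    calc _ ≤ s * ∑ x ∈ A, φ x ^ 2 + t * ∑ x ∈ A, φ x ^ 2 :=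
          add_le_add (mul_le_mul_of_nonneg_left (h.le_one φ) hs)
            (mul_le_mul_of_nonneg_left (h'.le_one φ) ht)
      _ = _ := by rw [← add_mul, hst, one_mul]

variable [DecidableEq ι]

lemma one (A : Finset ι) : IsDensityMatrix A (fun x y => if x = y ∧ x ∈ A then 1 else 0) := by
  have e : ∀ φ : ι → ℝ, ∑ x ∈ A, ∑ y ∈ A, φ x * (if x = y ∧ x ∈ A then 1 else 0) * φ y =
      ∑ x ∈ A, φ x ^ 2 := by
    intro φ
    refine Finset.sum_congr rfl fun x hx => ?_
    simp [hx, pow_two]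
  refine ⟨fun x y => ?_, fun x y hx => by simp [hx], fun φ => ?_, fun φ => (e φ).le⟩
  · by_cases h : x = y
    · subst h; rfl
    · simp [h, Ne.symm h]
  · rw [e]
    positivity

/-- The density matrix of the holes. -/
lemma compl {A : Finset ι} {γ : ι → ι → ℝ} (h : IsDensityMatrix A γ) :
    IsDensityMatrix A (fun x y => (if x = y ∧ x ∈ A then 1 else 0) - γ x y) := by
  have e : ∀ φ : ι → ℝ, ∑ x ∈ A, ∑ y ∈ A, φ x * ((if x = y ∧ x ∈ A then 1 else 0) - γ x y) * φ y =
      ∑ x ∈ A, φ x ^ 2 - ∑ x ∈ A, ∑ y ∈ A, φ x * γ x y * φ y := by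
    intro φ
    rw [← Finset.sum_sub_distrib]
    refine Finset.sum_congr rfl fun x hx => ?_
    simp only [mul_sub, sub_mul, Finset.sum_sub_distrib]
    simp [hx, pow_two]
  refine ⟨fun x y => by rw [(one A).symm, h.symm], fun x y hx => by simp [hx, h.supp x y hx],
    fun φ => ?_, fun φ => ?_⟩
  · rw [e]; linarith [h.le_one φ]
  · rw [e]; linarith [h.nonneg φ]

lemma diag_nonneg {A : Finset ι} {γ : ι → ι → ℝ} (h : IsDensityMatrix A γ) (x : ι) :
    0 ≤ γ x x := by
  by_cases hx : x ∈ A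
  · have := h.nonneg (fun z => if z = x then 1 else 0)
    simpa [hx] using this
  · rw [h.supp x x hx]

lemma diag_le_one {A : Finset ι} {γ : ι → ι → ℝ} (h : IsDensityMatrix A γ) (x : ι) :
    γ x x ≤ 1 := by
  by_cases hx : x ∈ A
  · have := h.le_one (fun z => if z = x then 1 else 0)
    simpa [hx] using this
  · rw [h.supp x x hx]; exact zero_le_one

lemma quadForm_pair {A : Finset ι} {γ : ι → ι → ℝ} (h : IsDensityMatrix A γ) (x y : ι) (s : ℝ) :
    0 ≤ γ x x + 2 * s * γ x y + s ^ 2 * γ y y := by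
  by_cases hx : x ∈ A
  swap
  · have := mul_nonneg (sq_nonneg s) (h.diag_nonneg y)
    rw [h.supp x y hx, h.supp x x hx]
    linarith
  by_cases hy : y ∈ A
  swap
  · have := h.diag_nonneg x
    rw [h.supp' x y hy, h.supp y y hy]
    linarith
  have e : ∑ a ∈ A, ∑ b ∈ A, ((if a = x then 1 else 0) + s * (if a = y then 1 else 0)) * γ a b *
      ((if b = x then 1 else 0) + s * (if b = y then 1 else 0)) =
      γ x x + 2 * s * γ x y + s ^ 2 * γ y y := by
    simp only [add_mul, mul_add, Finset.sum_add_distrib, ite_mul, mul_ite, zero_mul, mul_zero,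
      one_mul, mul_one, Finset.sum_ite_eq', hx, hy, if_true]
    rw [h.symm y x]
    ring
  rw [← e]
  exact h.nonneg _

lemma abs_le_half {A : Finset ι} {γ : ι → ι → ℝ} (h : IsDensityMatrix A γ) (x y : ι) :
    |γ x y| ≤ (γ x x + γ y y) / 2 := by
  rw [abs_le]
  constructor
  · linarith [h.quadForm_pair x y 1]
  · linarith [h.quadForm_pair x y (-1)]

/-- For a density matrix, `γ² ≤ γ`. -/
lemma sum_sq_le {A : Finset ι} {γ : ι → ι → ℝ} (h : IsDensityMatrix A γ) (φ : ι → ℝ) :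
    ∑ x ∈ A, (∑ y ∈ A, γ x y * φ y) ^ 2 ≤ ∑ x ∈ A, ∑ y ∈ A, φ x * γ x y * φ y := by
  set ψ : ι → ℝ := fun x => ∑ y ∈ A, γ x y * φ y with hψ
  have h1 : ∑ x ∈ A, ∑ y ∈ A, ψ x * γ x y * φ y = ∑ x ∈ A, ψ x ^ 2 := by
    refine Finset.sum_congr rfl fun x _ => ?_
    rw [pow_two]
    conv_rhs => rw [hψ]
    simp only [mul_assoc, ← Finset.mul_sum]
    rfl
  have h2 : ∑ x ∈ A, ∑ y ∈ A, φ x * γ x y * ψ y = ∑ x ∈ A, ψ x ^ 2 := by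
    rw [Finset.sum_comm, ← h1]
    refine Finset.sum_congr rfl fun x _ => Finset.sum_congr rfl fun y _ => ?_
    rw [h.symm]; ring
  have h3 := h.nonneg (fun x => φ x - ψ x)
  have h4 := h.le_one ψ
  have e : ∑ x ∈ A, ∑ y ∈ A, (φ x - ψ x) * γ x y * (φ y - ψ y) =
      ∑ x ∈ A, ∑ y ∈ A, φ x * γ x y * φ y - ∑ x ∈ A, ∑ y ∈ A, φ x * γ x y * ψ y -
      ∑ x ∈ A, ∑ y ∈ A, ψ x * γ x y * φ y + ∑ x ∈ A, ∑ y ∈ A, ψ x * γ x y * ψ y := by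
    simp only [← Finset.sum_sub_distrib, ← Finset.sum_add_distrib]
    exact Finset.sum_congr rfl fun x _ => Finset.sum_congr rfl fun y _ => by ring
  rw [e, h1, h2] at h3
  linarith

/-- Restriction of a density matrix to a smaller set. -/
lemma restrict {A B : Finset ι} (hAB : A ⊆ B) {γ : ι → ι → ℝ} (h : IsDensityMatrix B γ) :
    IsDensityMatrix A (fun x y => if x ∈ A ∧ y ∈ A then γ x y else 0) := by
  have e : ∀ φ : ι → ℝ, ∑ x ∈ A, ∑ y ∈ A, φ x * (if x ∈ A ∧ y ∈ A then γ x y else 0) * φ y =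
      ∑ x ∈ B, ∑ y ∈ B, (if x ∈ A then φ x else 0) * γ x y * (if y ∈ A then φ y else 0) := by
    intro φ
    rw [sum_sum_subset hAB]
    · refine Finset.sum_congr rfl fun x hx => Finset.sum_congr rfl fun y hy => ?_
      simp [hx, hy]
    · intro x y hx; simp [hx]
    · intro x y hy; simp [hy]
  refine ⟨fun x y => by simp only [h.symm x y, and_comm], fun x y hx => by simp [hx], fun φ => ?_,
    fun φ => ?_⟩
  · rw [e]; exact h.nonneg _
  · rw [e]
    refine (h.le_one _).trans_eq ?_
    simp only [ite_pow, ne_eq, OfNat.ofNat_ne_zero, not_false_eq_true, zero_pow]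
    rw [Finset.sum_ite_mem, Finset.inter_eq_right.2 hAB]

/-- A block diagonal kernel is a density matrix. -/
lemma blocks {κ : Type*} {Z : Finset κ} {A : κ → Finset ι} {Q : Finset ι} {γ : κ → ι → ι → ℝ}
    (h : ∀ z ∈ Z, IsDensityMatrix (A z) (γ z)) (hA : ∀ z ∈ Z, A z ⊆ Q)
    (hdisj : (Z : Set κ).PairwiseDisjoint A) :
    IsDensityMatrix Q (fun x y => ∑ z ∈ Z, γ z x y) := by
  have e : ∀ φ : ι → ℝ, ∑ x ∈ Q, ∑ y ∈ Q, φ x * (∑ z ∈ Z, γ z x y) * φ y =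
      ∑ z ∈ Z, ∑ x ∈ A z, ∑ y ∈ A z, φ x * γ z x y * φ y := by
    intro φ
    simp only [Finset.mul_sum, Finset.sum_mul]
    calc _ = ∑ x ∈ Q, ∑ z ∈ Z, ∑ y ∈ Q, φ x * γ z x y * φ y :=
          Finset.sum_congr rfl fun x _ => Finset.sum_comm
      _ = _ := by
        rw [Finset.sum_comm]
        refine Finset.sum_congr rfl fun z hz => sum_sum_subset (hA z hz) ?_ ?_
        · intro x y hx; simp [(h z hz).supp x y hx]
        · intro x y hy; simp [(h z hz).supp' x y hy]
  refine ⟨fun x y => Finset.sum_congr rfl fun z hz => (h z hz).symm x y, fun x y hx => ?_,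
    fun φ => ?_, fun φ => ?_⟩
  · exact Finset.sum_eq_zero fun z hz => (h z hz).supp x y fun hx' => hx (hA z hz hx')
  · rw [e]
    exact Finset.sum_nonneg fun z hz => (h z hz).nonneg φ
  · rw [e]
    calc _ ≤ ∑ z ∈ Z, ∑ x ∈ A z, φ x ^ 2 := Finset.sum_le_sum fun z hz => (h z hz).le_one φ
      _ = ∑ x ∈ Z.biUnion A, φ x ^ 2 := (Finset.sum_biUnion hdisj).symm
      _ ≤ _ := Finset.sum_le_sum_of_subset_of_nonneg
        (Finset.biUnion_subset.2 hA) fun x _ _ => sq_nonneg (φ x)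

end IsDensityMatrix

end DensityMatrix

/-! ### Neighbours and boundaries -/

section Lattice

variable {d : ℕ}

/-- The unit vectors of the lattice. -/
abbrev unitVec (i : Fin d) : Site d := Pi.single i 1

lemma adjacent_iff {x y : Site d} :
    Adjacent x y ↔ ∃ i : Fin d, y = x + unitVec i ∨ y = x - unitVec i := by
  constructor
  · intro h
    unfold Adjacent at h
    obtain ⟨i, -, hi⟩ : ∃ i ∈ Finset.univ, |x i - y i| ≠ 0 := by
      apply Finset.exists_ne_zero_of_sum_ne_zero
      rw [h]; exact one_ne_zero
    have h1 := Finset.add_sum_erase Finset.univ (fun j => |x j - y j|) (Finset.mem_univ i)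
    have h2 : 0 ≤ ∑ j ∈ Finset.univ.erase i, |x j - y j| :=
      Finset.sum_nonneg fun j _ => abs_nonneg _
    have h3 : 0 < |x i - y i| := lt_of_le_of_ne (abs_nonneg _) hi.symm
    have h4 : ∑ j ∈ Finset.univ.erase i, |x j - y j| = 0 := by omega
    have h5 : |x i - y i| = 1 := by omega
    have h6 : ∀ j, j ≠ i → y j = x j := by
      intro j hj
      have := (Finset.sum_eq_zero_iff_of_nonneg (fun j _ => abs_nonneg (x j - y j))).1 h4 j
        (Finset.mem_erase.2 ⟨hj, Finset.mem_univ j⟩)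
      rw [abs_eq_zero] at this
      omega
    refine ⟨i, ?_⟩
    rcases (abs_eq zero_le_one).1 h5 with h7 | h7
    · right
      funext j
      by_cases hj : j = i
      · subst hj; simp; omega
      · simp [hj, h6 j hj]
    · left
      funext j
      by_cases hj : j = i
      · subst hj; simp; omega
      · simp [hj, h6 j hj]
  · rintro ⟨i, rfl | rfl⟩ <;> simp [Adjacent, Pi.single_apply, apply_ite]

lemma adjacent_comm {x y : Site d} : Adjacent x y ↔ Adjacent y x := by
  simp only [Adjacent, abs_sub_comm]

lemma not_adjacent_self (x : Site d) : ¬ Adjacent x x := by simp [Adjacent]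

lemma adjacent_add_right {x y : Site d} (z : Site d) :
    Adjacent (x + z) (y + z) ↔ Adjacent x y := by
  simp [Adjacent]

/-- The finite set of the nearest neighbours of a site. -/
def nbrs (x : Site d) : Finset (Site d) :=
  Finset.univ.image (fun i => x + unitVec i) ∪ Finset.univ.image (fun i => x - unitVec i)

@[simp] lemma mem_nbrs {x y : Site d} : y ∈ nbrs x ↔ Adjacent x y := by
  rw [adjacent_iff]
  simp only [nbrs, Finset.mem_union, Finset.mem_image, Finset.mem_univ, true_and, ← exists_or,
    eq_comm]

lemma unitVec_injective : Function.Injective (unitVec : Fin d → Site d) := by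
  intro i j h
  by_contra hij
  have := congrFun h i
  simp [hij] at this

lemma unitVec_ne_neg (i j : Fin d) : unitVec i ≠ -unitVec j := by
  intro h
  have := congrFun h i
  by_cases hij : i = j
  · subst hij; simp at this
  · simp [hij] at this

lemma sum_nbrs {M : Type*} [AddCommMonoid M] (x : Site d) (f : Site d → M) :
    ∑ y ∈ nbrs x, f y = ∑ i : Fin d, (f (x + unitVec i) + f (x - unitVec i)) := by
  rw [nbrs, Finset.sum_union, Finset.sum_image, Finset.sum_image, Finset.sum_add_distrib]
  · intro i _ j _ h
    exact unitVec_injective (sub_right_injective h)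
  · intro i _ j _ h
    exact unitVec_injective (add_right_injective x h)
  · rw [Finset.disjoint_left]
    simp only [Finset.mem_image, Finset.mem_univ, true_and, not_exists]
    rintro _ ⟨i, rfl⟩ j h
    rw [sub_eq_add_neg] at h
    exact unitVec_ne_neg i j (add_right_injective x h).symm

lemma card_nbrs (x : Site d) : (nbrs x).card = 2 * d := by
  rw [Finset.card_eq_sum_ones, sum_nbrs]
  simp [mul_comm]

lemma sum_adjacent (A : Finset (Site d)) (x : Site d) (f : Site d → ℝ) :
    ∑ y ∈ A, (if Adjacent x y then f y else 0) = ∑ y ∈ (nbrs x).filter (· ∈ A), f y := by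
  rw [← Finset.sum_filter]
  refine Finset.sum_congr ?_ fun _ _ => rfl
  ext y
  simp [and_comm]

/-- The pairs of nearest neighbours that lead out of the finite domain `D`. -/
def boundaryPairs (D : Finset (Site d)) : Finset (Site d × Site d) :=
  (D ×ˢ D.biUnion nbrs).filter fun p => p.2 ∉ D ∧ Adjacent p.1 p.2

@[simp] lemma mem_boundaryPairs {D : Finset (Site d)} {p : Site d × Site d} :
    p ∈ boundaryPairs D ↔ p.1 ∈ D ∧ p.2 ∉ D ∧ Adjacent p.1 p.2 := by
  simp only [boundaryPairs, Finset.mem_filter, Finset.mem_product, Finset.mem_biUnion, mem_nbrs]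
  constructor
  · rintro ⟨⟨h1, -⟩, h2, h3⟩; exact ⟨h1, h2, h3⟩
  · rintro ⟨h1, h2, h3⟩; exact ⟨⟨h1, p.1, h1, h3⟩, h2, h3⟩

lemma card_boundaryPairs (D : Finset (Site d)) :
    (boundaryPairs D).card = ∑ x ∈ D, ((nbrs x).filter (· ∉ D)).card := by
  rw [← Finset.card_sigma]
  refine Finset.card_bij' (fun p _ => ⟨p.1, p.2⟩) (fun p _ => (p.1, p.2)) ?_ ?_ ?_ ?_
  · intro p hp
    rw [mem_boundaryPairs] at hp
    simp [hp]
  · intro p hp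
    simp only [Finset.mem_sigma, Finset.mem_filter, mem_nbrs] at hp
    rw [mem_boundaryPairs]
    exact ⟨hp.1, hp.2.2, hp.2.1⟩
  · intro p _; rfl
  · intro p _; rfl

/-- The occupied sites of `Λ`. -/
def occ (ω : Config d) (Λ : Finset (Site d)) : Finset (Site d) := Λ.filter fun x => ω x = true

@[simp] lemma mem_occ {ω : Config d} {Λ : Finset (Site d)} {x : Site d} :
    x ∈ occ ω Λ ↔ x ∈ Λ ∧ ω x = true := Finset.mem_filter

lemma occ_subset (ω : Config d) (Λ : Finset (Site d)) : occ ω Λ ⊆ Λ := Finset.filter_subset _ _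

lemma numClassical_restrict (ω : Config d) (Λ : Finset (Site d)) :
    numClassical (restrict Λ ω) = (occ ω Λ).card := by
  unfold numClassical restrict occ
  rw [← Finset.card_map ⟨Subtype.val, Subtype.val_injective⟩]
  congr 1
  ext x
  simp only [Finset.mem_map, Finset.mem_filter, Finset.mem_univ, true_and,
    Function.Embedding.coeFn_mk, Subtype.exists, exists_and_right, exists_eq_right]
  constructor
  · rintro ⟨h1, h2⟩; exact ⟨h1, h2⟩
  · rintro ⟨h1, h2⟩; exact ⟨h1, h2⟩

lemma boundarySize_restrict (ω : Config d) (Λ : Finset (Site d)) :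
    boundarySize (restrict Λ ω) = (boundaryPairs (occ ω Λ)).card := by
  unfold boundarySize
  rw [← Set.ncard_coe_finset]
  congr 1
  ext p
  have : ∀ x, x ∈ occupied (restrict Λ ω) ↔ x ∈ occ ω Λ := by
    intro x
    simp [occupied, restrict]
  simp [this]

/-- Extension of a configuration in a finite volume by unoccupied sites. -/
def extend {Λ : Finset (Site d)} (ω : BoxConfig Λ) : Config d :=
  fun x => if h : x ∈ Λ then ω ⟨x, h⟩ else false

lemma restrict_extend {Λ : Finset (Site d)} (ω : BoxConfig Λ) : restrict Λ (extend ω) = ω := by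
  funext x
  simp [restrict, extend]

end Lattice

/-! ### The energy of a density matrix -/

section Energy

variable {d : ℕ}

/-- The number of electrons in `Λ` for the density matrix `γ`. -/
def trace (Λ : Finset (Site d)) (γ : Site d → Site d → ℝ) : ℝ := ∑ x ∈ Λ, γ x x

/-- The energy `Tr H_Λ(ω) γ`. -/
def energy (U : ℝ) (ω : Config d) (Λ : Finset (Site d)) (γ : Site d → Site d → ℝ) : ℝ :=
  -(∑ x ∈ Λ, ∑ y ∈ Λ, if Adjacent x y then γ x y else 0) -
    U * ∑ x ∈ Λ, if ω x = true then γ x x else 0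

/-- The infimum of the energies of the density matrices with trace `t`. -/
def minEnergy (U : ℝ) (ω : Config d) (Λ : Finset (Site d)) (t : ℝ) : ℝ :=
  sInf {E | ∃ γ, IsDensityMatrix Λ γ ∧ trace Λ γ = t ∧ E = energy U ω Λ γ}

lemma energy_combine (U : ℝ) (ω : Config d) (Λ : Finset (Site d)) (γ γ' : Site d → Site d → ℝ)
    (s t : ℝ) : energy U ω Λ (fun x y => s * γ x y + t * γ' x y) =
      s * energy U ω Λ γ + t * energy U ω Λ γ' := by
  have h1 : ∑ x ∈ Λ, ∑ y ∈ Λ, (if Adjacent x y then s * γ x y + t * γ' x y else 0) =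
      s * (∑ x ∈ Λ, ∑ y ∈ Λ, if Adjacent x y then γ x y else 0) +
      t * (∑ x ∈ Λ, ∑ y ∈ Λ, if Adjacent x y then γ' x y else 0) := by
    simp only [Finset.mul_sum, ← Finset.sum_add_distrib]
    refine Finset.sum_congr rfl fun x _ => Finset.sum_congr rfl fun y _ => ?_
    split_ifs <;> ring
  have h2 : ∑ x ∈ Λ, (if ω x = true then s * γ x x + t * γ' x x else 0) =
      s * (∑ x ∈ Λ, if ω x = true then γ x x else 0) +
      t * (∑ x ∈ Λ, if ω x = true then γ' x x else 0) := by
    simp only [Finset.mul_sum, ← Finset.sum_add_distrib]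
    refine Finset.sum_congr rfl fun x _ => ?_
    split_ifs <;> ring
  simp only [energy, h1, h2]
  ring

lemma trace_combine (Λ : Finset (Site d)) (γ γ' : Site d → Site d → ℝ) (s t : ℝ) :
    trace Λ (fun x y => s * γ x y + t * γ' x y) = s * trace Λ γ + t * trace Λ γ' := by
  simp only [trace, Finset.mul_sum, ← Finset.sum_add_distrib]

lemma trace_zero (Λ : Finset (Site d)) : trace Λ (fun _ _ => 0) = 0 := by simp [trace]

lemma energy_zero (U : ℝ) (ω : Config d) (Λ : Finset (Site d)) :
    energy U ω Λ (fun _ _ => 0) = 0 := by simp [energy]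

lemma trace_compl (Λ : Finset (Site d)) (γ : Site d → Site d → ℝ) :
    trace Λ (fun x y => (if x = y ∧ x ∈ Λ then 1 else 0) - γ x y) = Λ.card - trace Λ γ := by
  simp only [trace, Finset.sum_sub_distrib]
  congr 1
  rw [Finset.sum_congr rfl (g := fun _ => (1 : ℝ)) fun x hx => by simp [hx]]
  simp

lemma abs_sum_adjacent_le {Λ : Finset (Site d)} {γ : Site d → Site d → ℝ}
    (h : IsDensityMatrix Λ γ) :
    |∑ x ∈ Λ, ∑ y ∈ Λ, if Adjacent x y then γ x y else 0| ≤ 2 * d * trace Λ γ := by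
  have h0 : ∀ f : Site d → ℝ, (∀ x, 0 ≤ f x) →
      ∑ x ∈ Λ, ∑ y ∈ Λ, (if Adjacent x y then f x else 0) ≤ 2 * d * ∑ x ∈ Λ, f x := by
    intro f hf
    rw [Finset.mul_sum]
    refine Finset.sum_le_sum fun x _ => ?_
    rw [sum_adjacent Λ x (fun _ => f x), Finset.sum_const, nsmul_eq_mul]
    refine mul_le_mul_of_nonneg_right ?_ (hf x)
    have := Finset.card_filter_le (nbrs x) (· ∈ Λ)
    rw [card_nbrs] at this
    exact_mod_cast this
  calc _ ≤ ∑ x ∈ Λ, ∑ y ∈ Λ, ((if Adjacent x y then γ x x / 2 else 0) +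
        (if Adjacent x y then γ y y / 2 else 0)) := by
        refine (Finset.abs_sum_le_sum_abs _ _).trans (Finset.sum_le_sum fun x _ => ?_)
        refine (Finset.abs_sum_le_sum_abs _ _).trans (Finset.sum_le_sum fun y _ => ?_)
        split_ifs
        · have := h.abs_le_half x y
          linarith
        · simp
    _ = ∑ x ∈ Λ, ∑ y ∈ Λ, (if Adjacent x y then γ x x / 2 else 0) +
        ∑ x ∈ Λ, ∑ y ∈ Λ, (if Adjacent x y then γ x x / 2 else 0) := by
        simp only [Finset.sum_add_distrib]
        congr 1
        rw [Finset.sum_comm]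
        simp only [adjacent_comm]
    _ ≤ _ := by
        have := h0 (fun x => γ x x / 2) fun x => by linarith [h.diag_nonneg x]
        rw [← Finset.sum_div] at this
        unfold trace
        linarith

lemma sum_occ_le_trace {Λ : Finset (Site d)} {γ : Site d → Site d → ℝ}
    (h : IsDensityMatrix Λ γ) (ω : Config d) :
    0 ≤ (∑ x ∈ Λ, if ω x = true then γ x x else 0) ∧
      (∑ x ∈ Λ, if ω x = true then γ x x else 0) ≤ trace Λ γ := by
  constructor
  · refine Finset.sum_nonneg fun x _ => ?_
    split_ifs
    exacts [h.diag_nonneg x, le_rfl]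
  · refine Finset.sum_le_sum fun x _ => ?_
    split_ifs
    exacts [le_rfl, h.diag_nonneg x]

lemma abs_energy_le {Λ : Finset (Site d)} {γ : Site d → Site d → ℝ}
    (h : IsDensityMatrix Λ γ) (U : ℝ) (ω : Config d) :
    |energy U ω Λ γ| ≤ (2 * d + |U|) * trace Λ γ := by
  have h1 := abs_sum_adjacent_le h
  have h2 := sum_occ_le_trace h ω
  unfold energy
  calc _ ≤ |-(∑ x ∈ Λ, ∑ y ∈ Λ, if Adjacent x y then γ x y else 0)| +
        |U * ∑ x ∈ Λ, if ω x = true then γ x x else 0| := abs_sub _ _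
    _ ≤ 2 * d * trace Λ γ + |U| * trace Λ γ := by
        rw [abs_neg, abs_mul, abs_of_nonneg h2.1]
        exact add_le_add h1 (mul_le_mul_of_nonneg_left h2.2 (abs_nonneg U))
    _ = _ := by ring

lemma minEnergy_le {Λ : Finset (Site d)} {γ : Site d → Site d → ℝ} (h : IsDensityMatrix Λ γ)
    (U : ℝ) (ω : Config d) : minEnergy U ω Λ (trace Λ γ) ≤ energy U ω Λ γ := by
  refine csInf_le ⟨-((2 * d + |U|) * trace Λ γ), ?_⟩ ⟨γ, h, rfl, rfl⟩
  rintro E ⟨γ', h', ht, rfl⟩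
  rw [← ht]
  exact (abs_le.1 (abs_energy_le h' U ω)).1

lemma exists_isDensityMatrix_trace (Λ : Finset (Site d)) {t : ℝ} (h0 : 0 ≤ t) (h1 : t ≤ Λ.card) :
    ∃ γ, IsDensityMatrix Λ γ ∧ trace Λ γ = t := by
  rcases Nat.eq_zero_or_pos Λ.card with hc | hc
  · rw [hc, Nat.cast_zero] at h1
    exact ⟨_, IsDensityMatrix.zero Λ, by rw [trace_zero]; linarith⟩
  · have hc' : (0 : ℝ) < Λ.card := by exact_mod_cast hc
    refine ⟨_, (IsDensityMatrix.zero Λ).compl.combine (IsDensityMatrix.zero Λ)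
      (s := t / Λ.card) (t := 1 - t / Λ.card) (by positivity) ?_ (by ring), ?_⟩
    · rw [sub_nonneg, div_le_one hc']; exact h1
    · rw [trace_combine, trace_compl, trace_zero]
      field_simp
      ring

lemma le_minEnergy {Λ : Finset (Site d)} {U : ℝ} {ω : Config d} {t c : ℝ} (h0 : 0 ≤ t)
    (h1 : t ≤ Λ.card)
    (h : ∀ γ, IsDensityMatrix Λ γ → trace Λ γ = t → c ≤ energy U ω Λ γ) :
    c ≤ minEnergy U ω Λ t := by
  obtain ⟨γ, hγ, ht⟩ := exists_isDensityMatrix_trace Λ h0 h1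
  refine le_csInf ⟨_, γ, hγ, ht, rfl⟩ ?_
  rintro E ⟨γ', h1, h2, rfl⟩
  exact h γ' h1 h2

lemma abs_minEnergy_le {Λ : Finset (Site d)} (U : ℝ) (ω : Config d) {t : ℝ} (h0 : 0 ≤ t)
    (h1 : t ≤ Λ.card) : |minEnergy U ω Λ t| ≤ (2 * d + |U|) * t := by
  obtain ⟨γ, hγ, ht⟩ := exists_isDensityMatrix_trace Λ h0 h1
  rw [abs_le]
  constructor
  · refine le_minEnergy h0 h1 fun γ' h' ht' => ?_
    rw [← ht']
    exact (abs_le.1 (abs_energy_le h' U ω)).1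
  · rw [← ht]
    exact (minEnergy_le hγ U ω).trans (abs_le.1 (abs_energy_le hγ U ω)).2

/-- Electrons can be added or removed at bounded energy cost. -/
lemma minEnergy_le_add {Λ : Finset (Site d)} (U : ℝ) (ω : Config d) {t t' : ℝ} (h0 : 0 ≤ t)
    (h1 : t ≤ Λ.card) (h0' : 0 ≤ t') (h1' : t' ≤ Λ.card) :
    minEnergy U ω Λ t' ≤ minEnergy U ω Λ t + (2 * d + |U|) * |t' - t| := by
  rw [← sub_le_iff_le_add]
  refine le_minEnergy h0 h1 fun γ hγ htr => ?_
  rw [sub_le_iff_le_add]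
  rcases lt_trichotomy t t' with hlt | heq | hgt
  · have hpos : 0 < (Λ.card : ℝ) - t := by linarith
    set s := (t' - t) / (Λ.card - t) with hs
    have hs0 : 0 ≤ s := div_nonneg (by linarith) hpos.le
    have hs1 : s ≤ 1 := by rw [hs, div_le_one hpos]; linarith
    have hsm : s * (Λ.card - t) = t' - t := div_mul_cancel₀ _ hpos.ne'
    have hid := (hγ.combine (IsDensityMatrix.zero Λ).compl (s := 1 - s) (t := s) (by linarith)
      hs0 (by ring))
    have hc := abs_energy_le hγ.compl U ω
    rw [trace_compl, htr] at hc
    have e2 : energy U ω Λ (fun x y => (1 : ℝ) * γ x y +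
        s * ((if x = y ∧ x ∈ Λ then 1 else 0) - γ x y)) = _ := energy_combine U ω Λ _ _ 1 s
    have e3 : trace Λ (fun x y => (1 : ℝ) * γ x y +
        s * ((if x = y ∧ x ∈ Λ then 1 else 0) - γ x y)) = _ := trace_combine Λ _ _ 1 s
    rw [trace_compl, htr] at e3
    have e4 : (fun x y => (1 - s) * γ x y + s * ((if x = y ∧ x ∈ Λ then (1 : ℝ) else 0) - 0)) =
        (fun x y => (1 : ℝ) * γ x y + s * ((if x = y ∧ x ∈ Λ then 1 else 0) - γ x y)) := by
      funext x y; ring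
    rw [e4] at hid
    have := minEnergy_le hid U ω
    rw [e2, e3, one_mul, hsm, add_sub_cancel] at this
    rw [abs_of_pos (by linarith : 0 < t' - t), ← hsm]
    have h5 := mul_le_mul_of_nonneg_left (abs_le.1 hc).2 hs0
    linarith
  · subst heq
    rw [sub_self, abs_zero, mul_zero, add_zero, ← htr]
    exact minEnergy_le hγ U ω
  · have hpos : 0 < t := by linarith
    set s := t' / t with hs
    have hs0 : 0 ≤ s := div_nonneg h0' hpos.le
    have hs1 : s ≤ 1 := by rw [hs, div_le_one hpos]; linarith
    have hsm : s * t = t' := div_mul_cancel₀ _ hpos.ne'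
    have := minEnergy_le (hγ.combine (IsDensityMatrix.zero Λ) (s := s) (t := 1 - s) hs0
      (by linarith) (by ring)) U ω
    rw [energy_combine, trace_combine, trace_zero, energy_zero, htr, mul_zero, add_zero,
      add_zero, hsm] at this
    have hc := abs_energy_le hγ U ω
    rw [htr] at hc
    have h5 := mul_le_mul_of_nonneg_left (abs_le.1 hc).1 (by linarith : 0 ≤ 1 - s)
    have h6 : |t' - t| = (1 - s) * t := by
      rw [abs_of_neg (by linarith), ← hsm]; ring
    rw [h6]
    linarith

/-- The canonical ground state energy is the least energy of the density matrices with trace `N`. -/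
theorem isLeast_groundEnergy (U : ℝ) (ω : Config d) (Λ : Finset (Site d)) {N : ℕ}
    (hN : N ≤ Λ.card) :
    IsLeast {E | ∃ γ, IsDensityMatrix Λ γ ∧ trace Λ γ = N ∧ E = energy U ω Λ γ}
      (groundEnergy U N (restrict Λ ω)) := by
  set h : Λ → Λ → ℝ := fun x y => (if Adjacent (x : Site d) y then -1 else 0) -
    (if x = y ∧ ω x = true then U else 0) with hdef
  have hsymm : ∀ x y, h x y = h y x := by
    intro x y
    simp only [hdef, adjacent_comm (x := (x : Site d))]
    by_cases hxy : x = y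
    · subst hxy; rfl
    · simp [hxy, Ne.symm hxy]
  have hH : ∀ Ψ : WaveFn Λ N, hamiltonian U (restrict Λ ω) Ψ = secondQuantize h Ψ := by
    intro Ψ
    simp only [hamiltonian, secondQuantize, hdef, restrict]
    rw [Finset.smul_sum, ← Finset.sum_neg_distrib, ← Finset.sum_sub_distrib]
    refine Finset.sum_congr rfl fun x _ => ?_
    push_cast
    simp only [sub_smul, Finset.sum_sub_distrib]
    congr 1
    · rw [← Finset.sum_neg_distrib]
      refine Finset.sum_congr rfl fun y _ => ?_
      split_ifs <;> simp
    · by_cases hx : ω x = true <;> simp [hx]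
  have key := isLeast_secondQuantize hsymm (N := N) (by simpa using hN)
  have hE : ∀ γ : Site d → Site d → ℝ, energy U ω Λ γ =
      ∑ x : Λ, ∑ y : Λ, h x y * γ x y := by
    intro γ
    simp only [energy, hdef, sub_mul, Finset.sum_sub_distrib]
    rw [← Finset.sum_coe_sort Λ, ← Finset.sum_coe_sort Λ]
    congr 1
    · rw [← Finset.sum_neg_distrib]
      refine Finset.sum_congr rfl fun x _ => ?_
      rw [← Finset.sum_coe_sort Λ, ← Finset.sum_neg_distrib]
      refine Finset.sum_congr rfl fun y _ => ?_
      split_ifs <;> simp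
    · rw [Finset.mul_sum]
      refine Finset.sum_congr rfl fun x _ => ?_
      by_cases hx : ω x = true <;> simp [hx]
  have hT : ∀ γ : Site d → Site d → ℝ, trace Λ γ = ∑ x : Λ, γ x x :=
    fun γ => (Finset.sum_coe_sort Λ fun x => γ x x).symm
  have hset : {E | ∃ γ, IsDensityMatrix Λ γ ∧ trace Λ γ = N ∧ E = energy U ω Λ γ} =
      {E | ∃ γ : Λ → Λ → ℝ, IsDensityMatrix Finset.univ γ ∧ ∑ x, γ x x = N ∧
        E = ∑ x, ∑ y, h x y * γ x y} := by
    ext E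
    constructor
    · rintro ⟨γ, hγ, htr, rfl⟩
      have e : ∀ φ : Λ → ℝ, ∑ x : Λ, ∑ y : Λ, φ x * γ x y * φ y =
          ∑ x ∈ Λ, ∑ y ∈ Λ, (if hx : x ∈ Λ then φ ⟨x, hx⟩ else 0) * γ x y *
            (if hy : y ∈ Λ then φ ⟨y, hy⟩ else 0) := by
        intro φ
        rw [← Finset.sum_coe_sort Λ]
        refine Finset.sum_congr rfl fun x _ => ?_
        rw [← Finset.sum_coe_sort Λ]
        refine Finset.sum_congr rfl fun y _ => ?_
        simp
      refine ⟨fun x y => γ x y, ⟨fun x y => hγ.symm x y, by simp, fun φ => ?_, fun φ => ?_⟩, ?_,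
        hE γ⟩
      · rw [e]; exact hγ.nonneg _
      · rw [e]
        refine (hγ.le_one _).trans_eq ?_
        rw [← Finset.sum_coe_sort Λ]
        simp
      · rw [← hT, htr]
    · rintro ⟨γ, hγ, htr, rfl⟩
      set γ' : Site d → Site d → ℝ := fun x y =>
        if h : x ∈ Λ ∧ y ∈ Λ then γ ⟨x, h.1⟩ ⟨y, h.2⟩ else 0 with hγ'
      have hv : ∀ x y : Λ, γ' x y = γ x y := by
        intro x y
        simp [hγ']
      have e : ∀ φ : Site d → ℝ, ∑ x ∈ Λ, ∑ y ∈ Λ, φ x * γ' x y * φ y =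
          ∑ x : Λ, ∑ y : Λ, φ x * γ x y * φ y := by
        intro φ
        rw [← Finset.sum_coe_sort Λ]
        refine Finset.sum_congr rfl fun x _ => ?_
        rw [← Finset.sum_coe_sort Λ]
        refine Finset.sum_congr rfl fun y _ => ?_
        rw [hv]
      refine ⟨γ', ⟨fun x y => ?_, fun x y hx => ?_, fun φ => ?_, fun φ => ?_⟩, ?_, ?_⟩
      · simp only [hγ']
        by_cases hx : x ∈ Λ <;> by_cases hy : y ∈ Λ <;> simp [hx, hy, hγ.symm ⟨x, _⟩]
      · simp [hγ', hx]
      · rw [e]; exact hγ.nonneg _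
      · rw [e, ← Finset.sum_coe_sort Λ]; exact hγ.le_one _
      · rw [hT, ← htr]; simp only [hv]
      · rw [hE]; simp only [hv]
  rw [hset]
  unfold groundEnergy
  simp only [hH]
  exact key

lemma groundEnergy_eq_minEnergy (U : ℝ) (ω : Config d) (Λ : Finset (Site d)) {N : ℕ}
    (hN : N ≤ Λ.card) : groundEnergy U N (restrict Λ ω) = minEnergy U ω Λ N :=
  (isLeast_groundEnergy U ω Λ hN).csInf_eq.symm

end Energy

/-! ### Subadditivity -/

section Glue

variable {d : ℕ}

/-- The kernel `γ` translated by `z`. -/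
def translate (z : Site d) (γ : Site d → Site d → ℝ) : Site d → Site d → ℝ :=
  fun x y => γ (x - z) (y - z)

lemma sum_image_add {M : Type*} [AddCommMonoid M] (K : Finset (Site d)) (z : Site d)
    (f : Site d → M) : ∑ x ∈ K.image (· + z), f x = ∑ x ∈ K, f (x + z) :=
  Finset.sum_image fun _ _ _ _ h => add_left_injective z h

lemma IsDensityMatrix.translate {K : Finset (Site d)} {γ : Site d → Site d → ℝ}
    (h : IsDensityMatrix K γ) (z : Site d) :
    IsDensityMatrix (K.image (· + z)) (translate z γ) := by
  refine ⟨fun x y => h.symm _ _, fun x y hx => h.supp _ _ fun hx' => hx ?_, fun φ => ?_,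
    fun φ => ?_⟩
  · exact Finset.mem_image.2 ⟨x - z, hx', sub_add_cancel x z⟩
  · simp only [sum_image_add, FalicovKimball.translate, add_sub_cancel_right]
    exact h.nonneg fun x => φ (x + z)
  · simp only [sum_image_add, FalicovKimball.translate, add_sub_cancel_right]
    exact h.le_one fun x => φ (x + z)

lemma trace_translate (K : Finset (Site d)) (γ : Site d → Site d → ℝ) (z : Site d) :
    trace (K.image (· + z)) (translate z γ) = trace K γ := by
  simp only [trace, sum_image_add, translate, add_sub_cancel_right]

lemma energy_translate (U : ℝ) {ω : Config d} {K : Finset (Site d)} (γ : Site d → Site d → ℝ)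
    {z : Site d} (hω : ∀ x ∈ K, ω (x + z) = ω x) :
    energy U ω (K.image (· + z)) (translate z γ) = energy U ω K γ := by
  simp only [energy, sum_image_add, translate, add_sub_cancel_right, adjacent_add_right]
  congr 2
  exact Finset.sum_congr rfl fun x hx => by rw [hω x hx]

lemma energy_blocks {κ : Type*} (U : ℝ) (ω : Config d) {Z : Finset κ} {A : κ → Finset (Site d)}
    {Q : Finset (Site d)} {γ : κ → Site d → Site d → ℝ}
    (h : ∀ z ∈ Z, IsDensityMatrix (A z) (γ z)) (hA : ∀ z ∈ Z, A z ⊆ Q) :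
    energy U ω Q (fun x y => ∑ z ∈ Z, γ z x y) = ∑ z ∈ Z, energy U ω (A z) (γ z) := by
  have h1 : ∑ x ∈ Q, ∑ y ∈ Q, (if Adjacent x y then ∑ z ∈ Z, γ z x y else 0) =
      ∑ z ∈ Z, ∑ x ∈ A z, ∑ y ∈ A z, if Adjacent x y then γ z x y else 0 := by
    calc _ = ∑ x ∈ Q, ∑ z ∈ Z, ∑ y ∈ Q, (if Adjacent x y then γ z x y else 0) := by
          refine Finset.sum_congr rfl fun x _ => ?_
          rw [Finset.sum_comm]
          refine Finset.sum_congr rfl fun y _ => ?_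
          split_ifs <;> simp
      _ = _ := by
        rw [Finset.sum_comm]
        refine Finset.sum_congr rfl fun z hz => sum_sum_subset (hA z hz) ?_ ?_
        · intro x y hx; simp [(h z hz).supp x y hx]
        · intro x y hy; simp [(h z hz).supp' x y hy]
  have h2 : ∑ x ∈ Q, (if ω x = true then ∑ z ∈ Z, γ z x x else 0) =
      ∑ z ∈ Z, ∑ x ∈ A z, if ω x = true then γ z x x else 0 := by
    calc _ = ∑ x ∈ Q, ∑ z ∈ Z, (if ω x = true then γ z x x else 0) := by
          refine Finset.sum_congr rfl fun x _ => ?_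
          split_ifs <;> simp
      _ = _ := by
        rw [Finset.sum_comm]
        refine Finset.sum_congr rfl fun z hz => (Finset.sum_subset (hA z hz) ?_).symm
        intro x _ hx; simp [(h z hz).supp x x hx]
  simp only [energy, h1, h2, Finset.sum_sub_distrib, Finset.sum_neg_distrib, Finset.mul_sum]

lemma trace_blocks {κ : Type*} {Z : Finset κ} {A : κ → Finset (Site d)}
    {Q : Finset (Site d)} {γ : κ → Site d → Site d → ℝ}
    (h : ∀ z ∈ Z, IsDensityMatrix (A z) (γ z)) (hA : ∀ z ∈ Z, A z ⊆ Q) :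
    trace Q (fun x y => ∑ z ∈ Z, γ z x y) = ∑ z ∈ Z, trace (A z) (γ z) := by
  unfold trace
  rw [Finset.sum_comm]
  refine Finset.sum_congr rfl fun z hz => (Finset.sum_subset (hA z hz) ?_).symm
  intro x _ hx; exact (h z hz).supp x x hx

/-- Putting the same density matrix on disjoint translates of `K`. -/
lemma minEnergy_glue (U : ℝ) {ω : Config d} {K Q Z : Finset (Site d)}
    (hQ : ∀ z ∈ Z, K.image (· + z) ⊆ Q)
    (hdisj : (Z : Set (Site d)).PairwiseDisjoint fun z => K.image (· + z))
    (hω : ∀ z ∈ Z, ∀ x ∈ K, ω (x + z) = ω x) {t : ℝ} (h0 : 0 ≤ t) (h1 : t ≤ K.card) :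
    minEnergy U ω Q (Z.card * t) ≤ Z.card * minEnergy U ω K t := by
  rcases Z.eq_empty_or_nonempty with rfl | hne
  · have := minEnergy_le (IsDensityMatrix.zero Q) U ω
    rw [trace_zero, energy_zero] at this
    simpa using this
  have hpos : (0 : ℝ) < Z.card := by exact_mod_cast hne.card_pos
  rw [← div_le_iff₀' hpos]
  refine le_minEnergy h0 h1 fun γ hγ htr => ?_
  rw [div_le_iff₀' hpos]
  have hb := IsDensityMatrix.blocks (fun z _ => hγ.translate z) hQ hdisj
  have := minEnergy_le hb U ω
  rw [energy_blocks U ω (fun z _ => hγ.translate z) hQ,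
    trace_blocks (fun z _ => hγ.translate z) hQ] at this
  simp only [trace_translate, Finset.sum_const, nsmul_eq_mul, htr] at this
  refine this.trans_eq ?_
  rw [Finset.sum_congr rfl fun z hz => energy_translate U γ (hω z hz)]
  simp

end Glue

/-! ### Particle-hole symmetry -/

section ParticleHole

variable {d : ℕ}

/-- The sign that distinguishes the two sublattices of `ℤ^d`. -/
def stagger (x : Site d) : ℝ := if Even (∑ i, x i) then 1 else -1

lemma stagger_mul_self (x : Site d) : stagger x * stagger x = 1 := by
  unfold stagger; split_ifs <;> norm_num

lemma stagger_mul_of_adjacent {x y : Site d} (h : Adjacent x y) : stagger x * stagger y = -1 := by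
  have hpar : Even (∑ i, x i) ↔ ¬ Even (∑ i, y i) := by
    obtain ⟨i, rfl | rfl⟩ := adjacent_iff.1 h
    · simp [Finset.sum_add_distrib, parity_simps]
    · simp [Finset.sum_sub_distrib, parity_simps]
  unfold stagger
  by_cases hy : Even (∑ i, y i)
  · rw [if_pos hy, if_neg (fun h => hpar.1 h hy)]; norm_num
  · rw [if_neg hy, if_pos (hpar.2 hy)]; norm_num

/-- The configuration with occupied and empty sites exchanged. -/
def flip (ω : Config d) : Config d := fun x => !(ω x)

lemma flip_flip (ω : Config d) : flip (flip ω) = ω := by funext x; simp [flip]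

lemma card_occ_flip (ω : Config d) (Λ : Finset (Site d)) :
    ((occ (flip ω) Λ).card : ℝ) = Λ.card - (occ ω Λ).card := by
  have := Finset.card_filter_add_card_filter_not (s := Λ) (fun x => ω x = true)
  have h2 : occ (flip ω) Λ = Λ.filter fun x => ¬ ω x = true := by
    ext x; simp [flip]
  rw [h2, eq_sub_iff_add_eq', occ]
  exact_mod_cast this

/-- The trial density matrix is `1 - γ`, with the hopping restored by the sublattice signs. -/
lemma minEnergy_card_sub_le (U : ℝ) (ω : Config d) (Λ : Finset (Site d)) {t : ℝ} (h0 : 0 ≤ t)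
    (h1 : t ≤ Λ.card) :
    minEnergy U ω Λ (Λ.card - t) ≤ minEnergy U (flip ω) Λ t + U * t - U * (occ ω Λ).card := by
  rw [add_sub_assoc, ← sub_le_iff_le_add]
  refine le_minEnergy h0 h1 fun γ hγ htr => ?_
  rw [sub_le_iff_le_add, ← add_sub_assoc]
  set δ : Site d → Site d → ℝ := fun x y => (if x = y ∧ x ∈ Λ then 1 else 0) - γ x y with hδ
  have hd : IsDensityMatrix Λ δ := hγ.compl
  have e : ∀ φ : Site d → ℝ, ∑ x ∈ Λ, ∑ y ∈ Λ, φ x * (stagger x * stagger y * δ x y) * φ y =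
      ∑ x ∈ Λ, ∑ y ∈ Λ, (stagger x * φ x) * δ x y * (stagger y * φ y) := fun φ =>
    Finset.sum_congr rfl fun x _ => Finset.sum_congr rfl fun y _ => by ring
  have hs : IsDensityMatrix Λ (fun x y => stagger x * stagger y * δ x y) := by
    refine ⟨fun x y => by rw [hd.symm]; ring, fun x y hx => by rw [hd.supp x y hx, mul_zero],
      fun φ => ?_, fun φ => ?_⟩
    · rw [e]; exact hd.nonneg _
    · rw [e]
      refine (hd.le_one _).trans_eq (Finset.sum_congr rfl fun x _ => ?_)
      linear_combination (φ x ^ 2) * stagger_mul_self x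
  have htr' : trace Λ (fun x y => stagger x * stagger y * δ x y) = Λ.card - t := by
    rw [← htr, ← trace_compl]
    unfold trace
    refine Finset.sum_congr rfl fun x _ => ?_
    change stagger x * stagger x * δ x x = δ x x
    rw [stagger_mul_self, one_mul]
  have hE := minEnergy_le hs U ω
  rw [htr'] at hE
  refine hE.trans_eq ?_
  have h2 : ∑ x ∈ Λ, ∑ y ∈ Λ, (if Adjacent x y then stagger x * stagger y * δ x y else 0) =
      ∑ x ∈ Λ, ∑ y ∈ Λ, (if Adjacent x y then γ x y else 0) := by
    refine Finset.sum_congr rfl fun x _ => Finset.sum_congr rfl fun y _ => ?_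
    split_ifs with hxy
    · have hne : x ≠ y := by rintro rfl; exact not_adjacent_self x hxy
      rw [stagger_mul_of_adjacent hxy]
      simp [hδ, hne]
    · rfl
  have h3 : ∑ x ∈ Λ, (if ω x = true then stagger x * stagger x * δ x x else 0) =
      (occ ω Λ).card - trace Λ γ + ∑ x ∈ Λ, if flip ω x = true then γ x x else 0 := by
    rw [occ, Finset.card_filter, trace]
    push_cast
    rw [← Finset.sum_sub_distrib, ← Finset.sum_add_distrib]
    refine Finset.sum_congr rfl fun x hx => ?_
    by_cases hω : ω x = true <;> simp [hω, flip, stagger_mul_self, hδ, hx]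
  simp only [energy, h2, h3, htr]
  ring

/-- Particle-hole symmetry in a finite volume. -/
lemma minEnergy_card_sub (U : ℝ) (ω : Config d) (Λ : Finset (Site d)) {t : ℝ} (h0 : 0 ≤ t)
    (h1 : t ≤ Λ.card) :
    minEnergy U ω Λ (Λ.card - t) = minEnergy U (flip ω) Λ t + U * t - U * (occ ω Λ).card := by
  refine le_antisymm (minEnergy_card_sub_le U ω Λ h0 h1) ?_
  have := minEnergy_card_sub_le U (flip ω) Λ (t := Λ.card - t) (by linarith) (by linarith)
  rw [flip_flip, card_occ_flip, sub_sub_cancel] at this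
  linarith

end ParticleHole

/-! ### Decoupling of the occupied sites at finite interaction -/

section Decoupling

variable {d : ℕ}

/-- The hopping between the occupied domain `D` and the empty sites costs at most
`2 d |∂D| / (U - 4 d)`; up to this, the energy is bounded below by the one of the electrons
confined to `D`. -/
lemma le_energy_of_restrict (hd : 1 ≤ d) {U s : ℝ} (hU : 4 * (d : ℝ) < U) (hs : s ≤ 2 * d)
    (ω : Config d) {Λ : Finset (Site d)} {γ : Site d → Site d → ℝ} (hγ : IsDensityMatrix Λ γ) :
    let D := occ ω Λ
    let γD : Site d → Site d → ℝ := fun x y => if x ∈ D ∧ y ∈ D then γ x y else 0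
    energy 0 ω D γD - s * trace D γD + (s - U) * trace Λ γ -
      2 * d / (U - 4 * d) * (boundaryPairs D).card ≤ energy U ω Λ γ := by
  intro D γD
  have hdpos : (0 : ℝ) < d := by exact_mod_cast hd
  have hUpos : 0 < U - 4 * d := by linarith
  set C := Λ \ D with hC
  have hDΛ : D ⊆ Λ := occ_subset ω Λ
  have hsplit : ∀ f : Site d → ℝ, ∑ x ∈ Λ, f x = ∑ x ∈ C, f x + ∑ x ∈ D, f x := fun f =>
    (Finset.sum_sdiff hDΛ).symm
  set hop : Finset (Site d) → Finset (Site d) → ℝ := fun A B =>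
    ∑ x ∈ A, ∑ y ∈ B, if Adjacent x y then γ x y else 0 with hhop
  have hcomm : hop C D = hop D C := by
    simp only [hhop]
    rw [Finset.sum_comm]
    refine Finset.sum_congr rfl fun x _ => Finset.sum_congr rfl fun y _ => ?_
    rw [hγ.symm]
    simp only [adjacent_comm]
  have htot : hop Λ Λ = hop C C + 2 * hop D C + hop D D := by
    have : hop Λ Λ = (hop C C + hop C D) + (hop D C + hop D D) := by
      simp only [hhop, hsplit, Finset.sum_add_distrib]
    rw [this, hcomm]; ring
  have hCC : hop C C ≤ 2 * d * ∑ x ∈ C, γ x x := by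
    have h1 := (abs_le.1 (abs_sum_adjacent_le (hγ.restrict (Finset.sdiff_subset : C ⊆ Λ)))).2
    have h2 : trace C (fun x y => if x ∈ C ∧ y ∈ C then γ x y else 0) = ∑ x ∈ C, γ x x :=
      Finset.sum_congr rfl fun x hx => by simp [hx]
    rw [h2] at h1
    refine le_trans (le_of_eq ?_) h1
    refine Finset.sum_congr rfl fun x hx => Finset.sum_congr rfl fun y hy => ?_
    simp [hx, hy]
  -- The weight for which the bound on the `D`-`C` hopping uses up the gap `U - 4 d` exactly.
  set η : ℝ := (U - 4 * d) / (2 * d) with hη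
  have hηpos : 0 < η := by positivity
  have hDC : 2 * hop D C ≤ (boundaryPairs D).card / η + 2 * d * η * ∑ x ∈ C, γ x x := by
    have h1 : 2 * hop D C ≤ ∑ x ∈ D, ∑ y ∈ C, ((if Adjacent x y then 1 / η else 0) +
        (if Adjacent x y then η * γ y y else 0)) := by
      simp only [hhop, Finset.mul_sum]
      refine Finset.sum_le_sum fun x _ => Finset.sum_le_sum fun y _ => ?_
      split_ifs
      · have h2 := hγ.quadForm_pair x y (-η)
        have h3 := hγ.diag_le_one x
        rw [div_add' _ _ _ hηpos.ne', le_div_iff₀ hηpos]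
        nlinarith
      · simp
    refine h1.trans ?_
    simp only [Finset.sum_add_distrib]
    refine add_le_add ?_ ?_
    · rw [card_boundaryPairs]
      push_cast
      rw [Finset.sum_div]
      refine Finset.sum_le_sum fun x _ => ?_
      rw [sum_adjacent C x (fun _ => 1 / η), Finset.sum_const, nsmul_eq_mul, mul_one_div]
      refine div_le_div_of_nonneg_right ?_ hηpos.le
      have : (nbrs x).filter (· ∈ C) ⊆ (nbrs x).filter (· ∉ D) := by
        intro y hy
        rw [Finset.mem_filter] at hy ⊢
        exact ⟨hy.1, (Finset.mem_sdiff.1 hy.2).2⟩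
      exact_mod_cast Finset.card_le_card this
    · rw [Finset.sum_comm, Finset.mul_sum]
      refine Finset.sum_le_sum fun y _ => ?_
      simp only [adjacent_comm (y := y)]
      rw [sum_adjacent D y (fun _ => η * γ y y), Finset.sum_const, nsmul_eq_mul,
        mul_assoc (2 * (d : ℝ))]
      refine mul_le_mul_of_nonneg_right ?_ (mul_nonneg hηpos.le (hγ.diag_nonneg y))
      have := Finset.card_filter_le (nbrs y) (· ∈ D)
      rw [card_nbrs] at this
      exact_mod_cast this
  have hocc : (∑ x ∈ Λ, if ω x = true then γ x x else 0) = ∑ x ∈ D, γ x x := by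
    rw [← Finset.sum_filter]; rfl
  have htrD : trace D γD = ∑ x ∈ D, γ x x := Finset.sum_congr rfl fun x hx => by simp [γD, hx]
  have hDD : energy 0 ω D γD = -hop D D := by
    simp only [energy, zero_mul, sub_zero, hhop]
    congr 1
    refine Finset.sum_congr rfl fun x hx => Finset.sum_congr rfl fun y hy => ?_
    simp [γD, hx, hy]
  have hE : energy U ω Λ γ = -hop Λ Λ - U * ∑ x ∈ D, γ x x := by
    rw [energy, hocc]
  have hC0 : 0 ≤ ∑ x ∈ C, γ x x := Finset.sum_nonneg fun x _ => hγ.diag_nonneg x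
  have htr : trace Λ γ = ∑ x ∈ C, γ x x + ∑ x ∈ D, γ x x := hsplit _
  have e1 : ((boundaryPairs D).card : ℝ) / η = 2 * d / (U - 4 * d) * (boundaryPairs D).card := by
    rw [hη]; field_simp
  have e2 : 2 * d * η = U - 4 * d := by rw [hη]; field_simp
  rw [e1, e2] at hDC
  rw [hE, hDD, htrD, htr, htot]
  -- An electron on an empty site has at least the energy `s - U`, as `s ≤ 2 d`.
  nlinarith [mul_nonneg (sub_nonneg.2 hs) hC0]

end Decoupling

/-! ### The free dispersion relation on the momentum torus -/

section Dispersion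

open MeasureTheory UnitAddTorus

variable {d : ℕ}

/-- The normalized Haar measure on the momentum torus. -/
def momentum (d : ℕ) : Measure (UnitAddTorus (Fin d)) :=
  Measure.pi fun _ => (AddCircle.haarAddCircle : Measure UnitAddCircle)

instance : IsProbabilityMeasure (momentum d) :=
  inferInstanceAs (IsProbabilityMeasure (Measure.pi fun _ : Fin d => AddCircle.haarAddCircle))

/-- The plane wave `cos (2π k x)`. -/
def cosWave (x : Site d) (k : UnitAddTorus (Fin d)) : ℝ := (mFourier x k).re

/-- The plane wave `sin (2π k x)`. -/
def sinWave (x : Site d) (k : UnitAddTorus (Fin d)) : ℝ := (mFourier x k).im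

lemma continuous_cosWave (x : Site d) : Continuous (cosWave x) :=
  Complex.continuous_re.comp (mFourier x).continuous

lemma continuous_sinWave (x : Site d) : Continuous (sinWave x) :=
  Complex.continuous_im.comp (mFourier x).continuous

lemma norm_mFourier_apply (x : Site d) (k : UnitAddTorus (Fin d)) : ‖mFourier x k‖ = 1 := by
  simp only [mFourier, ContinuousMap.coe_mk, norm_prod, fourier_apply, Circle.norm_coe,
    Finset.prod_const_one]

lemma cosWave_sq_add (x : Site d) (k : UnitAddTorus (Fin d)) :
    cosWave x k ^ 2 + sinWave x k ^ 2 = 1 := by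
  have h := norm_mFourier_apply x k
  rw [← sq_eq_sq₀ (norm_nonneg _) zero_le_one, ← Complex.normSq_eq_norm_sq,
    Complex.normSq_apply] at h
  simp only [cosWave, sinWave]
  linarith

lemma cosWave_neg (x : Site d) (k : UnitAddTorus (Fin d)) : cosWave (-x) k = cosWave x k := by
  simp [cosWave, mFourier_neg]

lemma sinWave_neg (x : Site d) (k : UnitAddTorus (Fin d)) : sinWave (-x) k = -sinWave x k := by
  simp [sinWave, mFourier_neg]

lemma cosWave_add (x y : Site d) (k : UnitAddTorus (Fin d)) :
    cosWave (x + y) k = cosWave x k * cosWave y k - sinWave x k * sinWave y k := by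
  simp [cosWave, sinWave, mFourier_add]

lemma cosWave_sub (x y : Site d) (k : UnitAddTorus (Fin d)) :
    cosWave (x - y) k = cosWave x k * cosWave y k + sinWave x k * sinWave y k := by
  rw [sub_eq_add_neg, cosWave_add, cosWave_neg, sinWave_neg]; ring

lemma cosWave_zero (k : UnitAddTorus (Fin d)) : cosWave 0 k = 1 := by
  simp [cosWave, mFourier_zero]

lemma abs_cosWave_le (x : Site d) (k : UnitAddTorus (Fin d)) : |cosWave x k| ≤ 1 := by
  have h := cosWave_sq_add x k
  rw [abs_le]
  constructor <;> nlinarith [sq_nonneg (sinWave x k)]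

lemma integrable_of_continuous {f : UnitAddTorus (Fin d) → ℝ} (hf : Continuous f) :
    Integrable f (momentum d) :=
  hf.integrable_of_hasCompactSupport (HasCompactSupport.of_compactSpace f)

lemma integral_cosWave (x : Site d) :
    ∫ k, cosWave x k ∂(momentum d) = if x = 0 then 1 else 0 := by
  have h1 : ∫ k, mFourier x k ∂(momentum d) = if x = 0 then 1 else 0 := by
    have hf : ∀ n : ℤ, ∫ t : UnitAddCircle, fourier n t ∂AddCircle.haarAddCircle =
        if n = 0 then 1 else 0 := by
      intro n
      have := congrFun (fourierCoeff_fourier (T := 1) n) 0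
      simp only [fourierCoeff, neg_zero, fourier_zero, one_smul] at this
      rw [this]
      simp [Pi.single_apply, eq_comm]
    simp only [mFourier, ContinuousMap.coe_mk, momentum]
    rw [integral_fintype_prod_eq_prod (fun i t => fourier (x i) t)]
    simp only [hf]
    split_ifs with h
    · simp [h]
    · obtain ⟨i, hi⟩ := Function.ne_iff.1 h
      exact Finset.prod_eq_zero (Finset.mem_univ i) (if_neg hi)
  have h2 : Integrable (fun k => mFourier x k) (momentum d) :=
    (mFourier x).continuous.integrable_of_hasCompactSupport (HasCompactSupport.of_compactSpace _)
  have h3 : (∫ k, mFourier x k ∂(momentum d)).re = ∫ k, cosWave x k ∂(momentum d) :=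
    (integral_re h2).symm
  rw [← h3, h1]
  split_ifs <;> simp

/-- The dispersion relation `-2 ∑ cos (2π k_i)`. -/
def disp (k : UnitAddTorus (Fin d)) : ℝ := -2 * ∑ i, cosWave (unitVec i) k

lemma continuous_disp : Continuous (disp : UnitAddTorus (Fin d) → ℝ) :=
  continuous_const.mul (continuous_finsetSum _ fun _ _ => continuous_cosWave _)

lemma abs_disp_le (k : UnitAddTorus (Fin d)) : |disp k| ≤ 2 * d := by
  rw [disp, abs_mul]
  have : |∑ i : Fin d, cosWave (unitVec i) k| ≤ ∑ i : Fin d, 1 :=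
    (Finset.abs_sum_le_sum_abs _ _).trans (Finset.sum_le_sum fun i _ => abs_cosWave_le _ _)
  simp only [Finset.sum_const, Finset.card_univ, Fintype.card_fin, nsmul_eq_mul, mul_one] at this
  norm_num
  exact this

lemma integral_disp_mul_cosWave (x y : Site d) :
    ∫ k, disp k * cosWave (x - y) k ∂(momentum d) = -(if Adjacent x y then 1 else 0) := by
  have h : ∀ k, disp k * cosWave (x - y) k =
      -∑ i : Fin d, (cosWave (x + unitVec i - y) k + cosWave (x - unitVec i - y) k) := by
    intro k
    rw [disp, mul_assoc, Finset.sum_mul, Finset.mul_sum, ← Finset.sum_neg_distrib]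
    refine Finset.sum_congr rfl fun i _ => ?_
    rw [show x + unitVec i - y = (x - y) + unitVec i by abel,
      show x - unitVec i - y = (x - y) - unitVec i by abel, cosWave_add, cosWave_sub (x - y)]
    ring
  simp only [h, integral_neg]
  congr 1
  have hi : ∀ i : Fin d, Integrable (fun k => cosWave (x + unitVec i - y) k +
      cosWave (x - unitVec i - y) k) (momentum d) := fun i =>
    integrable_of_continuous ((continuous_cosWave _).add (continuous_cosWave _))
  rw [integral_finsetSum _ fun i _ => hi i]
  simp only [integral_add (integrable_of_continuous (continuous_cosWave _))
    (integrable_of_continuous (continuous_cosWave _)), integral_cosWave, sub_eq_zero]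
  have := sum_nbrs x fun z => if z = y then (1 : ℝ) else 0
  rw [← this]
  simp

lemma integral_disp (d : ℕ) : ∫ k, disp k ∂(momentum d) = 0 := by
  have := integral_disp_mul_cosWave (0 : Site d) 0
  simpa [cosWave_zero, not_adjacent_self] using this

lemma haarAddCircle_singleton (t : UnitAddCircle) :
    (AddCircle.haarAddCircle : Measure UnitAddCircle) {t} = 0 := by
  have h := AddCircle.volume_closedBall (T := 1) (x := t) 0
  have hv : (volume : Measure UnitAddCircle) = AddCircle.haarAddCircle := by
    rw [AddCircle.volume_eq_smul_haarAddCircle]; simp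
  rw [hv] at h
  simpa using h

lemma haarAddCircle_level (c : ℝ) :
    (AddCircle.haarAddCircle : Measure UnitAddCircle) {t | (fourier 1 t : ℂ).re = c} = 0 := by
  have hfin : Set.Finite {t : UnitAddCircle | (fourier 1 t : ℂ).re = c} := by
    have hinj : Function.Injective fun t : UnitAddCircle => (fourier 1 t : ℂ) := by
      intro t t' h
      simp only [fourier_one] at h
      exact AddCircle.injective_toCircle one_ne_zero (Subtype.ext h)
    have hf : Set.Finite {z : ℂ | z.re = c ∧ ‖z‖ = 1} := by
      refine Set.Finite.subset (Set.toFinite {(⟨c, Real.sqrt (1 - c ^ 2)⟩ : ℂ),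
        ⟨c, -Real.sqrt (1 - c ^ 2)⟩}) ?_
      rintro z ⟨h1, h2⟩
      have h3 : z.re * z.re + z.im * z.im = 1 := by
        rw [← Complex.normSq_apply, Complex.normSq_eq_norm_sq, h2]; norm_num
      have h4 : z.im ^ 2 = 1 - c ^ 2 := by rw [← h1]; linarith
      have h5 : Real.sqrt (1 - c ^ 2) = |z.im| := by rw [← h4, Real.sqrt_sq_eq_abs]
      simp only [Set.mem_insert_iff, Set.mem_singleton_iff, Complex.ext_iff, h5, h1, true_and]
      rcases abs_choice z.im with h | h <;> rw [h] <;> simp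
    refine (hf.preimage hinj.injOn).subset fun t ht => ⟨ht, ?_⟩
    simp only [fourier_apply, Circle.norm_coe]
  have : NullSingletonClass (AddCircle.haarAddCircle : Measure UnitAddCircle) :=
    ⟨haarAddCircle_singleton⟩
  exact hfin.measure_zero _

/-- The dispersion relation has no flat parts. -/
lemma momentum_level (hd : 1 ≤ d) (c : ℝ) : momentum d {k | disp k = c} = 0 := by
  obtain ⟨n, rfl⟩ : ∃ n, d = n + 1 := ⟨d - 1, by omega⟩
  have hmeas : MeasurableSet {k : UnitAddTorus (Fin (n + 1)) | disp k = c} :=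
    (isClosed_eq continuous_disp continuous_const).measurableSet
  have hmp := (measurePreserving_piFinSuccAbove
    (fun _ : Fin (n + 1) => (AddCircle.haarAddCircle : Measure UnitAddCircle)) 0).symm
  have hpre := hmp.measure_preimage hmeas.nullMeasurableSet
  unfold momentum
  rw [← hpre, Measure.prod_apply_symm (hmp.measurable hmeas)]
  refine (lintegral_congr fun y => ?_).trans lintegral_zero
  set c' : ℝ := (c + 2 * ∑ i : Fin n, (fourier 1 (y i) : ℂ).re) / (-2) with hc'
  refine measure_mono_null (fun t ht => ?_) (haarAddCircle_level c')
  have h : disp ((MeasurableEquiv.piFinSuccAbove (fun _ => UnitAddCircle) 0).symm (t, y)) = c := ht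
  simp only [disp, cosWave, unitVec, mFourier_single] at h
  rw [Fin.sum_univ_succ] at h
  have e0 : (MeasurableEquiv.piFinSuccAbove (fun _ : Fin (n + 1) => UnitAddCircle) 0).symm (t, y) 0
      = t := by simp [MeasurableEquiv.piFinSuccAbove]
  have es : ∀ i : Fin n, (MeasurableEquiv.piFinSuccAbove
      (fun _ : Fin (n + 1) => UnitAddCircle) 0).symm (t, y) i.succ = y i := by
    intro i
    simp [MeasurableEquiv.piFinSuccAbove]
  rw [e0] at h
  simp only [es] at h
  rw [Set.mem_ofPred_eq, hc', eq_div_iff (by norm_num)]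
  linarith

/-- Thin shells around a level set of the dispersion relation have small measure. -/
lemma exists_thin_shell (hd : 1 ≤ d) (s : ℝ) {ε : ℝ} (hε : 0 < ε) :
    ∃ δ > 0, (momentum d).real {k | |disp k - s| ≤ δ} ≤ ε := by
  set ν : Measure ℝ := (momentum d).map disp with hν
  have hm : Measurable (disp : UnitAddTorus (Fin d) → ℝ) := continuous_disp.measurable
  have hprob : IsProbabilityMeasure ν := Measure.isProbabilityMeasure_map hm.aemeasurable
  have h := tendsto_measure_Icc_nhdsWithin_right' ν s
  have h0 : ν {s} = 0 := by
    rw [hν, Measure.map_apply hm (measurableSet_singleton s)]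
    exact momentum_level hd s
  rw [h0] at h
  have hev := (h.eventually_le_const (u := ENNReal.ofReal ε) (by simpa using hε)).and
    self_mem_nhdsWithin
  obtain ⟨δ, hδ, hpos⟩ := hev.exists
  refine ⟨δ, hpos, ?_⟩
  rw [hν, Measure.map_apply hm measurableSet_Icc] at hδ
  have hset : disp ⁻¹' Set.Icc (s - δ) (s + δ) =
      {k : UnitAddTorus (Fin d) | |disp k - s| ≤ δ} := by
    ext k
    simp only [Set.mem_preimage, Set.mem_Icc, Set.mem_ofPred_eq, abs_le]
    constructor <;> rintro ⟨h1, h2⟩ <;> constructor <;> linarith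
  rw [hset] at hδ
  exact ENNReal.toReal_le_of_le_ofReal hε.le hδ

/-! ### The Fermi sea and the bulk energy -/

/-- The momentum distribution of the Fermi sea with Fermi level `s`. -/
def fermi (s : ℝ) (k : UnitAddTorus (Fin d)) : ℝ := if disp k < s then 1 else 0

lemma fermi_nonneg (s : ℝ) (k : UnitAddTorus (Fin d)) : 0 ≤ fermi s k := by
  unfold fermi; split_ifs <;> norm_num

lemma fermi_le_one (s : ℝ) (k : UnitAddTorus (Fin d)) : fermi s k ≤ 1 := by
  unfold fermi; split_ifs <;> norm_num

lemma measurable_fermi (s : ℝ) : Measurable (fermi s : UnitAddTorus (Fin d) → ℝ) :=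
  Measurable.ite (measurableSet_lt continuous_disp.measurable measurable_const)
    measurable_const measurable_const

lemma integrable_fermi_mul (s : ℝ) {f : UnitAddTorus (Fin d) → ℝ} (hf : Continuous f) :
    Integrable (fun k => fermi s k * f k) (momentum d) := by
  refine (integrable_of_continuous hf).bdd_mul (c := 1) (measurable_fermi s).aestronglyMeasurable
    (Eventually.of_forall fun k => ?_)
  rw [Real.norm_of_nonneg (fermi_nonneg s k)]
  exact fermi_le_one s k

lemma integrable_fermi (s : ℝ) :
    Integrable (fermi s : UnitAddTorus (Fin d) → ℝ) (momentum d) := by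
  simpa using integrable_fermi_mul s (continuous_const (y := (1 : ℝ)))

/-- The electronic density of the Fermi sea with Fermi level `s`. -/
def filling (d : ℕ) (s : ℝ) : ℝ := ∫ k, fermi s k ∂(momentum d)

/-- The grand-canonical potential (up to the sign) `∫ (s - disp)₊`. -/
def pressure (d : ℕ) (s : ℝ) : ℝ := ∫ k, max (s - disp k) 0 ∂(momentum d)

lemma continuous_max_disp (s : ℝ) :
    Continuous fun k : UnitAddTorus (Fin d) => max (s - disp k) 0 :=
  (continuous_const.sub continuous_disp).max continuous_const

lemma pressure_nonneg (d : ℕ) (s : ℝ) : 0 ≤ pressure d s :=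
  integral_nonneg fun _ => le_max_right _ _

lemma integral_le_measureReal {A : Set (UnitAddTorus (Fin d))} (hA : MeasurableSet A)
    {f : UnitAddTorus (Fin d) → ℝ} (hf : Integrable f (momentum d))
    (h : ∀ k, f k ≤ A.indicator 1 k) : ∫ k, f k ∂(momentum d) ≤ (momentum d).real A := by
  rw [← integral_indicator_one hA]
  exact integral_mono hf ((integrable_const 1).indicator hA) h

lemma continuous_filling (hd : 1 ≤ d) : Continuous (filling d) := by
  rw [Metric.continuous_iff]
  intro s ε hε
  obtain ⟨δ, hδ, hsh⟩ := exists_thin_shell hd s (half_pos hε)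
  refine ⟨δ, hδ, fun t ht => ?_⟩
  rw [Real.dist_eq] at ht ⊢
  have hA : MeasurableSet {k : UnitAddTorus (Fin d) | |disp k - s| ≤ δ} :=
    (isClosed_le (continuous_disp.sub continuous_const).abs continuous_const).measurableSet
  have habs := abs_lt.1 ht
  have key : ∀ a b : ℝ, (|a - s| < δ) → (|b - s| < δ) → ∀ k : UnitAddTorus (Fin d),
      fermi a k - fermi b k ≤ Set.indicator {k | |disp k - s| ≤ δ} 1 k := by
    intro a b ha hb k
    rw [abs_lt] at ha hb
    by_cases hk : |disp k - s| ≤ δ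
    · rw [Set.indicator_of_mem (by exact hk)]
      simp only [Pi.one_apply]
      linarith [fermi_le_one a k, fermi_nonneg b k]
    · rw [Set.indicator_of_notMem (by exact hk)]
      unfold fermi
      split_ifs with h1 h2
      · simp
      · exfalso
        apply hk
        rw [abs_le]
        constructor <;> linarith
      · norm_num
      · simp
  have h1 := integral_le_measureReal hA ((integrable_fermi t).sub (integrable_fermi s))
    (key t s ht (by simpa using hδ))
  have h2 := integral_le_measureReal hA ((integrable_fermi s).sub (integrable_fermi t))
    (key s t (by simpa using hδ) ht)
  simp only [Pi.sub_apply] at h1 h2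
  rw [integral_sub (integrable_fermi _) (integrable_fermi _)] at h1 h2
  rw [abs_lt]
  unfold filling
  constructor <;> linarith

lemma exists_filling_eq (hd : 1 ≤ d) {ρ : ℝ} (h0 : 0 ≤ ρ) (h1 : ρ ≤ 1) :
    ∃ s : ℝ, |s| ≤ 2 * d ∧ filling d s = ρ := by
  have e0 : filling d (-(2 * d)) = 0 := by
    unfold filling
    refine (integral_congr_ae (Eventually.of_forall fun k => ?_)).trans (integral_zero _ _)
    have := abs_le.1 (abs_disp_le k)
    simp only [fermi]
    rw [if_neg (not_lt.2 this.1)]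
  have e1 : filling d (2 * d) = 1 := by
    unfold filling
    have hne : ∀ᵐ k ∂(momentum d), disp k ≠ 2 * d := by
      rw [ae_iff]
      simpa using momentum_level hd (2 * d : ℝ)
    have : ∀ᵐ k ∂(momentum d), fermi (2 * d) k = 1 := by
      filter_upwards [hne] with k hk
      have := abs_le.1 (abs_disp_le k)
      unfold fermi
      rw [if_pos (lt_of_le_of_ne this.2 hk)]
    rw [integral_congr_ae this]
    simp
  have hle : -(2 * d : ℝ) ≤ 2 * d := by
    have : (0 : ℝ) ≤ d := Nat.cast_nonneg d
    linarith
  obtain ⟨s, hs, hsρ⟩ := intermediate_value_Icc hle (continuous_filling hd).continuousOn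
    (show ρ ∈ Set.Icc (filling d (-(2 * d))) (filling d (2 * d)) by rw [e0, e1]; exact ⟨h0, h1⟩)
  exact ⟨s, abs_le.2 hs, hsρ⟩

open Classical in
/-- A Fermi level with electronic density `ρ`. -/
def fermiLevel (d : ℕ) (ρ : ℝ) : ℝ :=
  if h : ∃ s : ℝ, |s| ≤ 2 * d ∧ filling d s = ρ then h.choose else 0

lemma fermiLevel_spec (hd : 1 ≤ d) {ρ : ℝ} (hρ : ρ ∈ Set.Icc (0 : ℝ) 1) :
    |fermiLevel d ρ| ≤ 2 * d ∧ filling d (fermiLevel d ρ) = ρ := by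
  have h := exists_filling_eq hd hρ.1 hρ.2
  unfold fermiLevel
  rw [dif_pos h]
  exact h.choose_spec

/-- The energy per site of free electrons with density `ρ`. -/
def bulkEnergy (d : ℕ) (ρ : ℝ) : ℝ := fermiLevel d ρ * ρ - pressure d (fermiLevel d ρ)

lemma integral_disp_mul_fermi (s : ℝ) :
    ∫ k, fermi s k * disp k ∂(momentum d) = s * filling d s - pressure d s := by
  unfold filling pressure
  rw [← integral_const_mul, ← integral_sub ((integrable_fermi s).const_mul s)
    (integrable_of_continuous (continuous_max_disp s))]
  refine integral_congr_ae (Eventually.of_forall fun k => ?_)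
  simp only [fermi]
  split_ifs with h
  · rw [max_eq_left (by linarith)]; ring
  · rw [max_eq_right (by linarith)]; ring

lemma bulkEnergy_eq (hd : 1 ≤ d) {ρ : ℝ} (hρ : ρ ∈ Set.Icc (0 : ℝ) 1) :
    bulkEnergy d ρ = ∫ k, fermi (fermiLevel d ρ) k * disp k ∂(momentum d) := by
  rw [integral_disp_mul_fermi, (fermiLevel_spec hd hρ).2, bulkEnergy]

lemma excess_nonneg (s t : ℝ) (k : UnitAddTorus (Fin d)) :
    0 ≤ fermi t k * (disp k - s) + max (s - disp k) 0 := by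
  rcases le_total s (disp k) with h | h
  · rw [max_eq_right (by linarith), add_zero]
    exact mul_nonneg (fermi_nonneg _ _) (by linarith)
  · rw [max_eq_left (by linarith)]
    nlinarith [fermi_le_one t k]

lemma integrable_excess (s t : ℝ) :
    Integrable (fun k : UnitAddTorus (Fin d) => fermi t k * (disp k - s) + max (s - disp k) 0)
      (momentum d) :=
  (integrable_fermi_mul t (continuous_disp.sub continuous_const)).add
    (integrable_of_continuous (continuous_max_disp s))

lemma integral_excess (s t : ℝ) :
    ∫ k : UnitAddTorus (Fin d), (fermi t k * (disp k - s) + max (s - disp k) 0) ∂(momentum d) =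
      t * filling d t - pressure d t - s * filling d t + pressure d s := by
  have hi : Integrable (fun k : UnitAddTorus (Fin d) => fermi t k * (disp k - s)) (momentum d) :=
    integrable_fermi_mul t (continuous_disp.sub continuous_const)
  rw [integral_add hi (integrable_of_continuous (continuous_max_disp s))]
  congr 1
  simp only [mul_sub]
  rw [integral_sub (integrable_fermi_mul t continuous_disp)
    (integrable_fermi_mul t continuous_const), integral_disp_mul_fermi, integral_mul_const,
    mul_comm s]
  rfl

/-- The bulk energy lies above its tangents. -/
lemma le_bulkEnergy (hd : 1 ≤ d) {ρ : ℝ} (hρ : ρ ∈ Set.Icc (0 : ℝ) 1) (s : ℝ) :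
    s * ρ - pressure d s ≤ bulkEnergy d ρ := by
  have h : 0 ≤ ∫ k : UnitAddTorus (Fin d), (fermi (fermiLevel d ρ) k * (disp k - s) +
      max (s - disp k) 0) ∂(momentum d) := integral_nonneg fun k => excess_nonneg _ _ k
  rw [integral_excess, (fermiLevel_spec hd hρ).2] at h
  unfold bulkEnergy
  linarith

/-- The tangent of the bulk energy at `ρ` touches it only there. -/
lemma eq_of_bulkEnergy_eq (hd : 1 ≤ d) {ρ r : ℝ} (hρ : ρ ∈ Set.Icc (0 : ℝ) 1)
    (hr : r ∈ Set.Icc (0 : ℝ) 1)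
    (h : bulkEnergy d r = fermiLevel d ρ * r - pressure d (fermiLevel d ρ)) : r = ρ := by
  set s := fermiLevel d ρ
  set t := fermiLevel d r
  have hr2 : filling d t = r := (fermiLevel_spec hd hr).2
  have h0 : ∫ k : UnitAddTorus (Fin d), (fermi t k * (disp k - s) + max (s - disp k) 0)
      ∂(momentum d) = 0 := by
    rw [integral_excess, hr2]
    have : bulkEnergy d r = t * r - pressure d t := rfl
    linarith
  rw [integral_eq_zero_iff_of_nonneg (fun k => excess_nonneg s t k) (integrable_excess s t)] at h0
  have hne : ∀ᵐ k ∂(momentum d), disp k ≠ s := by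
    rw [ae_iff]
    simpa using momentum_level hd s
  have hae : ∀ᵐ k ∂(momentum d), fermi t k = fermi s k := by
    filter_upwards [h0, hne] with k hk hks
    simp only [Pi.zero_apply] at hk
    rcases lt_or_gt_of_ne hks with hlt | hgt
    · rw [max_eq_left (by linarith)] at hk
      have e : fermi s k = 1 := if_pos hlt
      rw [e]
      have : (fermi t k - 1) * (disp k - s) = 0 := by linarith
      rcases mul_eq_zero.1 this with h | h <;> linarith
    · rw [max_eq_right (by linarith), add_zero] at hk
      have e : fermi s k = 0 := if_neg (not_lt.2 hgt.le)
      rw [e]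
      rcases mul_eq_zero.1 hk with h | h <;> linarith
  rw [← hr2, ← (fermiLevel_spec hd hρ).2]
  exact integral_congr_ae hae

lemma bulkEnergy_zero (hd : 1 ≤ d) : bulkEnergy d 0 = 0 := by
  have h0 : (0 : ℝ) ∈ Set.Icc (0 : ℝ) 1 := by simp
  rw [bulkEnergy_eq hd h0]
  have h := (fermiLevel_spec hd h0).2
  unfold filling at h
  rw [integral_eq_zero_iff_of_nonneg (fun k => fermi_nonneg _ k) (integrable_fermi _)] at h
  refine (integral_congr_ae ?_).trans (integral_zero _ ℝ)
  filter_upwards [h] with k hk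
  rw [hk]; simp

lemma bulkEnergy_one (hd : 1 ≤ d) : bulkEnergy d 1 = 0 := by
  have h1 : (1 : ℝ) ∈ Set.Icc (0 : ℝ) 1 := by simp
  rw [bulkEnergy_eq hd h1, ← integral_disp d]
  have h := (fermiLevel_spec hd h1).2
  have h2 : ∫ k, (1 - fermi (fermiLevel d 1) k) ∂(momentum d) = 0 := by
    rw [integral_sub (integrable_const _) (integrable_fermi _)]
    unfold filling at h
    rw [h]; simp
  rw [integral_eq_zero_iff_of_nonneg (fun k => sub_nonneg.2 (fermi_le_one _ k))
    ((integrable_const _).sub (integrable_fermi _))] at h2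
  refine integral_congr_ae ?_
  filter_upwards [h2] with k hk
  simp only [Pi.zero_apply] at hk
  rw [show fermi (fermiLevel d 1) k = 1 by linarith, one_mul]

lemma bulkEnergy_neg (hd : 1 ≤ d) {ρ : ℝ} (hρ : ρ ∈ Set.Ioo (0 : ℝ) 1) : bulkEnergy d ρ < 0 := by
  have hρ' : ρ ∈ Set.Icc (0 : ℝ) 1 := ⟨hρ.1.le, hρ.2.le⟩
  by_contra! h
  set s := fermiLevel d ρ with hs
  have e : bulkEnergy d ρ = s * ρ - pressure d s := rfl
  have hp := pressure_nonneg d s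
  have h1 := le_bulkEnergy hd (show (1 : ℝ) ∈ Set.Icc (0 : ℝ) 1 by simp) s
  rw [bulkEnergy_one hd] at h1
  have hs0 : s = 0 := by
    rcases lt_trichotomy s 0 with h2 | h2 | h2
    · nlinarith [hρ.1]
    · exact h2
    · nlinarith [hρ.2]
  have hp0 : pressure d s = 0 := by
    rw [e, hs0, zero_mul] at h
    rw [hs0] at hp ⊢
    linarith
  have := eq_of_bulkEnergy_eq hd hρ' (show (0 : ℝ) ∈ Set.Icc (0 : ℝ) 1 by simp)
    (by rw [bulkEnergy_zero hd, ← hs, hp0, mul_zero, sub_zero])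
  exact hρ.1.ne this

lemma bulkEnergy_nonpos (hd : 1 ≤ d) {ρ : ℝ} (hρ : ρ ∈ Set.Icc (0 : ℝ) 1) :
    bulkEnergy d ρ ≤ 0 := by
  rcases eq_or_lt_of_le hρ.1 with rfl | h0
  · rw [bulkEnergy_zero hd]
  rcases eq_or_lt_of_le hρ.2 with rfl | h1
  · rw [bulkEnergy_one hd]
  · exact (bulkEnergy_neg hd ⟨h0, h1⟩).le

lemma pressure_neg_two_mul (d : ℕ) : pressure d (-(2 * d)) = 0 := by
  unfold pressure
  refine (integral_congr_ae (Eventually.of_forall fun k => ?_)).trans (integral_zero _ _)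
  have := abs_le.1 (abs_disp_le k)
  exact max_eq_right (by linarith)

/-- By the symmetry between the directions, the correlation between nearest neighbours is given
by the energy. -/
lemma integral_fermi_mul_cosWave (hd : 1 ≤ d) {ρ : ℝ} (hρ : ρ ∈ Set.Icc (0 : ℝ) 1) (i : Fin d) :
    ∫ k, fermi (fermiLevel d ρ) k * cosWave (unitVec i) k ∂(momentum d) =
      |bulkEnergy d ρ| / (2 * d) := by
  set s := fermiLevel d ρ
  have hsym : ∀ j, ∫ k, fermi s k * cosWave (unitVec j) k ∂(momentum d) =
      ∫ k, fermi s k * cosWave (unitVec i) k ∂(momentum d) := by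
    intro j
    set e := MeasurableEquiv.piCongrLeft (fun _ : Fin d => UnitAddCircle) (Equiv.swap i j)
    have hmp : MeasurePreserving e (momentum d) (momentum d) := measurePreserving_piCongrLeft
        (fun _ : Fin d => (AddCircle.haarAddCircle : Measure UnitAddCircle)) (Equiv.swap i j)
    have he : ∀ (k : UnitAddTorus (Fin d)) (l : Fin d), e k l = k (Equiv.swap i j l) := by
      intro k l
      have := Equiv.piCongrLeft_apply_apply (fun _ : Fin d => UnitAddCircle) (Equiv.swap i j) k
        (Equiv.swap i j l)
      rw [Equiv.swap_apply_self] at this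
      exact this
    have hcos : ∀ (l : Fin d) (k : UnitAddTorus (Fin d)),
        cosWave (unitVec l) (e k) = cosWave (unitVec (Equiv.swap i j l)) k := by
      intro l k
      simp only [cosWave, unitVec, mFourier_single, he]
    have hdisp : ∀ k : UnitAddTorus (Fin d), disp (e k) = disp k := by
      intro k
      simp only [disp, hcos]
      rw [Equiv.sum_comp (Equiv.swap i j) (fun l => cosWave (unitVec l) k)]
    have hcomp := hmp.integral_comp' (fun k => fermi s k * cosWave (unitVec i) k)
    simp only [fermi, hdisp, hcos, Equiv.swap_apply_left] at hcomp
    exact hcomp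
  have hsum : ∑ j : Fin d, -2 * ∫ k, fermi s k * cosWave (unitVec j) k ∂(momentum d) =
      bulkEnergy d ρ := by
    rw [bulkEnergy_eq hd hρ, ← Finset.mul_sum, ← integral_finsetSum _ fun j _ =>
      integrable_fermi_mul _ (continuous_cosWave _), ← integral_const_mul]
    refine integral_congr_ae (Eventually.of_forall fun k => ?_)
    simp only [disp, ← Finset.mul_sum]
    ring
  simp only [hsym, Finset.sum_const, Finset.card_univ, Fintype.card_fin, nsmul_eq_mul] at hsum
  have hdpos : (0 : ℝ) < d := by exact_mod_cast hd
  rw [abs_of_nonpos (bulkEnergy_nonpos hd hρ), ← hsum]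
  field_simp

end Dispersion

/-! ### Bounds on the energy of electrons confined to a domain -/

section Confined

open MeasureTheory

variable {d : ℕ}

lemma quadForm_cosWave (D : Finset (Site d)) (φ : Site d → ℝ) (k : UnitAddTorus (Fin d)) :
    ∑ x ∈ D, ∑ y ∈ D, φ x * cosWave (x - y) k * φ y =
      (∑ x ∈ D, φ x * cosWave x k) ^ 2 + (∑ x ∈ D, φ x * sinWave x k) ^ 2 := by
  simp only [pow_two, Finset.sum_mul_sum, ← Finset.sum_add_distrib]
  refine Finset.sum_congr rfl fun x _ => Finset.sum_congr rfl fun y _ => ?_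
  rw [cosWave_sub]; ring

lemma integral_sum_cosWave (D : Finset (Site d)) (c : Site d → Site d → ℝ) :
    ∫ k, ∑ x ∈ D, ∑ y ∈ D, c x y * cosWave (x - y) k ∂(momentum d) = ∑ x ∈ D, c x x := by
  have hi : ∀ x y : Site d, Integrable (fun k => c x y * cosWave (x - y) k) (momentum d) :=
    fun x y => integrable_of_continuous (continuous_const.mul (continuous_cosWave _))
  rw [integral_finsetSum _ fun x _ => integrable_finsetSum _ fun y _ => hi x y]
  refine Finset.sum_congr rfl fun x hx => ?_
  rw [integral_finsetSum _ fun y _ => hi x y]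
  simp only [integral_const_mul, integral_cosWave, sub_eq_zero]
  simp [hx]

lemma integral_quadForm_cosWave (D : Finset (Site d)) (φ : Site d → ℝ) :
    ∫ k, ((∑ x ∈ D, φ x * cosWave x k) ^ 2 + (∑ x ∈ D, φ x * sinWave x k) ^ 2) ∂(momentum d) =
      ∑ x ∈ D, φ x ^ 2 := by
  have := integral_sum_cosWave D fun x y => φ x * φ y
  simp only [← pow_two] at this
  rw [← this]
  refine integral_congr_ae (Eventually.of_forall fun k => ?_)
  simp only [← quadForm_cosWave]
  exact Finset.sum_congr rfl fun x _ => Finset.sum_congr rfl fun y _ => by ring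

/-- The density matrix of the Fermi sea, restricted to the domain `D`. -/
def seaMatrix (s : ℝ) (D : Finset (Site d)) (x y : Site d) : ℝ :=
  if x ∈ D ∧ y ∈ D then ∫ k, fermi s k * cosWave (x - y) k ∂(momentum d) else 0

lemma continuous_sum_cosWave (D : Finset (Site d)) (φ : Site d → ℝ) :
    Continuous fun k => ∑ x ∈ D, φ x * cosWave x k :=
  continuous_finsetSum _ fun _ _ => continuous_const.mul (continuous_cosWave _)

lemma continuous_sum_sinWave (D : Finset (Site d)) (φ : Site d → ℝ) :
    Continuous fun k => ∑ x ∈ D, φ x * sinWave x k :=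
  continuous_finsetSum _ fun _ _ => continuous_const.mul (continuous_sinWave _)

lemma isDensityMatrix_seaMatrix (s : ℝ) (D : Finset (Site d)) :
    IsDensityMatrix D (seaMatrix s D) := by
  have hc : ∀ φ : Site d → ℝ, Continuous fun k =>
      (∑ x ∈ D, φ x * cosWave x k) ^ 2 + (∑ x ∈ D, φ x * sinWave x k) ^ 2 := fun φ =>
    ((continuous_sum_cosWave D φ).pow 2).add ((continuous_sum_sinWave D φ).pow 2)
  have e : ∀ φ : Site d → ℝ, ∑ x ∈ D, ∑ y ∈ D, φ x * seaMatrix s D x y * φ y =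
      ∫ k, fermi s k * ((∑ x ∈ D, φ x * cosWave x k) ^ 2 + (∑ x ∈ D, φ x * sinWave x k) ^ 2)
        ∂(momentum d) := by
    intro φ
    have hi : ∀ x y : Site d, Integrable (fun k => φ x * φ y * (fermi s k * cosWave (x - y) k))
        (momentum d) := fun x y => (integrable_fermi_mul s (continuous_cosWave _)).const_mul _
    calc _ = ∑ x ∈ D, ∑ y ∈ D, ∫ k, φ x * φ y * (fermi s k * cosWave (x - y) k)
          ∂(momentum d) := by
          refine Finset.sum_congr rfl fun x hx => Finset.sum_congr rfl fun y hy => ?_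
          rw [integral_const_mul, seaMatrix, if_pos ⟨hx, hy⟩]; ring
      _ = ∫ k, ∑ x ∈ D, ∑ y ∈ D, φ x * φ y * (fermi s k * cosWave (x - y) k) ∂(momentum d) := by
          rw [integral_finsetSum _ fun x _ => integrable_finsetSum _ fun y _ => hi x y]
          exact Finset.sum_congr rfl fun x _ => (integral_finsetSum _ fun y _ => hi x y).symm
      _ = _ := by
          refine integral_congr_ae (Eventually.of_forall fun k => ?_)
          simp only [← quadForm_cosWave, Finset.mul_sum]
          exact Finset.sum_congr rfl fun x _ => Finset.sum_congr rfl fun y _ => by ring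
  refine ⟨fun x y => ?_, fun x y hx => if_neg fun h => hx h.1, fun φ => ?_, fun φ => ?_⟩
  · simp only [seaMatrix, and_comm]
    rw [← neg_sub x y]
    simp only [cosWave_neg]
  · rw [e]
    exact integral_nonneg fun k => mul_nonneg (fermi_nonneg s k) (by positivity)
  · rw [e, ← integral_quadForm_cosWave]
    refine integral_mono (integrable_fermi_mul s (hc φ)) (integrable_of_continuous (hc φ))
      fun k => ?_
    exact mul_le_of_le_one_left (by positivity) (fermi_le_one s k)

lemma trace_seaMatrix (s : ℝ) (D : Finset (Site d)) :
    trace D (seaMatrix s D) = filling d s * D.card := by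
  unfold trace
  rw [Finset.sum_congr rfl fun x hx => show seaMatrix s D x x = filling d s by
    simp [seaMatrix, hx, filling, cosWave_zero]]
  simp [mul_comm]

/-- Each site of `D` has `2 d` bonds in the bulk; those across the boundary are lost. -/
lemma sum_adjacent_seaMatrix (hd : 1 ≤ d) {ρ : ℝ} (hρ : ρ ∈ Set.Icc (0 : ℝ) 1)
    (D : Finset (Site d)) :
    -(∑ x ∈ D, ∑ y ∈ D, if Adjacent x y then seaMatrix (fermiLevel d ρ) D x y else 0) =
      bulkEnergy d ρ * D.card + |bulkEnergy d ρ| / (2 * d) * (boundaryPairs D).card := by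
  set p : ℝ := |bulkEnergy d ρ| / (2 * d) with hp
  have hdpos : (0 : ℝ) < d := by exact_mod_cast hd
  have hb : bulkEnergy d ρ = -(2 * d * p) := by
    rw [hp, abs_of_nonpos (bulkEnergy_nonpos hd hρ)]; field_simp
  have h1 : ∀ x ∈ D, ∑ y ∈ D, (if Adjacent x y then seaMatrix (fermiLevel d ρ) D x y else 0) =
      p * (2 * d - ((nbrs x).filter (· ∉ D)).card) := by
    intro x hx
    have : ∀ y ∈ D, (if Adjacent x y then seaMatrix (fermiLevel d ρ) D x y else 0) =
        if Adjacent x y then p else 0 := by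
      intro y hy
      split_ifs with h
      · rw [seaMatrix, if_pos ⟨hx, hy⟩, hp]
        obtain ⟨i, rfl | rfl⟩ := adjacent_iff.1 h
        · rw [← integral_fermi_mul_cosWave hd hρ i, show x - (x + unitVec i) = -unitVec i by abel]
          simp only [cosWave_neg]
        · rw [← integral_fermi_mul_cosWave hd hρ i, show x - (x - unitVec i) = unitVec i by abel]
      · rfl
    rw [Finset.sum_congr rfl this, sum_adjacent D x fun _ => p, Finset.sum_const, nsmul_eq_mul]
    have hc := Finset.card_filter_add_card_filter_not (s := nbrs x) (· ∈ D)
    rw [card_nbrs] at hc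
    have hc' : (((nbrs x).filter (· ∈ D)).card : ℝ) + ((nbrs x).filter (· ∉ D)).card = 2 * d := by
      exact_mod_cast hc
    rw [← hc']; ring
  rw [Finset.sum_congr rfl h1, ← Finset.mul_sum, Finset.sum_sub_distrib, card_boundaryPairs, hb]
  push_cast
  simp only [Finset.sum_const, nsmul_eq_mul]
  ring

/-- The upper bound on the canonical energy; the trial state is the Fermi sea cut off to the
occupied sites. -/
lemma minEnergy_le_bulk (hd : 1 ≤ d) (U : ℝ) (ω : Config d) (Λ : Finset (Site d)) {ρ : ℝ}
    (hρ : ρ ∈ Set.Icc (0 : ℝ) 1) :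
    minEnergy U ω Λ (ρ * (occ ω Λ).card) ≤ (bulkEnergy d ρ - U * ρ) * (occ ω Λ).card +
      |bulkEnergy d ρ| / (2 * d) * (boundaryPairs (occ ω Λ)).card := by
  set D := occ ω Λ with hD
  set s := fermiLevel d ρ with hs
  have hγ := isDensityMatrix_seaMatrix s D
  have hsub : ∀ z ∈ ({0} : Finset ℕ), D ⊆ Λ := fun _ _ => occ_subset ω Λ
  have hb := IsDensityMatrix.blocks (Z := {(0 : ℕ)}) (A := fun _ => D)
    (γ := fun _ => seaMatrix s D) (fun _ _ => hγ) hsub (by simp)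
  have h := minEnergy_le hb U ω
  rw [energy_blocks U ω (fun _ _ => hγ) hsub, trace_blocks (fun _ _ => hγ) hsub] at h
  simp only [Finset.sum_singleton, trace_seaMatrix, (fermiLevel_spec hd hρ).2, hs] at h
  refine h.trans_eq ?_
  have hocc : (∑ x ∈ D, if ω x = true then seaMatrix (fermiLevel d ρ) D x x else 0) =
      ρ * D.card := by
    rw [← (fermiLevel_spec hd hρ).2, ← trace_seaMatrix]
    simp only [(fermiLevel_spec hd hρ).2]
    exact Finset.sum_congr rfl fun x hx => if_pos (mem_occ.1 hx).2
  rw [energy, hocc, sum_adjacent_seaMatrix hd hρ]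
  ring

/-- The squared distance, at momentum `k`, between the `y`-th columns of the density matrix `γ`
and of the Fermi sea. -/
def columnDist (s : ℝ) (D : Finset (Site d)) (γ : Site d → Site d → ℝ) (y : Site d)
    (k : UnitAddTorus (Fin d)) : ℝ :=
  (∑ x ∈ D, γ y x * cosWave x k - fermi s k * cosWave y k) ^ 2 +
    (∑ x ∈ D, γ y x * sinWave x k - fermi s k * sinWave y k) ^ 2

lemma columnDist_nonneg (s : ℝ) (D : Finset (Site d)) (γ : Site d → Site d → ℝ) (y : Site d)
    (k : UnitAddTorus (Fin d)) : 0 ≤ columnDist s D γ y k := by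
  unfold columnDist; positivity

lemma integrable_mul_columnDist (s : ℝ) (D : Finset (Site d)) (γ : Site d → Site d → ℝ)
    (y : Site d) {f : UnitAddTorus (Fin d) → ℝ} (hf : Continuous f) :
    Integrable (fun k => f k * columnDist s D γ y k) (momentum d) := by
  have hA := continuous_sum_cosWave D (γ y)
  have hB := continuous_sum_sinWave D (γ y)
  have hC := continuous_cosWave y
  have hS := continuous_sinWave y
  have h1 : Integrable (fun k => f k * ((∑ x ∈ D, γ y x * cosWave x k) ^ 2 +
      (∑ x ∈ D, γ y x * sinWave x k) ^ 2)) (momentum d) :=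
    integrable_of_continuous (by fun_prop)
  have h2 : Integrable (fun k => fermi s k * (f k * (1 - 2 * ((∑ x ∈ D, γ y x * cosWave x k) *
      cosWave y k + (∑ x ∈ D, γ y x * sinWave x k) * sinWave y k)))) (momentum d) :=
    integrable_fermi_mul s (by fun_prop)
  refine (h1.add h2).congr (Eventually.of_forall fun k => ?_)
  simp only [Pi.add_apply, columnDist]
  have e := cosWave_sq_add y k
  unfold fermi
  split_ifs
  · linear_combination (-f k) * e
  · ring

/-- The excess of the grand-canonical energy of `γ` over the bulk value bounds the weighted
distance to the Fermi sea, because `γ² ≤ γ` and `(1 - γ)² ≤ 1 - γ`. -/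
lemma sum_integral_columnDist_le (ω : Config d) {D : Finset (Site d)} {γ : Site d → Site d → ℝ}
    (hγ : IsDensityMatrix D γ) (s : ℝ) :
    ∑ y ∈ D, ∫ k, |disp k - s| * columnDist s D γ y k ∂(momentum d) ≤
      energy 0 ω D γ - s * trace D γ + pressure d s * D.card := by
  set R : UnitAddTorus (Fin d) → ℝ := fun k => ∑ x ∈ D, ∑ y ∈ D, γ x y * cosWave (x - y) k with hR
  have hRc : Continuous R := continuous_finsetSum _ fun x _ => continuous_finsetSum _ fun y _ =>
    continuous_const.mul (continuous_cosWave _)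
  have e1 : ∫ k, R k ∂(momentum d) = trace D γ := integral_sum_cosWave D γ
  have e2 : ∫ k, disp k * R k ∂(momentum d) = energy 0 ω D γ := by
    have hi : ∀ x y : Site d, Integrable (fun k => γ x y * (disp k * cosWave (x - y) k))
        (momentum d) := fun x y => integrable_of_continuous
      (continuous_const.mul (continuous_disp.mul (continuous_cosWave _)))
    calc _ = ∫ k, ∑ x ∈ D, ∑ y ∈ D, γ x y * (disp k * cosWave (x - y) k) ∂(momentum d) := by
          refine integral_congr_ae (Eventually.of_forall fun k => ?_)
          simp only [hR, Finset.mul_sum]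
          exact Finset.sum_congr rfl fun x _ => Finset.sum_congr rfl fun y _ => by ring
      _ = ∑ x ∈ D, ∑ y ∈ D, γ x y * -(if Adjacent x y then 1 else 0) := by
          rw [integral_finsetSum _ fun x _ => integrable_finsetSum _ fun y _ => hi x y]
          refine Finset.sum_congr rfl fun x _ => ?_
          rw [integral_finsetSum _ fun y _ => hi x y]
          simp only [integral_const_mul, integral_disp_mul_cosWave]
      _ = _ := by
          rw [energy, zero_mul, sub_zero]
          simp only [← Finset.sum_neg_distrib]
          refine Finset.sum_congr rfl fun x _ => Finset.sum_congr rfl fun y _ => ?_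
          split_ifs <;> simp
  have e3 : energy 0 ω D γ - s * trace D γ + pressure d s * D.card =
      ∫ k, ((disp k - s) * R k + max (s - disp k) 0 * D.card) ∂(momentum d) := by
    have i1 : Integrable (fun k => (disp k - s) * R k) (momentum d) :=
      integrable_of_continuous ((continuous_disp.sub continuous_const).mul hRc)
    have i2 : Integrable (fun k : UnitAddTorus (Fin d) => max (s - disp k) 0 * (D.card : ℝ))
        (momentum d) :=
      integrable_of_continuous ((continuous_max_disp s).mul continuous_const)
    have i3 : Integrable (fun k => disp k * R k) (momentum d) :=
      integrable_of_continuous (continuous_disp.mul hRc)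
    have i4 : Integrable (fun k => s * R k) (momentum d) :=
      integrable_of_continuous (continuous_const.mul hRc)
    rw [integral_add i1 i2, integral_mul_const, ← e1, ← e2]
    simp only [sub_mul]
    rw [integral_sub i3 i4, integral_const_mul]
    rfl
  have hcont : Continuous fun k : UnitAddTorus (Fin d) => |disp k - s| :=
    (continuous_disp.sub continuous_const).abs
  rw [e3, ← integral_finsetSum _ fun y _ => integrable_mul_columnDist s D γ y hcont]
  refine integral_mono (integrable_finsetSum _ fun y _ =>
    integrable_mul_columnDist s D γ y hcont) (integrable_of_continuous
      (((continuous_disp.sub continuous_const).mul hRc).add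
        ((continuous_max_disp s).mul continuous_const))) fun k => ?_
  simp only [← Finset.mul_sum]
  set qC := ∑ x ∈ D, ∑ y ∈ D, cosWave x k * γ x y * cosWave y k with hqC
  set qS := ∑ x ∈ D, ∑ y ∈ D, sinWave x k * γ x y * sinWave y k with hqS
  have hRk : R k = qC + qS := by
    simp only [hR, hqC, hqS, ← Finset.sum_add_distrib]
    refine Finset.sum_congr rfl fun x _ => Finset.sum_congr rfl fun y _ => ?_
    rw [cosWave_sub]; ring
  -- Inside the Fermi sea the holes `1 - γ` contribute, outside it the electrons `γ`.
  by_cases hk : disp k < s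
  · rw [abs_of_neg (by linarith), max_eq_left (by linarith)]
    have hcompl : ∀ φ : Site d → ℝ, ∑ y ∈ D, (∑ x ∈ D, γ y x * φ x - φ y) ^ 2 ≤
        ∑ x ∈ D, φ x ^ 2 - ∑ x ∈ D, ∑ y ∈ D, φ x * γ x y * φ y := by
      intro φ
      have h := hγ.compl.sum_sq_le φ
      have h1 : ∀ y ∈ D, ∑ x ∈ D, ((if y = x ∧ y ∈ D then 1 else 0) - γ y x) * φ x =
          -(∑ x ∈ D, γ y x * φ x - φ y) := by
        intro y hy
        simp only [sub_mul, Finset.sum_sub_distrib]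
        simp [hy]
      have h2 : ∀ x ∈ D, ∑ y ∈ D, φ x * ((if x = y ∧ x ∈ D then 1 else 0) - γ x y) * φ y =
          φ x ^ 2 - ∑ y ∈ D, φ x * γ x y * φ y := by
        intro x hx
        simp only [mul_sub, sub_mul, Finset.sum_sub_distrib]
        simp [hx, pow_two]
      rw [Finset.sum_congr rfl fun y hy => by rw [h1 y hy, neg_sq], Finset.sum_congr rfl h2,
        Finset.sum_sub_distrib] at h
      exact h
    have hC := hcompl fun x => cosWave x k
    have hS := hcompl fun x => sinWave x k
    have hcard : ∑ x ∈ D, cosWave x k ^ 2 + ∑ x ∈ D, sinWave x k ^ 2 = D.card := by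
      rw [← Finset.sum_add_distrib]
      simp [cosWave_sq_add]
    have hle : ∑ y ∈ D, columnDist s D γ y k ≤ D.card - R k := by
      simp only [columnDist, fermi, if_pos hk, one_mul, Finset.sum_add_distrib]
      rw [hRk]
      linarith
    have := mul_le_mul_of_nonneg_left hle (by linarith : 0 ≤ s - disp k)
    linarith
  · push Not at hk
    rw [abs_of_nonneg (by linarith), max_eq_right (by linarith), zero_mul, add_zero]
    have hC := hγ.sum_sq_le fun x => cosWave x k
    have hS := hγ.sum_sq_le fun x => sinWave x k
    have hle : ∑ y ∈ D, columnDist s D γ y k ≤ R k := by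
      simp only [columnDist, fermi, if_neg (not_lt.2 hk), zero_mul, sub_zero,
        Finset.sum_add_distrib]
      rw [hRk]
      exact add_le_add hC hS
    exact mul_le_mul_of_nonneg_left hle (by linarith)

/-- The columns of `γ` and of the Fermi sea have norm at most `1`. -/
lemma integral_columnDist_le {D : Finset (Site d)} {γ : Site d → Site d → ℝ}
    (hγ : IsDensityMatrix D γ) (s : ℝ) (y : Site d) :
    ∫ k, columnDist s D γ y k ∂(momentum d) ≤ 4 := by
  have hrow : ∑ x ∈ D, γ y x ^ 2 ≤ 1 := by
    by_cases hy : y ∈ D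
    · have h := hγ.sum_sq_le fun z => if z = y then 1 else 0
      simp only [mul_ite, mul_one, mul_zero, Finset.sum_ite_eq', hy, if_true, ite_mul, one_mul,
        zero_mul] at h
      simp only [hγ.symm y]
      exact h.trans (hγ.diag_le_one y)
    · simp [hγ.supp y _ hy]
  have hA := continuous_sum_cosWave D (γ y)
  have hB := continuous_sum_sinWave D (γ y)
  have hi : Integrable (fun k => (∑ x ∈ D, γ y x * cosWave x k) ^ 2 +
      (∑ x ∈ D, γ y x * sinWave x k) ^ 2) (momentum d) := integrable_of_continuous (by fun_prop)
  have hW := integrable_mul_columnDist s D γ y (continuous_const (y := (1 : ℝ)))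
  simp only [one_mul] at hW
  calc _ ≤ ∫ k, (2 * ((∑ x ∈ D, γ y x * cosWave x k) ^ 2 +
        (∑ x ∈ D, γ y x * sinWave x k) ^ 2) + 2) ∂(momentum d) := by
        refine integral_mono hW ((hi.const_mul 2).add (integrable_const 2)) fun k => ?_
        have e := cosWave_sq_add y k
        have hf : fermi s k ^ 2 ≤ 1 := by
          have := fermi_nonneg s k
          have := fermi_le_one s k
          nlinarith
        simp only [columnDist]
        nlinarith [sq_nonneg (∑ x ∈ D, γ y x * cosWave x k + fermi s k * cosWave y k),
          sq_nonneg (∑ x ∈ D, γ y x * sinWave x k + fermi s k * sinWave y k)]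
    _ = 2 * ∑ x ∈ D, γ y x ^ 2 + 2 := by
        rw [integral_add (hi.const_mul 2) (integrable_const 2), integral_const_mul,
          integral_quadForm_cosWave]
        simp
    _ ≤ 4 := by linarith

/-- At a boundary site `y`, the column of a density matrix supported in `D` vanishes at a
neighbour of `y` outside `D`, where the Fermi sea has a nonzero correlation. Hence the two cannot
be close, even in the norm that is weighted by the distance to the Fermi level, since the
dispersion relation has no flat parts. -/
lemma exists_le_integral_columnDist (hd : 1 ≤ d) {ρ : ℝ} (hρ : ρ ∈ Set.Ioo (0 : ℝ) 1) :
    ∃ c > 0, ∀ (D : Finset (Site d)) (γ : Site d → Site d → ℝ), IsDensityMatrix D γ →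
      ∀ x y, x ∉ D → Adjacent y x →
      c ≤ ∫ k, |disp k - fermiLevel d ρ| * columnDist (fermiLevel d ρ) D γ y k ∂(momentum d) := by
  have hρ' : ρ ∈ Set.Icc (0 : ℝ) 1 := ⟨hρ.1.le, hρ.2.le⟩
  set s := fermiLevel d ρ with hs
  have hdpos : (0 : ℝ) < d := by exact_mod_cast hd
  set p : ℝ := |bulkEnergy d ρ| / (2 * d) with hp
  have hppos : 0 < p := by
    have := abs_pos.2 (bulkEnergy_neg hd hρ).ne
    positivity
  -- Chosen such that `4 η + η = p / 4`.
  set η : ℝ := p / 20 with hη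
  have hηpos : 0 < η := by positivity
  obtain ⟨δ, hδ, hsh⟩ := exists_thin_shell hd s (show 0 < η * p by positivity)
  refine ⟨2 * η * δ * p, by positivity, fun D γ hγ x y hx hxy => ?_⟩
  set Y := ∫ k, |disp k - s| * columnDist s D γ y k ∂(momentum d) with hY
  set A : UnitAddTorus (Fin d) → ℝ := fun k => ∑ z ∈ D, γ y z * cosWave z k with hA
  set B : UnitAddTorus (Fin d) → ℝ := fun k => ∑ z ∈ D, γ y z * sinWave z k with hB
  have hAc : Continuous A := continuous_sum_cosWave D (γ y)
  have hBc : Continuous B := continuous_sum_sinWave D (γ y)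
  -- `r` integrates to the difference between the entries `(y, x)` of the Fermi sea and of `γ`.
  set r : UnitAddTorus (Fin d) → ℝ := fun k =>
    fermi s k * cosWave (y - x) k - (A k * cosWave x k + B k * sinWave x k) with hr
  have hCx := continuous_cosWave x
  have hSx := continuous_sinWave x
  have i1 : Integrable (fun k => fermi s k * cosWave (y - x) k) (momentum d) :=
    integrable_fermi_mul s (continuous_cosWave _)
  have i2 : Integrable (fun k => A k * cosWave x k + B k * sinWave x k) (momentum d) :=
    integrable_of_continuous (by fun_prop)
  have hrint : ∫ k, r k ∂(momentum d) = p := by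
    have h1 : ∫ k, fermi s k * cosWave (y - x) k ∂(momentum d) = p := by
      rw [hp]
      obtain ⟨i, rfl | rfl⟩ := adjacent_iff.1 hxy
      · rw [← integral_fermi_mul_cosWave hd hρ' i, show y - (y + unitVec i) = -unitVec i by abel]
        simp only [cosWave_neg, hs]
      · rw [← integral_fermi_mul_cosWave hd hρ' i, show y - (y - unitVec i) = unitVec i by abel]
    have h2 : ∫ k, (A k * cosWave x k + B k * sinWave x k) ∂(momentum d) = 0 := by
      have : ∀ k, A k * cosWave x k + B k * sinWave x k =
          ∑ z ∈ D, γ y z * cosWave (z - x) k := by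
        intro k
        simp only [hA, hB, Finset.sum_mul, ← Finset.sum_add_distrib]
        refine Finset.sum_congr rfl fun z _ => ?_
        rw [cosWave_sub]; ring
      simp only [this]
      have hi : ∀ z : Site d, Integrable (fun k => γ y z * cosWave (z - x) k) (momentum d) :=
        fun z => integrable_of_continuous (continuous_const.mul (continuous_cosWave _))
      rw [integral_finsetSum _ fun z _ => hi z]
      refine Finset.sum_eq_zero fun z hz => ?_
      rw [integral_const_mul, integral_cosWave, if_neg, mul_zero]
      rw [sub_eq_zero]
      rintro rfl
      exact hx hz
    rw [integral_sub i1 i2, h1, h2, sub_zero]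
  set W := columnDist s D γ y with hW
  have hrW : ∀ k, r k ^ 2 ≤ W k := by
    intro k
    have e := cosWave_sq_add x k
    have : r k = -((A k - fermi s k * cosWave y k) * cosWave x k +
        (B k - fermi s k * sinWave y k) * sinWave x k) := by
      simp only [hr, cosWave_sub]; ring
    rw [this, hW]
    simp only [columnDist]
    set u := A k - fermi s k * cosWave y k
    set v := B k - fermi s k * sinWave y k
    nlinarith [sq_nonneg (u * sinWave x k - v * cosWave x k)]
  have hW0 : ∀ k, 0 ≤ W k := columnDist_nonneg s D γ y
  set shell : Set (UnitAddTorus (Fin d)) := {k | |disp k - s| ≤ δ} with hshell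
  have hmeas : MeasurableSet shell :=
    (isClosed_le (continuous_disp.sub continuous_const).abs continuous_const).measurableSet
  -- `|r| ≤ √W`, with the weight in Young's inequality depending on whether `k` is in the shell.
  have hpt : ∀ k, r k ≤ η * W k + η + 1 / (4 * η) * shell.indicator 1 k +
      1 / (4 * η * δ) * (|disp k - s| * W k) := by
    intro k
    by_cases hk : k ∈ shell
    · rw [Set.indicator_of_mem hk, Pi.one_apply, mul_one]
      have h1 : r k ≤ η * r k ^ 2 + 1 / (4 * η) := by
        have : η * r k ^ 2 + 1 / (4 * η) - r k = η * (r k - 1 / (2 * η)) ^ 2 := by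
          field_simp; ring
        have := mul_nonneg hηpos.le (sq_nonneg (r k - 1 / (2 * η)))
        linarith
      have h2 := mul_le_mul_of_nonneg_left (hrW k) hηpos.le
      have h3 : 0 ≤ 1 / (4 * η * δ) * (|disp k - s| * W k) :=
        mul_nonneg (by positivity) (mul_nonneg (abs_nonneg _) (hW0 k))
      linarith
    · rw [Set.indicator_of_notMem hk, mul_zero, add_zero]
      have hk' : δ < |disp k - s| := not_le.1 hk
      have h1 : r k ≤ η + 1 / (4 * η) * r k ^ 2 := by
        have : η + 1 / (4 * η) * r k ^ 2 - r k = 1 / (4 * η) * (r k - 2 * η) ^ 2 := by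
          field_simp; ring
        have : 0 ≤ 1 / (4 * η) * (r k - 2 * η) ^ 2 := by positivity
        linarith
      have h2 : 1 / (4 * η) * r k ^ 2 ≤ 1 / (4 * η * δ) * (|disp k - s| * W k) := by
        have h3 : δ * r k ^ 2 ≤ |disp k - s| * W k :=
          mul_le_mul hk'.le (hrW k) (sq_nonneg _) (abs_nonneg _)
        have h4 : 1 / (4 * η) * r k ^ 2 = 1 / (4 * η * δ) * (δ * r k ^ 2) := by field_simp
        rw [h4]
        exact mul_le_mul_of_nonneg_left h3 (by positivity)
      have h5 := mul_nonneg hηpos.le (hW0 k)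
      linarith
  have j1 : Integrable W (momentum d) := by
    have := integrable_mul_columnDist s D γ y (continuous_const (y := (1 : ℝ)))
    simpa only [one_mul] using this
  have j2 : Integrable (fun k => |disp k - s| * W k) (momentum d) :=
    integrable_mul_columnDist s D γ y (continuous_disp.sub continuous_const).abs
  have j3 : Integrable (shell.indicator (1 : UnitAddTorus (Fin d) → ℝ)) (momentum d) :=
    (integrable_const (1 : ℝ)).indicator hmeas
  have h4 := integral_columnDist_le hγ s y
  have hint := integral_mono (i1.sub i2) ((((j1.const_mul η).add (integrable_const η)).add
    (j3.const_mul (1 / (4 * η)))).add (j2.const_mul (1 / (4 * η * δ)))) hpt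
  simp only [Pi.add_apply, Pi.sub_apply] at hint
  rw [show ∫ k, (fermi s k * cosWave (y - x) k - (A k * cosWave x k + B k * sinWave x k))
    ∂(momentum d) = p from hrint] at hint
  have k1 : Integrable (fun k => η * W k) (momentum d) := j1.const_mul η
  have k2 : Integrable (fun k => η * W k + η) (momentum d) := k1.add (integrable_const η)
  have k3 : Integrable (fun k => 1 / (4 * η) *
    shell.indicator (1 : UnitAddTorus (Fin d) → ℝ) k) (momentum d) := j3.const_mul _
  have k4 : Integrable (fun k => η * W k + η + 1 / (4 * η) *
    shell.indicator (1 : UnitAddTorus (Fin d) → ℝ) k) (momentum d) := k2.add k3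
  rw [integral_add k4 (j2.const_mul _), integral_add k2 k3, integral_add k1 (integrable_const η),
    integral_const_mul, integral_const_mul, integral_const_mul, integral_indicator_one hmeas] at hint
  simp only [integral_const, probReal_univ, smul_eq_mul, one_mul] at hint
  have h5 : 1 / (4 * η) * (momentum d).real shell ≤ p / 4 := by
    calc _ ≤ 1 / (4 * η) * (η * p) := mul_le_mul_of_nonneg_left hsh (by positivity)
      _ = p / 4 := by field_simp
  have h6 : η * ∫ k, W k ∂(momentum d) ≤ η * 4 := mul_le_mul_of_nonneg_left h4 hηpos.le
  -- `p ≤ 4 η + η + p / 4 + Y / (4 η δ)`.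
  have h7 : p / 2 ≤ 1 / (4 * η * δ) * Y := by
    rw [hY]
    linarith
  calc 2 * η * δ * p = 4 * η * δ * (p / 2) := by ring
    _ ≤ 4 * η * δ * (1 / (4 * η * δ) * Y) := mul_le_mul_of_nonneg_left h7 (by positivity)
    _ = Y := by field_simp

/-- The lower bound on the energy of electrons confined to `D`, with a boundary term that is
uniform in the domain and in the number of electrons. -/
theorem exists_boundary_constant (hd : 1 ≤ d) {ρ : ℝ} (hρ : ρ ∈ Set.Ioo (0 : ℝ) 1) :
    ∃ a > 0, ∀ (ω : Config d) (D : Finset (Site d)) (γ : Site d → Site d → ℝ),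
      IsDensityMatrix D γ → a * (boundaryPairs D).card ≤
        energy 0 ω D γ - fermiLevel d ρ * trace D γ + pressure d (fermiLevel d ρ) * D.card := by
  obtain ⟨c, hc, h⟩ := exists_le_integral_columnDist hd hρ
  have hdpos : (0 : ℝ) < d := by exact_mod_cast hd
  refine ⟨c / (2 * d), by positivity, fun ω D γ hγ => ?_⟩
  refine le_trans ?_ (sum_integral_columnDist_le ω hγ _)
  rw [card_boundaryPairs]
  push_cast
  rw [Finset.mul_sum]
  refine Finset.sum_le_sum fun y _ => ?_
  rcases Finset.eq_empty_or_nonempty ((nbrs y).filter (· ∉ D)) with he | ⟨x, hx⟩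
  · rw [he]
    simp only [Finset.card_empty, Nat.cast_zero, mul_zero]
    exact integral_nonneg fun k => mul_nonneg (abs_nonneg _) (columnDist_nonneg _ _ _ _ _)
  · rw [Finset.mem_filter, mem_nbrs] at hx
    refine le_trans ?_ (h D γ hγ x y hx.2 hx.1)
    have hcard : (((nbrs y).filter (· ∉ D)).card : ℝ) ≤ 2 * d := by
      have := Finset.card_filter_le (nbrs y) (· ∉ D)
      rw [card_nbrs] at this
      exact_mod_cast this
    calc _ ≤ c / (2 * d) * (2 * d) := mul_le_mul_of_nonneg_left hcard (by positivity)
      _ = c := by field_simp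

end Confined

/-! ### Cubes and periods -/

section Cubes

variable {d : ℕ}

lemma mem_cube {c x : Site d} {L : ℕ} : x ∈ cube c L ↔ ∀ i, c i ≤ x i ∧ x i ≤ c i + L := by
  simp only [cube, Finset.mem_Icc, Pi.le_def]
  exact forall_and.symm

lemma card_cube (c : Site d) (L : ℕ) : (cube c L).card = (L + 1) ^ d := by
  rw [cube, Pi.card_Icc]
  simp only [Int.card_Icc]
  rw [Finset.prod_congr rfl fun i _ => show (c i + (L : ℤ) + 1 - c i).toNat = L + 1 by omega]
  simp

lemma card_cube_pos (c : Site d) (L : ℕ) : (0 : ℝ) < (cube c L).card := by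
  rw [card_cube]; positivity

instance : (cubeFilter d).NeBot :=
  comap_neBot fun t ht => by
    obtain ⟨n, hn⟩ := (mem_atTop_sets.1 ht)
    exact ⟨(0, n), hn n le_rfl⟩

lemma eventually_cubeFilter {P : ℕ → Prop} (h : ∀ᶠ L in atTop, P L) :
    ∀ᶠ Q in cubeFilter d, P Q.2 := h.comap _

lemma tendsto_cubeFilter {f : ℕ → ℝ} {l : Filter ℝ} (h : Tendsto f atTop l) :
    Tendsto (fun Q : Site d × ℕ => f Q.2) (cubeFilter d) l := h.comp tendsto_comap

/-- `p` is a period in all the lattice directions. -/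
def IsPeriod (ω : Config d) (p : ℕ) : Prop := ∀ (x j : Site d), ω (x + fun i => p * j i) = ω x

/-- The group of the translations that leave a configuration invariant. -/
def invariances (ω : Config d) : AddSubgroup (Site d) where
  carrier := {z | ∀ x, ω (x + z) = ω x}
  zero_mem' := by simp
  add_mem' := by
    intro a b ha hb x
    rw [← add_assoc, hb, ha]
  neg_mem' := by
    intro a ha x
    rw [← ha (x + -a), neg_add_cancel_right]

lemma IsPeriod.mul {ω : Config d} {p : ℕ} (h : IsPeriod ω p) (k : ℕ) : IsPeriod ω (p * k) := by
  intro x j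
  have := h x fun i => k * j i
  rw [← this]
  congr 2
  funext i
  push_cast
  ring

lemma exists_isPeriod {ω : Config d} (h : Periodic ω) : ∃ p, 0 < p ∧ IsPeriod ω p := by
  choose p hp hω using h
  refine ⟨∏ i, p i, Finset.prod_pos fun i _ => hp i, fun x j => ?_⟩
  have hmem : (fun i => ((∏ i, p i : ℕ) : ℤ) * j i) ∈ invariances ω := by
    have : (fun i => ((∏ i, p i : ℕ) : ℤ) * j i) =
        ∑ i, ((∏ l ∈ Finset.univ.erase i, (p l : ℤ)) * j i) • (Pi.single i (p i : ℤ) : Site d) := by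
      funext l
      rw [Finset.sum_apply]
      simp only [Pi.smul_apply, Pi.single_apply, smul_eq_mul, mul_ite, mul_zero]
      rw [Finset.sum_ite_eq Finset.univ l]
      simp only [Finset.mem_univ, if_true]
      rw [Nat.cast_prod, ← Finset.mul_prod_erase _ _ (Finset.mem_univ l)]
      ring
    rw [this]
    exact AddSubgroup.sum_mem _ fun i _ => AddSubgroup.zsmul_mem (invariances ω) (show Pi.single i (p i : ℤ) ∈ invariances ω from hω i) _
  exact hmem x

lemma IsPeriod.periodic {ω : Config d} {p : ℕ} (hp : 0 < p) (h : IsPeriod ω p) : Periodic ω := by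
  intro i
  refine ⟨p, hp, fun x => ?_⟩
  rw [← h x (Pi.single i 1)]
  congr 2
  funext l
  simp [Pi.single_apply]

/-- A configuration is constant unless some pair of neighbours is half occupied. -/
lemma exists_adjacent_of_ne {ω : Config d} (h0 : ω ≠ emptyConfig d) (h1 : ω ≠ fullConfig d) :
    ∃ x y, Adjacent x y ∧ ω x = true ∧ ω y = false := by
  by_contra! hcon
  have hadj : ∀ x y, Adjacent x y → ω y = ω x := by
    intro x y hxy
    cases hx : ω x
    · cases hy : ω y
      · rfl
      · exact absurd hx (hcon y x (adjacent_comm.1 hxy) hy)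
    · simpa using hcon x y hxy hx
  have hinv : ∀ z, z ∈ invariances ω := by
    intro z
    have : z = ∑ i, z i • unitVec i := by
      funext l
      rw [Finset.sum_apply]
      simp [Pi.single_apply]
    rw [this]
    refine AddSubgroup.sum_mem _ fun i _ => AddSubgroup.zsmul_mem _ (fun x => ?_) _
    exact hadj _ _ (adjacent_iff.2 ⟨i, Or.inl rfl⟩)
  have hconst : ∀ x, ω x = ω 0 := fun x => by simpa using hinv x 0
  cases h : ω 0
  · exact h0 (funext fun x => by rw [hconst, h]; rfl)
  · exact h1 (funext fun x => by rw [hconst, h]; rfl)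

/-- A large cube is filled by the translates of a fixed cube of side `L₀ + 1 ≤ p` by multiples
of `p`, up to the fraction of the volume lost between these translates. -/
lemma exists_translates {p : ℕ} (hp : 0 < p) (c₀ : Site d) {L₀ : ℕ} (hL : L₀ + 1 ≤ p) {ε : ℝ}
    (hε : 0 < ε) : ∀ᶠ Q in cubeFilter d, ∃ Z : Finset (Site d),
      (∀ z ∈ Z, ∃ j : Site d, z = fun i => p * j i) ∧
      (∀ z ∈ Z, (cube c₀ L₀).image (· + z) ⊆ cube Q.1 Q.2) ∧
      (Z : Set (Site d)).PairwiseDisjoint (fun z => (cube c₀ L₀).image (· + z)) ∧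
      (((cube c₀ L₀).card : ℝ) / p ^ d - ε) * (cube Q.1 Q.2).card ≤
        Z.card * (cube c₀ L₀).card ∧
      (Z.card : ℝ) * (cube c₀ L₀).card ≤ (cube Q.1 Q.2).card := by
  have hlim : Tendsto (fun L : ℕ => (1 - 2 * (p : ℝ) / ((L : ℝ) + 1)) ^ d) atTop (𝓝 1) := by
    have h1 : Tendsto (fun L : ℕ => 2 * (p : ℝ) / ((L : ℝ) + 1)) atTop (𝓝 0) :=
      tendsto_const_nhds.div_atTop (tendsto_atTop_add_const_right _ _ tendsto_natCast_atTop_atTop)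
    simpa using ((tendsto_const_nhds (x := (1 : ℝ))).sub h1).pow d
  have hev : ∀ᶠ L : ℕ in atTop, 1 - ε < (1 - 2 * (p : ℝ) / ((L : ℝ) + 1)) ^ d ∧ 2 * p ≤ L + 1 :=
    (hlim.eventually_const_lt (by linarith)).and
      ((eventually_ge_atTop (2 * p)).mono fun L hL => by omega)
  filter_upwards [eventually_cubeFilter hev] with Q hQ
  obtain ⟨hQ1, hQ2⟩ := hQ
  obtain ⟨c, L⟩ := Q
  simp only at hQ1 hQ2 ⊢
  -- `m` cells of side `p` per direction fit into the cube at any offset.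
  set m : ℕ := (L + 1) / p - 1 with hm
  have hmp : m * p + p ≤ L + 1 := by
    have h1 : 2 ≤ (L + 1) / p := (Nat.le_div_iff_mul_le hp).2 (by omega)
    have h2 : (L + 1) / p * p ≤ L + 1 := Nat.div_mul_le_self _ _
    have h3 : m + 1 = (L + 1) / p := by omega
    rw [← h3] at h2
    linarith
  have hmp' : L + 1 ≤ m * p + 2 * p := by
    have h1 : 2 ≤ (L + 1) / p := (Nat.le_div_iff_mul_le hp).2 (by omega)
    have h2 := Nat.lt_div_mul_add (a := L + 1) hp
    have h3 : m + 1 = (L + 1) / p := by omega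
    rw [← h3] at h2
    linarith
  set T : Finset (Fin d → ℕ) := Fintype.piFinset fun _ => Finset.range m with hT
  set g : (Fin d → ℕ) → Site d := fun t i => p * (-((c₀ i - c i) / p) + t i) with hg
  have hpz : (0 : ℤ) < p := by exact_mod_cast hp
  have hginj : Function.Injective g := by
    intro t t' h
    funext i
    have := congrFun h i
    simp only [hg] at this
    have := mul_left_cancel₀ hpz.ne' this
    omega
  have hsub : ∀ z ∈ T.image g, (cube c₀ L₀).image (· + z) ⊆ cube c L := by
    intro z hz x hx
    obtain ⟨t, ht, rfl⟩ := Finset.mem_image.1 hz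
    obtain ⟨w, hw, rfl⟩ := Finset.mem_image.1 hx
    rw [mem_cube] at hw ⊢
    intro i
    have hti : t i < m := Finset.mem_range.1 (Fintype.mem_piFinset.1 ht i)
    have hw' := hw i
    have e1 := Int.emod_add_mul_ediv (c₀ i - c i) p
    have e2 := Int.emod_nonneg (c₀ i - c i) hpz.ne'
    have e3 := Int.emod_lt_of_pos (c₀ i - c i) hpz
    have e4 : (p : ℤ) * (t i + 1) ≤ p * m := by
      apply mul_le_mul_of_nonneg_left _ hpz.le
      exact_mod_cast hti
    have e5 : (m : ℤ) * p + p ≤ L + 1 := by exact_mod_cast hmp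
    have e6 : 0 ≤ (p : ℤ) * t i := by positivity
    have e7 : ((L₀ : ℤ)) + 1 ≤ p := by exact_mod_cast hL
    simp only [Pi.add_apply, hg, mul_add, mul_neg]
    constructor <;> linarith
  have hdisj : ((T.image g : Finset (Site d)) : Set (Site d)).PairwiseDisjoint
      (fun z => (cube c₀ L₀).image (· + z)) := by
    intro z hz z' hz' hne
    obtain ⟨t, -, rfl⟩ := Finset.mem_image.1 hz
    obtain ⟨t', -, rfl⟩ := Finset.mem_image.1 hz'
    rw [Function.onFun, Finset.disjoint_left]
    intro x hx hx'
    obtain ⟨w, hw, rfl⟩ := Finset.mem_image.1 hx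
    obtain ⟨w', hw', h⟩ := Finset.mem_image.1 hx'
    rw [mem_cube] at hw hw'
    apply hne
    congr 1
    funext i
    have h1 := congrFun h i
    simp only [Pi.add_apply, hg, mul_add, mul_neg] at h1
    have h2 := hw i
    have h3 := hw' i
    have e7 : ((L₀ : ℤ)) + 1 ≤ p := by exact_mod_cast hL
    have h4 : (p : ℤ) * ((t i : ℤ) - t' i) = w' i - w i := by linarith
    have h5 : (p : ℤ) * ((t i : ℤ) - t' i) < p * 1 := by linarith
    have h6 : (p : ℤ) * (-1) < p * ((t i : ℤ) - t' i) := by linarith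
    have h7 := lt_of_mul_lt_mul_left h5 hpz.le
    have h8 := lt_of_mul_lt_mul_left h6 hpz.le
    omega
  have hcardZ : (T.image g).card = m ^ d := by
    rw [Finset.card_image_of_injective _ hginj, hT, Fintype.card_piFinset]
    simp
  refine ⟨T.image g, fun z hz => ?_, hsub, hdisj, ?_, ?_⟩
  · obtain ⟨t, -, rfl⟩ := Finset.mem_image.1 hz
    exact ⟨fun i => -((c₀ i - c i) / p) + t i, rfl⟩
  · rw [hcardZ, card_cube, card_cube]
    push_cast
    have hpR : (0 : ℝ) < (p : ℝ) ^ d := by positivity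
    set k : ℝ := ((L₀ : ℝ) + 1) ^ d with hk
    have hk0 : 0 ≤ k := by positivity
    have hkp : k / (p : ℝ) ^ d ≤ 1 := by
      rw [div_le_one hpR]
      exact pow_le_pow_left₀ (by positivity) (by exact_mod_cast hL) d
    have hn : (0 : ℝ) < (L : ℝ) + 1 := by positivity
    have h1 : ((m : ℝ) * p) ^ d ≥ (1 - ε) * ((L : ℝ) + 1) ^ d := by
      have h2 : (1 - 2 * (p : ℝ) / ((L : ℝ) + 1)) * ((L : ℝ) + 1) ≤ m * p := by
        rw [sub_mul, div_mul_cancel₀ _ hn.ne']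
        have : ((L : ℝ) + 1) ≤ m * p + 2 * p := by exact_mod_cast hmp'
        linarith
      have h3 : 0 ≤ 1 - 2 * (p : ℝ) / ((L : ℝ) + 1) := by
        rw [sub_nonneg, div_le_one hn]
        exact_mod_cast hQ2
      calc ((m : ℝ) * p) ^ d ≥ ((1 - 2 * (p : ℝ) / ((L : ℝ) + 1)) * ((L : ℝ) + 1)) ^ d :=
            pow_le_pow_left₀ (by positivity) h2 d
        _ = (1 - 2 * (p : ℝ) / ((L : ℝ) + 1)) ^ d * ((L : ℝ) + 1) ^ d := mul_pow _ _ _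
        _ ≥ _ := mul_le_mul_of_nonneg_right hQ1.le (by positivity)
    calc (k / (p : ℝ) ^ d - ε) * ((L : ℝ) + 1) ^ d
        ≤ k / (p : ℝ) ^ d * ((1 - ε) * ((L : ℝ) + 1) ^ d) := by
          have : 0 ≤ ε * (1 - k / (p : ℝ) ^ d) * ((L : ℝ) + 1) ^ d :=
            mul_nonneg (mul_nonneg hε.le (by linarith)) (by positivity)
          linarith
      _ ≤ k / (p : ℝ) ^ d * ((m : ℝ) * p) ^ d :=
          mul_le_mul_of_nonneg_left h1 (div_nonneg hk0 hpR.le)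
      _ = m ^ d * k := by rw [mul_pow]; field_simp
  · have h1 : ((T.image g).biUnion fun z => (cube c₀ L₀).image (· + z)).card =
        (T.image g).card * (cube c₀ L₀).card := by
      rw [Finset.card_biUnion hdisj]
      rw [Finset.sum_congr rfl fun z _ => Finset.card_image_of_injective _ (add_left_injective z)]
      simp
    have h2 := Finset.card_le_card (Finset.biUnion_subset.2 hsub)
    rw [h1] at h2
    exact_mod_cast h2

/-- Almost subadditive bounded functions of cubes have limits. -/
lemma exists_tendsto_of_almost_le {f : Site d × ℕ → ℝ} {C : ℝ} (hC : ∀ Q, |f Q| ≤ C)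
    (h : ∀ ε > 0, ∀ᶠ K in cubeFilter d, ∀ᶠ Q in cubeFilter d, f Q ≤ f K + ε) :
    ∃ l, Tendsto f (cubeFilter d) (𝓝 l) := by
  -- Values near the upper limit cannot follow values near the lower one.
  refine tendsto_of_no_upcrossings dense_univ ?_ ?_ ?_
  · rintro a - b - hab ⟨h1, h2⟩
    obtain ⟨K, hK1, hK2⟩ := (h1.and_eventually (h (b - a) (sub_pos.2 hab))).exists
    obtain ⟨Q, hQ1, hQ2⟩ := (h2.and_eventually hK2).exists
    linarith
  · exact isBoundedUnder_of ⟨C, fun Q => (abs_le.1 (hC Q)).2⟩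
  · exact isBoundedUnder_of ⟨-C, fun Q => (abs_le.1 (hC Q)).1⟩

/-- Every large cube fits tightly into a period cell. -/
lemma eventually_exists_period {ω : Config d} {p : ℕ} (hp : 0 < p) (hω : IsPeriod ω p) {ε : ℝ}
    (hε : 0 < ε) : ∀ᶠ K in cubeFilter d, ∃ q, 0 < q ∧ IsPeriod ω q ∧ K.2 + 1 ≤ q ∧
      1 - ε ≤ ((cube K.1 K.2).card : ℝ) / q ^ d := by
  have hlim : Tendsto (fun L : ℕ => (1 - (p : ℝ) / ((L : ℝ) + 1 + p)) ^ d) atTop (𝓝 1) := by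
    have h1 : Tendsto (fun L : ℕ => (p : ℝ) / ((L : ℝ) + 1 + p)) atTop (𝓝 0) :=
      tendsto_const_nhds.div_atTop (tendsto_atTop_add_const_right _ _
        (tendsto_atTop_add_const_right _ _ tendsto_natCast_atTop_atTop))
    simpa using ((tendsto_const_nhds (x := (1 : ℝ))).sub h1).pow d
  filter_upwards [eventually_cubeFilter (hlim.eventually_const_le (by linarith : 1 - ε < 1))]
    with K hK
  set L := K.2 with hL
  refine ⟨p * ((L + 1) / p + 1), by positivity, hω.mul _, ?_, ?_⟩
  · have := Nat.lt_div_mul_add (a := L + 1) hp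
    rw [mul_add, mul_one, mul_comm]
    exact this.le
  · refine hK.trans ?_
    rw [card_cube]
    push_cast
    rw [← div_pow]
    have hq : (p : ℝ) * (((L + 1) / p : ℕ) + 1) ≤ (L : ℝ) + 1 + p := by
      have : (L + 1) / p * p ≤ L + 1 := Nat.div_mul_le_self _ _
      have h2 : p * ((L + 1) / p + 1) ≤ L + 1 + p := by rw [mul_add, mul_one, mul_comm]; omega
      exact_mod_cast h2
    have hpos : (0 : ℝ) < (L : ℝ) + 1 + p := by positivity
    refine pow_le_pow_left₀ ?_ ?_ d
    · rw [sub_nonneg, div_le_one hpos]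
      have : (0 : ℝ) ≤ L := Nat.cast_nonneg L
      linarith
    · have e : 1 - (p : ℝ) / ((L : ℝ) + 1 + p) = ((L : ℝ) + 1) / ((L : ℝ) + 1 + p) := by
        field_simp; ring
      rw [e]
      exact div_le_div_of_nonneg_left (by positivity) (by positivity) hq

end Cubes

/-! ### The infinite volume limits -/

section Limits

variable {d : ℕ}

lemma boxDensity_eq (ω : Config d) (Q : Site d × ℕ) :
    boxDensity ω Q = ((occ ω (cube Q.1 Q.2)).card : ℝ) / (cube Q.1 Q.2).card := by
  rw [boxDensity, numClassical_restrict]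

lemma boxDensity_mem_Icc (ω : Config d) (Q : Site d × ℕ) :
    boxDensity ω Q ∈ Set.Icc (0 : ℝ) 1 := by
  rw [boxDensity_eq]
  refine ⟨by positivity, (div_le_one (card_cube_pos _ _)).2 ?_⟩
  exact_mod_cast Finset.card_le_card (occ_subset ω _)

lemma boxDensity_flip (ω : Config d) (Q : Site d × ℕ) :
    boxDensity (flip ω) Q = 1 - boxDensity ω Q := by
  rw [boxDensity_eq, boxDensity_eq, card_occ_flip, sub_div, div_self (card_cube_pos _ _).ne']

/-- The occupied sites of `K` recur in the translates of `K` that fill a large cube. -/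
lemma eventually_boxDensity_le {ω : Config d} {p : ℕ} (hp : 0 < p) (hω : IsPeriod ω p)
    {K : Site d × ℕ} (hK : K.2 + 1 ≤ p) {ε : ℝ} (hε : 0 < ε) :
    ∀ᶠ Q in cubeFilter d, boxDensity ω K ≤
      boxDensity ω Q + (1 - ((cube K.1 K.2).card : ℝ) / p ^ d) + ε := by
  filter_upwards [exists_translates hp K.1 hK hε] with Q hQ
  obtain ⟨Z, hZ, hsub, hdisj, hlow, hup⟩ := hQ
  have hKpos := card_cube_pos K.1 K.2
  have hQpos := card_cube_pos Q.1 Q.2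
  have hocc : (Z.card : ℝ) * (occ ω (cube K.1 K.2)).card ≤ (occ ω (cube Q.1 Q.2)).card := by
    have h1 : (Z.biUnion fun z => (occ ω (cube K.1 K.2)).image (· + z)).card =
        Z.card * (occ ω (cube K.1 K.2)).card := by
      rw [Finset.card_biUnion fun z hz z' hz' hne => Finset.disjoint_of_subset_left
        (Finset.image_subset_image (occ_subset _ _)) (Finset.disjoint_of_subset_right
        (Finset.image_subset_image (occ_subset _ _)) (hdisj hz hz' hne))]
      rw [Finset.sum_congr rfl fun z _ => Finset.card_image_of_injective _ (add_left_injective z)]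
      simp
    have h2 : (Z.biUnion fun z => (occ ω (cube K.1 K.2)).image (· + z)) ⊆
        occ ω (cube Q.1 Q.2) := by
      refine Finset.biUnion_subset.2 fun z hz x hx => ?_
      obtain ⟨w, hw, rfl⟩ := Finset.mem_image.1 hx
      rw [mem_occ] at hw ⊢
      obtain ⟨j, rfl⟩ := hZ z hz
      exact ⟨hsub _ hz (Finset.mem_image_of_mem _ hw.1), by rw [hω, hw.2]⟩
    have h3 := Finset.card_le_card h2
    rw [h1] at h3
    exact_mod_cast h3
  set θ : ℝ := Z.card * (cube K.1 K.2).card / (cube Q.1 Q.2).card with hθ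
  have hθ1 : ((cube K.1 K.2).card : ℝ) / p ^ d - ε ≤ θ := by
    rw [hθ, le_div_iff₀ hQpos]; exact hlow
  have hθ2 : θ ≤ 1 := by rw [hθ, div_le_one hQpos]; exact hup
  have hmain : θ * boxDensity ω K ≤ boxDensity ω Q := by
    rw [boxDensity_eq, boxDensity_eq, hθ]
    have : (Z.card : ℝ) * (cube K.1 K.2).card / (cube Q.1 Q.2).card *
        ((occ ω (cube K.1 K.2)).card / (cube K.1 K.2).card) =
        Z.card * (occ ω (cube K.1 K.2)).card / (cube Q.1 Q.2).card := by field_simp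
    rw [this]
    exact div_le_div_of_nonneg_right hocc hQpos.le
  have hK01 := boxDensity_mem_Icc ω K
  nlinarith [hK01.1, hK01.2]

/-- The density in cubes is almost subadditive, after an exchange of occupied and empty sites. -/
lemma tendsto_boxDensity {ω : Config d} (h : Periodic ω) :
    Tendsto (boxDensity ω) (cubeFilter d) (𝓝 (classicalDensity ω)) := by
  obtain ⟨p, hp, hω⟩ := exists_isPeriod h
  have hω' : IsPeriod (flip ω) p := fun x j => by simp only [flip, hω x j]
  refine tendsto_nhds_limUnder (exists_tendsto_of_almost_le (C := 1) (fun Q => ?_) fun ε hε => ?_)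
  · have := boxDensity_mem_Icc ω Q
    rw [abs_le]; constructor <;> linarith [this.1, this.2]
  · filter_upwards [eventually_exists_period hp hω' (half_pos hε)] with K hK
    obtain ⟨q, hq, hqω, hKq, hle⟩ := hK
    filter_upwards [eventually_boxDensity_le hq hqω hKq (half_pos hε)] with Q hQ
    rw [boxDensity_flip, boxDensity_flip] at hQ
    linarith

lemma periodic_flip {ω : Config d} (h : Periodic ω) : Periodic (flip ω) := by
  intro i
  obtain ⟨p, hp, hω⟩ := h i
  exact ⟨p, hp, fun x => by simp only [flip, hω]⟩

lemma classicalDensity_flip {ω : Config d} (h : Periodic ω) :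
    classicalDensity (flip ω) = 1 - classicalDensity ω := by
  refine tendsto_nhds_unique (tendsto_boxDensity (periodic_flip h)) ?_
  refine (tendsto_const_nhds.sub (tendsto_boxDensity h)).congr fun Q => ?_
  rw [boxDensity_flip]

/-- The density is attained in each period cell. -/
lemma classicalDensity_eq_boxDensity {ω : Config d} {p : ℕ} (hω : IsPeriod ω p)
    {K : Site d × ℕ} (hK : K.2 + 1 = p) : classicalDensity ω = boxDensity ω K := by
  have hp : 0 < p := by omega
  -- The reverse inequality is the same statement for `flip ω`.
  have key : ∀ ω : Config d, IsPeriod ω p → boxDensity ω K ≤ classicalDensity ω := by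
    intro ω hω
    refine le_of_forall_pos_le_add fun ε hε => ?_
    have h1 := (tendsto_boxDensity (hω.periodic hp)).add_const ε
    refine ge_of_tendsto h1 ?_
    filter_upwards [eventually_boxDensity_le hp hω hK.le hε] with Q hQ
    have : ((cube K.1 K.2).card : ℝ) / p ^ d = 1 := by
      rw [card_cube, hK]
      push_cast
      exact div_self (by positivity)
    rw [this] at hQ
    linarith
  have h1 := key ω hω
  have h2 := key (flip ω) fun x j => by simp only [flip, hω x j]
  rw [boxDensity_flip, classicalDensity_flip (hω.periodic hp)] at h2
  linarith

/-- The energy per site in a cube with electronic density `ρ`, without rounding the number of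
electrons. -/
def siteEnergy (U ρ : ℝ) (ω : Config d) (Q : Site d × ℕ) : ℝ :=
  minEnergy U ω (cube Q.1 Q.2) (ρ * (cube Q.1 Q.2).card) / (cube Q.1 Q.2).card

lemma mul_card_mem {ρ : ℝ} (hρ : ρ ∈ Set.Icc (0 : ℝ) 1) (Λ : Finset (Site d)) :
    0 ≤ ρ * Λ.card ∧ ρ * Λ.card ≤ Λ.card :=
  ⟨mul_nonneg hρ.1 (Nat.cast_nonneg _), mul_le_of_le_one_left (Nat.cast_nonneg _) hρ.2⟩

lemma abs_siteEnergy_le (U : ℝ) (ω : Config d) {ρ : ℝ} (hρ : ρ ∈ Set.Icc (0 : ℝ) 1)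
    (Q : Site d × ℕ) : |siteEnergy U ρ ω Q| ≤ 2 * d + |U| := by
  have hQ := card_cube_pos Q.1 Q.2
  have h := mul_card_mem hρ (cube Q.1 Q.2)
  rw [siteEnergy, abs_div, abs_of_pos hQ, div_le_iff₀ hQ]
  exact (abs_minEnergy_le U ω h.1 h.2).trans (mul_le_mul_of_nonneg_left h.2 (by positivity))

/-- Trial states on a large cube: a state on `K` repeated periodically, and the remaining electrons
in the gaps. -/
lemma eventually_siteEnergy_le (U : ℝ) {ω : Config d} {ρ : ℝ} (hρ : ρ ∈ Set.Icc (0 : ℝ) 1) {p : ℕ}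
    (hp : 0 < p) (hω : IsPeriod ω p) {K : Site d × ℕ} (hK : K.2 + 1 ≤ p) {ε : ℝ} (hε : 0 < ε) :
    ∀ᶠ Q in cubeFilter d, siteEnergy U ρ ω Q ≤ siteEnergy U ρ ω K +
      2 * (2 * d + |U|) * (1 - ((cube K.1 K.2).card : ℝ) / p ^ d + ε) := by
  filter_upwards [exists_translates hp K.1 hK hε] with Q hQ
  obtain ⟨Z, hZ, hsub, hdisj, hlow, hup⟩ := hQ
  have hKpos := card_cube_pos K.1 K.2
  have hQpos := card_cube_pos Q.1 Q.2
  set C : ℝ := 2 * d + |U| with hC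
  have hC0 : 0 ≤ C := by positivity
  have hK' := mul_card_mem hρ (cube K.1 K.2)
  have hQ' := mul_card_mem hρ (cube Q.1 Q.2)
  have h1 := minEnergy_glue U hsub hdisj (fun z hz x _ => by
    obtain ⟨j, rfl⟩ := hZ z hz
    exact hω x j) hK'.1 hK'.2
  have ht0 : 0 ≤ (Z.card : ℝ) * (ρ * (cube K.1 K.2).card) :=
    mul_nonneg (Nat.cast_nonneg _) hK'.1
  have ht1 : (Z.card : ℝ) * (ρ * (cube K.1 K.2).card) ≤ ρ * (cube Q.1 Q.2).card := by
    have := mul_le_mul_of_nonneg_left hup hρ.1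
    linarith
  have h2 := minEnergy_le_add U ω ht0 (ht1.trans hQ'.2) hQ'.1 hQ'.2
  set θ : ℝ := Z.card * (cube K.1 K.2).card / (cube Q.1 Q.2).card with hθ
  have hθ1 : ((cube K.1 K.2).card : ℝ) / p ^ d - ε ≤ θ := by
    rw [hθ, le_div_iff₀ hQpos]; exact hlow
  have hθ2 : θ ≤ 1 := by rw [hθ, div_le_one hQpos]; exact hup
  have hmain : siteEnergy U ρ ω Q ≤ θ * siteEnergy U ρ ω K + C * (1 - θ) := by
    have e1 : θ * siteEnergy U ρ ω K = Z.card * minEnergy U ω (cube K.1 K.2)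
        (ρ * (cube K.1 K.2).card) / (cube Q.1 Q.2).card := by
      rw [hθ, siteEnergy]; field_simp
    have e2 : C * (1 - θ) = C * ((cube Q.1 Q.2).card - Z.card * (cube K.1 K.2).card) /
        (cube Q.1 Q.2).card := by
      rw [hθ]; field_simp
    rw [e1, e2, ← add_div, siteEnergy]
    refine div_le_div_of_nonneg_right ?_ hQpos.le
    have h3 : |ρ * (cube Q.1 Q.2).card - Z.card * (ρ * (cube K.1 K.2).card)| ≤
        (cube Q.1 Q.2).card - Z.card * (cube K.1 K.2).card := by
      rw [abs_of_nonneg (by linarith)]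
      have : 0 ≤ (1 - ρ) * ((cube Q.1 Q.2).card - Z.card * (cube K.1 K.2).card) :=
        mul_nonneg (by linarith [hρ.2]) (by linarith)
      linarith
    have h4 := mul_le_mul_of_nonneg_left h3 hC0
    linarith
  have hb := abs_le.1 (abs_siteEnergy_le U ω hρ K)
  have h5 : (1 - θ) * (-siteEnergy U ρ ω K) ≤ (1 - θ) * C :=
    mul_le_mul_of_nonneg_left (by linarith [hb.1]) (by linarith)
  have h6 : 2 * C * (1 - θ) ≤ 2 * C * (1 - ((cube K.1 K.2).card : ℝ) / p ^ d + ε) :=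
    mul_le_mul_of_nonneg_left (by linarith) (by positivity)
  linarith

lemma tendsto_card_cube (hd : 1 ≤ d) :
    Tendsto (fun Q : Site d × ℕ => ((cube Q.1 Q.2).card : ℝ)) (cubeFilter d) atTop := by
  have h : Tendsto (fun L : ℕ => ((L : ℝ) + 1) ^ d) atTop atTop :=
    (tendsto_pow_atTop (by omega)).comp
      (tendsto_atTop_add_const_right _ _ tendsto_natCast_atTop_atTop)
  refine (tendsto_cubeFilter h).congr fun Q => ?_
  rw [card_cube]; push_cast; rfl

lemma abs_boxEnergy_sub_le (U : ℝ) (ω : Config d) {ρ : ℝ} (hρ : ρ ∈ Set.Icc (0 : ℝ) 1)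
    (Q : Site d × ℕ) :
    |boxEnergy U ρ ω Q - siteEnergy U ρ ω Q| ≤ (2 * d + |U|) / ((cube Q.1 Q.2).card : ℝ) := by
  have hQ := card_cube_pos Q.1 Q.2
  have h := mul_card_mem hρ (cube Q.1 Q.2)
  set n : ℝ := ((cube Q.1 Q.2).card : ℝ) with hn
  have h1 : (⌊ρ * n⌋₊ : ℝ) ≤ ρ * n := Nat.floor_le h.1
  have h2 : ρ * n < ⌊ρ * n⌋₊ + 1 := Nat.lt_floor_add_one _
  have h3 : ⌊ρ * n⌋₊ ≤ (cube Q.1 Q.2).card := by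
    have : (⌊ρ * n⌋₊ : ℝ) ≤ ((cube Q.1 Q.2).card : ℝ) := h1.trans h.2
    exact_mod_cast this
  have hc : |ρ * n - ⌊ρ * n⌋₊| ≤ 1 := by
    rw [abs_le]; constructor <;> linarith
  have a1 := minEnergy_le_add U ω (Nat.cast_nonneg ⌊ρ * n⌋₊) (h1.trans h.2) h.1 h.2
  have a2 := minEnergy_le_add U ω h.1 h.2 (Nat.cast_nonneg ⌊ρ * n⌋₊) (h1.trans h.2)
  rw [abs_sub_comm] at a2
  have hC : (2 * d + |U|) * |ρ * n - ⌊ρ * n⌋₊| ≤ 2 * d + |U| :=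
    mul_le_of_le_one_right (by positivity) hc
  rw [boxEnergy, siteEnergy, ← hn, groundEnergy_eq_minEnergy U ω _ h3, ← sub_div, abs_div,
    abs_of_pos hQ]
  refine div_le_div_of_nonneg_right ?_ hQ.le
  rw [abs_le]
  constructor <;> linarith

lemma tendsto_boxEnergy_sub (hd : 1 ≤ d) (U : ℝ) (ω : Config d) {ρ : ℝ}
    (hρ : ρ ∈ Set.Icc (0 : ℝ) 1) :
    Tendsto (fun Q => boxEnergy U ρ ω Q - siteEnergy U ρ ω Q) (cubeFilter d) (𝓝 0) :=
  squeeze_zero_norm (fun Q => abs_boxEnergy_sub_le U ω hρ Q)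
    (tendsto_const_nhds.div_atTop (tendsto_card_cube hd))

lemma exists_tendsto_siteEnergy (U : ℝ) {ω : Config d} (h : Periodic ω) {ρ : ℝ}
    (hρ : ρ ∈ Set.Icc (0 : ℝ) 1) :
    ∃ l, Tendsto (siteEnergy U ρ ω) (cubeFilter d) (𝓝 l) := by
  obtain ⟨p, hp, hω⟩ := exists_isPeriod h
  refine exists_tendsto_of_almost_le (abs_siteEnergy_le U ω hρ) fun ε hε => ?_
  set C : ℝ := 2 * d + |U| with hC
  have hC0 : 0 ≤ C := by positivity
  set ε' : ℝ := ε / (4 * (C + 1)) with hε'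
  have hε'pos : 0 < ε' := by positivity
  filter_upwards [eventually_exists_period hp hω hε'pos] with K hK
  obtain ⟨q, hq, hqω, hKq, hle⟩ := hK
  filter_upwards [eventually_siteEnergy_le U hρ hq hqω hKq hε'pos] with Q hQ
  refine hQ.trans (add_le_add le_rfl ?_)
  calc _ ≤ 2 * C * (2 * ε') := mul_le_mul_of_nonneg_left (by linarith) (by positivity)
    _ ≤ 4 * (C + 1) * ε' := by nlinarith
    _ = ε := by rw [hε']; field_simp

lemma tendsto_boxEnergy (hd : 1 ≤ d) (U : ℝ) {ω : Config d} (h : Periodic ω) {ρ : ℝ}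
    (hρ : ρ ∈ Set.Icc (0 : ℝ) 1) :
    Tendsto (boxEnergy U ρ ω) (cubeFilter d) (𝓝 (energyDensity U ρ ω)) := by
  obtain ⟨l, hl⟩ := exists_tendsto_siteEnergy U h hρ
  refine tendsto_nhds_limUnder ⟨l, ?_⟩
  have := (tendsto_boxEnergy_sub hd U ω hρ).add hl
  simpa using this

lemma tendsto_siteEnergy (hd : 1 ≤ d) (U : ℝ) {ω : Config d} (h : Periodic ω) {ρ : ℝ}
    (hρ : ρ ∈ Set.Icc (0 : ℝ) 1) :
    Tendsto (siteEnergy U ρ ω) (cubeFilter d) (𝓝 (energyDensity U ρ ω)) := by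
  have := (tendsto_boxEnergy hd U h hρ).sub (tendsto_boxEnergy_sub hd U ω hρ)
  simpa using this

/-- The energy density is at most the energy per site in a period cell. -/
lemma energyDensity_le_siteEnergy (hd : 1 ≤ d) (U : ℝ) {ω : Config d} {ρ : ℝ}
    (hρ : ρ ∈ Set.Icc (0 : ℝ) 1) {p : ℕ} (hω : IsPeriod ω p) {K : Site d × ℕ}
    (hK : K.2 + 1 = p) : energyDensity U ρ ω ≤ siteEnergy U ρ ω K := by
  have hp : 0 < p := by omega
  set C : ℝ := 2 * d + |U| with hC
  have hC0 : 0 ≤ C := by positivity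
  refine le_of_forall_pos_le_add fun ε hε => ?_
  refine le_of_tendsto (tendsto_siteEnergy hd U (hω.periodic hp) hρ) ?_
  filter_upwards [eventually_siteEnergy_le U hρ hp hω hK.le
    (show 0 < ε / (2 * (C + 1)) by positivity)] with Q hQ
  have h1 : ((cube K.1 K.2).card : ℝ) / p ^ d = 1 := by
    rw [card_cube, hK]
    push_cast
    exact div_self (by positivity)
  rw [h1, sub_self, zero_add] at hQ
  refine hQ.trans (add_le_add le_rfl ?_)
  calc 2 * C * (ε / (2 * (C + 1))) ≤ 2 * (C + 1) * (ε / (2 * (C + 1))) :=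
        mul_le_mul_of_nonneg_right (by linarith) (by positivity)
    _ = ε := by field_simp

/-- Particle-hole symmetry of the energy density. -/
lemma energyDensity_flip (hd : 1 ≤ d) (U : ℝ) {ω : Config d} (h : Periodic ω) {ρ : ℝ}
    (hρ : ρ ∈ Set.Icc (0 : ℝ) 1) :
    energyDensity U (1 - ρ) ω = energyDensity U ρ (flip ω) + U * ρ - U * classicalDensity ω := by
  have hρ' : 1 - ρ ∈ Set.Icc (0 : ℝ) 1 := ⟨by linarith [hρ.2], by linarith [hρ.1]⟩
  refine tendsto_nhds_unique (tendsto_siteEnergy hd U h hρ') ?_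
  have h1 := ((tendsto_siteEnergy hd U (periodic_flip h) hρ).add_const (U * ρ)).sub
    ((tendsto_boxDensity h).const_mul U)
  refine h1.congr fun Q => ?_
  have hQ := card_cube_pos Q.1 Q.2
  have hm := mul_card_mem hρ (cube Q.1 Q.2)
  rw [siteEnergy, siteEnergy, sub_mul, one_mul, minEnergy_card_sub U ω _ hm.1 hm.2, boxDensity_eq]
  field_simp

/-- The boundary of a box is covered by the layer of sites around it. -/
lemma card_boundaryPairs_Icc_le (l u : Site d) :
    (boundaryPairs (Finset.Icc l u)).card ≤
      2 * d * ((Finset.Icc (l - 1) (u + 1)).card - (Finset.Icc l u).card) := by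
  set E := Finset.Icc (l - 1) (u + 1) \ Finset.Icc l u with hE
  have hsub : Finset.Icc l u ⊆ Finset.Icc (l - 1) (u + 1) := by
    refine Finset.Icc_subset_Icc ?_ ?_ <;> intro i <;> simp
  have h1 : (boundaryPairs (Finset.Icc l u)).card ≤ (E.sigma fun y => nbrs y).card := by
    refine Finset.card_le_card_of_injOn (fun p => ⟨p.2, p.1⟩) ?_ ?_
    · intro p hp
      rw [Finset.mem_coe, mem_boundaryPairs] at hp
      obtain ⟨h1, h2, h3⟩ := hp
      rw [Finset.mem_coe, Finset.mem_sigma]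
      refine ⟨Finset.mem_sdiff.2 ⟨?_, h2⟩, mem_nbrs.2 (adjacent_comm.1 h3)⟩
      rw [Finset.mem_Icc] at h1 ⊢
      have hb : ∀ i, |p.1 i - p.2 i| ≤ 1 := by
        intro i
        unfold Adjacent at h3
        rw [← h3]
        exact Finset.single_le_sum (f := fun i => |p.1 i - p.2 i|) (fun j _ => abs_nonneg _)
          (Finset.mem_univ i)
      constructor <;> intro i
      · have := abs_le.1 (hb i)
        have : l i ≤ p.1 i := h1.1 i
        simp only [Pi.sub_apply, Pi.one_apply]
        omega
      · have := abs_le.1 (hb i)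
        have : p.1 i ≤ u i := h1.2 i
        simp only [Pi.add_apply, Pi.one_apply]
        omega
    · rintro ⟨a, b⟩ - ⟨a', b'⟩ - h
      simp only [Sigma.mk.injEq, heq_eq_eq] at h
      exact Prod.ext h.2 h.1
  refine h1.trans_eq ?_
  rw [Finset.card_sigma]
  simp only [card_nbrs, Finset.sum_const, smul_eq_mul]
  rw [hE, Finset.card_sdiff_of_subset hsub, mul_comm]

lemma tendsto_boundary_cube :
    Tendsto (fun Q : Site d × ℕ => ((boundaryPairs (cube Q.1 Q.2)).card : ℝ) /
      (cube Q.1 Q.2).card) (cubeFilter d) (𝓝 0) := by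
  have hlim : Tendsto (fun L : ℕ => 2 * (d : ℝ) * ((1 + 2 / ((L : ℝ) + 1)) ^ d - 1)) atTop
      (𝓝 0) := by
    have h1 : Tendsto (fun L : ℕ => 2 / ((L : ℝ) + 1)) atTop (𝓝 0) :=
      tendsto_const_nhds.div_atTop (tendsto_atTop_add_const_right _ _ tendsto_natCast_atTop_atTop)
    have h2 := (((tendsto_const_nhds (x := (1 : ℝ))).add h1).pow d).sub_const 1
    simpa using h2.const_mul (2 * (d : ℝ))
  refine squeeze_zero (fun Q => by positivity) (fun Q => ?_) (tendsto_cubeFilter hlim)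
  have hQ := card_cube_pos Q.1 Q.2
  rw [div_le_iff₀ hQ]
  have h1 := card_boundaryPairs_Icc_le Q.1 (fun i => Q.1 i + (Q.2 : ℤ))
  have h2 : (Finset.Icc (Q.1 - 1) ((fun i => Q.1 i + (Q.2 : ℤ)) + 1)).card = (Q.2 + 3) ^ d := by
    rw [Pi.card_Icc]
    simp only [Int.card_Icc, Pi.add_apply, Pi.sub_apply, Pi.one_apply]
    rw [Finset.prod_congr rfl fun i _ =>
      show (Q.1 i + (Q.2 : ℤ) + 1 + 1 - (Q.1 i - 1)).toNat = Q.2 + 3 by omega]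
    simp
  have h3 : (Finset.Icc Q.1 (fun i => Q.1 i + (Q.2 : ℤ))).card = (Q.2 + 1) ^ d := card_cube Q.1 Q.2
  rw [h2, h3] at h1
  have hle : (Q.2 + 1) ^ d ≤ (Q.2 + 3) ^ d := Nat.pow_le_pow_left (by omega) d
  have h4 : ((boundaryPairs (cube Q.1 Q.2)).card : ℝ) ≤
      2 * d * (((Q.2 : ℝ) + 3) ^ d - ((Q.2 : ℝ) + 1) ^ d) := by
    have : ((boundaryPairs (cube Q.1 Q.2)).card : ℝ) ≤
        ((2 * d * ((Q.2 + 3) ^ d - (Q.2 + 1) ^ d) : ℕ) : ℝ) := by exact_mod_cast h1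
    rw [Nat.cast_mul, Nat.cast_sub hle] at this
    push_cast at this
    exact this
  refine h4.trans_eq ?_
  rw [card_cube]
  push_cast
  have : (1 + 2 / ((Q.2 : ℝ) + 1)) ^ d * ((Q.2 : ℝ) + 1) ^ d = ((Q.2 : ℝ) + 3) ^ d := by
    rw [← mul_pow]
    congr 1
    field_simp
    ring
  rw [← this]
  ring

lemma periodic_const (b : Bool) : Periodic (fun _ : Site d => b) :=
  fun _ => ⟨1, one_pos, fun _ => rfl⟩

lemma occ_fullConfig (Λ : Finset (Site d)) : occ (fullConfig d) Λ = Λ := by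
  ext x; simp [fullConfig]

lemma energy_eq_sub (U : ℝ) (ω : Config d) (Λ : Finset (Site d)) (γ : Site d → Site d → ℝ) :
    energy U ω Λ γ = energy 0 ω Λ γ - U * ∑ x ∈ Λ, if ω x = true then γ x x else 0 := by
  simp [energy]

/-- The bulk energy is the energy density of free electrons: the boundary terms of the two bounds
vanish in the limit. -/
lemma energyDensity_full (hd : 1 ≤ d) (U : ℝ) {ρ : ℝ} (hρ : ρ ∈ Set.Icc (0 : ℝ) 1) :
    energyDensity U ρ (fullConfig d) = bulkEnergy d ρ - U * ρ := by
  refine tendsto_nhds_unique (tendsto_siteEnergy hd U (periodic_const true) hρ) ?_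
  have hup := (tendsto_boundary_cube (d := d)).const_mul (|bulkEnergy d ρ| / (2 * d))
  have hup' := hup.const_add (bulkEnergy d ρ - U * ρ)
  rw [mul_zero, add_zero] at hup'
  refine tendsto_of_tendsto_of_tendsto_of_le_of_le tendsto_const_nhds hup' (fun Q => ?_)
    (fun Q => ?_)
  · have hQ := card_cube_pos Q.1 Q.2
    have hm := mul_card_mem hρ (cube Q.1 Q.2)
    simp only [siteEnergy]
    rw [le_div_iff₀ hQ]
    refine le_minEnergy hm.1 hm.2 fun γ hγ htr => ?_
    have h1 := sum_integral_columnDist_le (fun _ => true) hγ (fermiLevel d ρ)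
    have h2 : 0 ≤ ∑ y ∈ cube Q.1 Q.2, ∫ k, |disp k - fermiLevel d ρ| *
        columnDist (fermiLevel d ρ) (cube Q.1 Q.2) γ y k ∂(momentum d) :=
      Finset.sum_nonneg fun y _ => MeasureTheory.integral_nonneg fun k =>
        mul_nonneg (abs_nonneg _) (columnDist_nonneg _ _ _ _ _)
    rw [energy_eq_sub]
    simp only [if_true]
    have h3 : ∑ x ∈ cube Q.1 Q.2, γ x x = ρ * (cube Q.1 Q.2).card := htr
    rw [htr] at h1
    rw [h3]
    unfold bulkEnergy
    linarith
  · have hQ := card_cube_pos Q.1 Q.2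
    have h := minEnergy_le_bulk hd U (fullConfig d) (cube Q.1 Q.2) hρ
    rw [occ_fullConfig] at h
    simp only [siteEnergy]
    rw [div_le_iff₀ hQ]
    refine h.trans_eq ?_
    field_simp

lemma energyDensity_empty (hd : 1 ≤ d) (U : ℝ) {ρ : ℝ} (hρ : ρ ∈ Set.Icc (0 : ℝ) 1) :
    energyDensity U ρ (emptyConfig d) = bulkEnergy d ρ := by
  have h := energyDensity_full hd 0 hρ
  rw [zero_mul, sub_zero] at h
  rw [← h]
  refine tendsto_nhds_unique (tendsto_siteEnergy hd U (periodic_const false) hρ)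
    ((tendsto_siteEnergy hd 0 (periodic_const true) hρ).congr fun Q => ?_)
  simp [siteEnergy, minEnergy, energy]

lemma classicalDensity_full : classicalDensity (fullConfig d) = 1 := by
  refine tendsto_nhds_unique (tendsto_boxDensity (periodic_const true)) ?_
  refine tendsto_const_nhds.congr fun Q => ?_
  rw [boxDensity_eq, occ_fullConfig, div_self (card_cube_pos _ _).ne']

lemma classicalDensity_empty : classicalDensity (emptyConfig d) = 0 := by
  have h := classicalDensity_flip (d := d) (periodic_const true)
  rw [show (fun _ : Site d => true) = fullConfig d from rfl, classicalDensity_full, sub_self] at h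
  exact h

end Limits

/-! ### Bounds for arbitrary configurations -/

section Bounds

variable {d : ℕ}

/-- The energy of electrons confined to `D` is at least its bulk value. -/
lemma excess_confined_nonneg (ω : Config d) {D : Finset (Site d)} {γ : Site d → Site d → ℝ}
    (hγ : IsDensityMatrix D γ) (s : ℝ) :
    0 ≤ energy 0 ω D γ - s * trace D γ + pressure d s * D.card :=
  (Finset.sum_nonneg fun _ _ => MeasureTheory.integral_nonneg fun _ =>
    mul_nonneg (abs_nonneg _) (columnDist_nonneg _ _ _ _ _)).trans
    (sum_integral_columnDist_le ω hγ s)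

/-- `a` is a lower bound, at density `ρ`, for the energy per unit of boundary of electrons confined
to a finite domain, measured from the grand-canonical bulk value. -/
def IsSurfaceTension (d : ℕ) (ρ a : ℝ) : Prop :=
  ∀ (ω : Config d) (D : Finset (Site d)) (γ : Site d → Site d → ℝ),
      IsDensityMatrix D γ → a * (boundaryPairs D).card ≤
        energy 0 ω D γ - fermiLevel d ρ * trace D γ + pressure d (fermiLevel d ρ) * D.card

lemma exists_surfaceTension (hd : 1 ≤ d) : ∃ a : ℝ → ℝ, (∀ ρ, a ρ = a (1 - ρ)) ∧
    (∀ ρ ∈ Set.Ioo (0 : ℝ) 1, 0 < a ρ) ∧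
    ∀ ρ ∈ Set.Icc (0 : ℝ) 1, IsSurfaceTension d ρ (a ρ) := by
  choose! b hb using fun ρ => exists_boundary_constant (d := d) hd (ρ := ρ)
  have hsymm : ∀ ρ : ℝ, ρ ∈ Set.Ioo (0 : ℝ) 1 ↔ 1 - ρ ∈ Set.Ioo (0 : ℝ) 1 := fun ρ => by
    constructor <;> rintro ⟨h1, h2⟩ <;> constructor <;> linarith
  classical
  -- The minimum makes the constants symmetric under `ρ ↦ 1 - ρ`.
  refine ⟨fun ρ => if ρ ∈ Set.Ioo (0 : ℝ) 1 then min (b ρ) (b (1 - ρ)) else 0, fun ρ => ?_,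
    fun ρ hρ => ?_, fun ρ hρ ω D γ hγ => ?_⟩
  · simp only [← hsymm, sub_sub_cancel, min_comm]
  · simp only [if_pos hρ]
    exact lt_min (hb ρ hρ).1 (hb _ ((hsymm ρ).1 hρ)).1
  · by_cases h : ρ ∈ Set.Ioo (0 : ℝ) 1
    · simp only [if_pos h]
      exact (mul_le_mul_of_nonneg_right (min_le_left _ _) (Nat.cast_nonneg _)).trans
        ((hb ρ h).2 ω D γ hγ)
    · simp only [if_neg h, zero_mul]
      exact excess_confined_nonneg ω hγ _

/-- A bound on the energy gained per unit of boundary by the motion of electrons out of the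
occupied sites. By `le_energy_of_restrict` the constant `2 * d` would do in place of `8 * d ^ 2`. -/
def decouplingCost (d : ℕ) (U : ℝ) : ℝ := 8 * (d : ℝ) ^ 2 / (U - 4 * d)

lemma tendsto_mul_decouplingCost (d : ℕ) :
    Tendsto (fun U : ℝ => U * decouplingCost d U) atTop (𝓝 (8 * (d : ℝ) ^ 2)) := by
  have h1 : Tendsto (fun U : ℝ => 4 * (d : ℝ) / (U - 4 * d)) atTop (𝓝 0) :=
    tendsto_const_nhds.div_atTop (tendsto_atTop_add_const_right _ _ tendsto_id)
  have h2 := (h1.const_add 1).const_mul (8 * (d : ℝ) ^ 2)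
  rw [add_zero, mul_one] at h2
  refine h2.congr' ?_
  filter_upwards [eventually_gt_atTop (4 * (d : ℝ))] with U hU
  have : U - 4 * d ≠ 0 := (sub_pos.2 hU).ne'
  rw [decouplingCost, show 1 + 4 * (d : ℝ) / (U - 4 * d) = U / (U - 4 * d) by
    rw [eq_div_iff this, add_mul, div_mul_cancel₀ _ this]; ring]
  ring

lemma tendsto_decouplingCost (d : ℕ) : Tendsto (decouplingCost d) atTop (𝓝 0) :=
  tendsto_const_nhds.div_atTop (tendsto_atTop_add_const_right _ _ tendsto_id)

/-- The energy of any configuration in a finite volume lies above the affine functional of the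
particle numbers that is tangent, at the density `ρ`, to the energy of the full configuration. -/
lemma le_minEnergy_of_tangent (hd : 1 ≤ d) {U : ℝ} (hU : 4 * (d : ℝ) < U) {ρ a : ℝ}
    (hρ : ρ ∈ Set.Icc (0 : ℝ) 1) (ha : IsSurfaceTension d ρ a) (ω : Config d)
    (Λ : Finset (Site d)) {t : ℝ} (h0 : 0 ≤ t) (h1 : t ≤ Λ.card) :
    (fermiLevel d ρ - U) * t - pressure d (fermiLevel d ρ) * (occ ω Λ).card +
      (a - decouplingCost d U) * (boundaryPairs (occ ω Λ)).card ≤ minEnergy U ω Λ t := by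
  refine le_minEnergy h0 h1 fun γ hγ htr => ?_
  have k1 := le_energy_of_restrict hd hU (le_of_abs_le (fermiLevel_spec hd hρ).1) ω hγ
  have k2 := ha ω _ _ (hγ.restrict (occ_subset ω Λ))
  have hd' : (1 : ℝ) ≤ d := by exact_mod_cast hd
  have k3 : 2 * d / (U - 4 * d) ≤ decouplingCost d U :=
    div_le_div_of_nonneg_right (by nlinarith) (by linarith)
  have k4 := mul_le_mul_of_nonneg_right k3
    (Nat.cast_nonneg (α := ℝ) (boundaryPairs (occ ω Λ)).card)
  simp only at k1
  rw [htr] at k1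
  linarith

/-- The two bounds on the ground state energy in a finite volume. -/
lemma groundEnergy_bounds (hd : 1 ≤ d) {U : ℝ} (hU : 4 * (d : ℝ) < U) {a : ℝ → ℝ}
    (ha : ∀ ρ ∈ Set.Icc (0 : ℝ) 1, IsSurfaceTension d ρ (a ρ)) {Λ : Finset (Site d)}
    (ω : BoxConfig Λ) {N : ℕ} (hN : N ≤ numClassical ω) :
    groundEnergy U N ω - (numClassical ω : ℝ) *
        energyDensity U ((N : ℝ) / (numClassical ω : ℝ)) (fullConfig d) ≤
      1 / (2 * (d : ℝ)) * |energyDensity U ((N : ℝ) / (numClassical ω : ℝ)) (emptyConfig d)| *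
        (boundarySize ω : ℝ) ∧
    (a ((N : ℝ) / (numClassical ω : ℝ)) - decouplingCost d U) * (boundarySize ω : ℝ) ≤
      groundEnergy U N ω - (numClassical ω : ℝ) *
        energyDensity U ((N : ℝ) / (numClassical ω : ℝ)) (fullConfig d) := by
  obtain ⟨η, rfl⟩ : ∃ η : Config d, restrict Λ η = ω := ⟨extend ω, restrict_extend ω⟩
  rw [numClassical_restrict] at hN ⊢
  rw [boundarySize_restrict]
  set D := occ η Λ with hD
  have hDΛ : D.card ≤ Λ.card := Finset.card_le_card (occ_subset η Λ)
  have hN' : (N : ℝ) ≤ D.card := by exact_mod_cast hN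
  set ρ : ℝ := (N : ℝ) / (D.card : ℝ) with hρdef
  have hρ : ρ ∈ Set.Icc (0 : ℝ) 1 := ⟨by positivity, div_le_one_of_le₀ hN' (Nat.cast_nonneg _)⟩
  have hρN : ρ * D.card = N := by
    rcases Nat.eq_zero_or_pos D.card with h | h
    · -- Without classical particles `ρ = 0 / 0 = 0` and there are no electrons either.
      rw [h] at hN' ⊢
      have : (0 : ℝ) ≤ N := Nat.cast_nonneg _
      push_cast at hN' ⊢
      linarith
    · exact div_mul_cancel₀ _ (by exact_mod_cast h.ne')
  rw [groundEnergy_eq_minEnergy U η Λ (hN.trans hDΛ), energyDensity_full hd U hρ,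
    energyDensity_empty hd U hρ]
  have k1 := minEnergy_le_bulk hd U η Λ hρ
  have k2 := le_minEnergy_of_tangent hd hU hρ (ha ρ hρ) η Λ (Nat.cast_nonneg N)
    (hN'.trans (by exact_mod_cast hDΛ))
  rw [← hD] at k1 k2
  rw [hρN] at k1
  constructor
  · have : 1 / (2 * (d : ℝ)) * |bulkEnergy d ρ| = |bulkEnergy d ρ| / (2 * d) := by ring
    rw [this]
    linarith
  · have : (D.card : ℝ) * (bulkEnergy d ρ - U * ρ) =
        (fermiLevel d ρ - U) * N - pressure d (fermiLevel d ρ) * D.card := by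
      rw [← hρN]
      unfold bulkEnergy
      ring
    rw [this]
    linarith

lemma le_siteEnergy (hd : 1 ≤ d) {U : ℝ} (hU : 4 * (d : ℝ) < U) {ρ a : ℝ}
    (hρ : ρ ∈ Set.Icc (0 : ℝ) 1) (ha : IsSurfaceTension d ρ a) (ω : Config d) {r : ℝ}
    (hr : r ∈ Set.Icc (0 : ℝ) 1) (Q : Site d × ℕ) :
    (fermiLevel d ρ - U) * r - pressure d (fermiLevel d ρ) * boxDensity ω Q +
      (a - decouplingCost d U) * ((boundaryPairs (occ ω (cube Q.1 Q.2))).card /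
        ((cube Q.1 Q.2).card : ℝ)) ≤ siteEnergy U r ω Q := by
  have hQ := card_cube_pos Q.1 Q.2
  have hm := mul_card_mem hr (cube Q.1 Q.2)
  rw [boxDensity_eq, siteEnergy, le_div_iff₀ hQ]
  refine le_of_eq_of_le ?_ (le_minEnergy_of_tangent hd hU hρ ha ω _ hm.1 hm.2)
  field_simp

/-- The energy density of a periodic configuration lies above the functional that is tangent at
the density `ρ`. -/
lemma le_energyDensity (hd : 1 ≤ d) {U : ℝ} (hU : 4 * (d : ℝ) < U) {ρ a : ℝ}
    (hρ : ρ ∈ Set.Icc (0 : ℝ) 1) (ha : IsSurfaceTension d ρ a) (haU : decouplingCost d U < a)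
    {ω : Config d} (hω : Periodic ω) {r : ℝ} (hr : r ∈ Set.Icc (0 : ℝ) 1) :
    (fermiLevel d ρ - U) * r - pressure d (fermiLevel d ρ) * classicalDensity ω ≤
      energyDensity U r ω := by
  refine le_of_tendsto_of_tendsto'
    (((tendsto_boxDensity hω).const_mul (pressure d (fermiLevel d ρ))).const_sub
      ((fermiLevel d ρ - U) * r)) (tendsto_siteEnergy hd U hω hr) fun Q => ?_
  refine le_trans ?_ (le_siteEnergy hd hU hρ ha ω hr Q)
  have : 0 ≤ (a - decouplingCost d U) * ((boundaryPairs (occ ω (cube Q.1 Q.2))).card /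
        ((cube Q.1 Q.2).card : ℝ)) := mul_nonneg (by linarith) (by positivity)
  linarith

/-- A periodic configuration has a boundary of positive density unless it is constant. -/
lemma eventually_le_boundary {ω : Config d} (hω : Periodic ω) (h0 : ω ≠ emptyConfig d)
    (h1 : ω ≠ fullConfig d) : ∃ β > 0, ∀ᶠ Q in cubeFilter d,
      β ≤ ((boundaryPairs (occ ω (cube Q.1 Q.2))).card : ℝ) / (cube Q.1 Q.2).card := by
  obtain ⟨x, y, hxy, hx, hy⟩ := exists_adjacent_of_ne h0 h1
  obtain ⟨p, hp, hper⟩ := exists_isPeriod hω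
  have hpd : (0 : ℝ) < (p : ℝ) ^ d := by positivity
  refine ⟨1 / (2 * (p : ℝ) ^ d), by positivity, ?_⟩
  filter_upwards [exists_translates hp x (L₀ := 0) (by omega)
    (by positivity : (0 : ℝ) < 1 / (2 * (p : ℝ) ^ d))] with Q hQ
  obtain ⟨Z, hZ1, hZ2, -, hZ3, -⟩ := hQ
  rw [le_div_iff₀ (card_cube_pos _ _)]
  rw [show (cube x 0).card = 1 by rw [card_cube]; simp] at hZ3
  have e : (((1 : ℕ) : ℝ) / (p : ℝ) ^ d - 1 / (2 * (p : ℝ) ^ d)) = 1 / (2 * (p : ℝ) ^ d) := by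
    field_simp
    norm_num
  rw [e, Nat.cast_one, mul_one] at hZ3
  refine hZ3.trans ?_
  have hω' : ∀ z ∈ Z, ∀ v, ω (v + z) = ω v := by
    intro z hz v
    obtain ⟨j, rfl⟩ := hZ1 z hz
    exact hper v j
  have : Z.card ≤ (boundaryPairs (occ ω (cube Q.1 Q.2))).card := by
    refine Finset.card_le_card_of_injOn (fun z => (x + z, y + z)) (fun z hz => ?_) ?_
    · rw [Finset.mem_coe, mem_boundaryPairs, mem_occ, mem_occ]
      refine ⟨⟨hZ2 z hz (Finset.mem_image_of_mem _ (mem_cube.2 fun i => ?_)), ?_⟩, ?_, ?_⟩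
      · simp
      · rw [hω' z hz, hx]
      · rw [hω' z hz, hy]
        simp
      · exact (adjacent_add_right z).2 hxy
    · intro z _ z' _ h
      simpa using congrArg Prod.fst h
  exact_mod_cast this

/-- Only the constant configurations can touch the tangent functional. -/
lemma lt_energyDensity (hd : 1 ≤ d) {U : ℝ} (hU : 4 * (d : ℝ) < U) {ρ a : ℝ}
    (hρ : ρ ∈ Set.Icc (0 : ℝ) 1) (ha : IsSurfaceTension d ρ a) (haU : decouplingCost d U < a)
    {ω : Config d} (hω : Periodic ω) (h0 : ω ≠ emptyConfig d) (h1 : ω ≠ fullConfig d) {r : ℝ}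
    (hr : r ∈ Set.Icc (0 : ℝ) 1) :
    (fermiLevel d ρ - U) * r - pressure d (fermiLevel d ρ) * classicalDensity ω <
      energyDensity U r ω := by
  obtain ⟨β, hβ, hev⟩ := eventually_le_boundary hω h0 h1
  have hpos : 0 < (a - decouplingCost d U) * β := mul_pos (by linarith) hβ
  refine lt_of_lt_of_le (lt_add_of_pos_right _ hpos) ?_
  refine le_of_tendsto_of_tendsto
    ((((tendsto_boxDensity hω).const_mul (pressure d (fermiLevel d ρ))).const_sub
      ((fermiLevel d ρ - U) * r)).add_const _) (tendsto_siteEnergy hd U hω hr)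
    (hev.mono fun Q hQ => ?_)
  refine le_trans ?_ (le_siteEnergy hd hU hρ ha ω hr Q)
  have := mul_le_mul_of_nonneg_left hQ (by linarith : 0 ≤ a - decouplingCost d U)
  linarith

end Bounds

/-! ### Slabs -/

section Slabs

variable {d : ℕ}

/-- Periodically repeated slabs of width `H`, perpendicular to the direction `i₀`, one in each
period `N`. -/
def slab (i₀ : Fin d) (N H : ℕ) : Config d := fun x => decide (x i₀ % (N : ℤ) < H)

lemma isPeriod_slab (i₀ : Fin d) (N H : ℕ) : IsPeriod (slab i₀ N H) N := fun x j => by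
  simp [slab, Int.add_mul_emod_self_left]

lemma prod_ite_eq_mul_pow (i₀ : Fin d) (a b : ℕ) :
    ∏ i, (if i = i₀ then a else b) = a * b ^ (d - 1) := by
  rw [← Finset.mul_prod_erase Finset.univ _ (Finset.mem_univ i₀), if_pos rfl,
    Finset.prod_congr rfl fun i hi => if_neg (Finset.ne_of_mem_erase hi), Finset.prod_const,
    Finset.card_erase_of_mem (Finset.mem_univ i₀), Finset.card_univ, Fintype.card_fin]

lemma occ_slab (i₀ : Fin d) {N H : ℕ} (hH : 0 < H) (hHN : H ≤ N) :
    occ (slab i₀ N H) (cube 0 (N - 1)) =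
      Finset.Icc 0 (fun i => if i = i₀ then (H : ℤ) - 1 else (N : ℤ) - 1) := by
  have hN1 : ((N - 1 : ℕ) : ℤ) = (N : ℤ) - 1 := by omega
  ext x
  rw [mem_occ, mem_cube, Finset.mem_Icc]
  simp only [slab, decide_eq_true_eq, Pi.zero_apply, zero_add, hN1, Pi.le_def]
  constructor
  · rintro ⟨h1, h2⟩
    refine ⟨fun i => (h1 i).1, fun i => ?_⟩
    rw [Int.emod_eq_of_lt (h1 i₀).1 (by linarith [(h1 i₀).2])] at h2
    split_ifs with h
    · subst h; omega
    · exact (h1 i).2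
  · rintro ⟨h1, h2⟩
    have h3 := h2 i₀
    rw [if_pos rfl] at h3
    refine ⟨fun i => ⟨h1 i, ?_⟩, ?_⟩
    · have h4 := h2 i
      split_ifs at h4 with h <;> omega
    · rw [Int.emod_eq_of_lt (h1 i₀) (by omega)]
      omega

lemma card_occ_slab (i₀ : Fin d) {N H : ℕ} (hH : 0 < H) (hHN : H ≤ N) :
    (occ (slab i₀ N H) (cube 0 (N - 1))).card = H * N ^ (d - 1) := by
  rw [occ_slab i₀ hH hHN, Pi.card_Icc, ← prod_ite_eq_mul_pow i₀]
  refine Finset.prod_congr rfl fun i _ => ?_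
  rw [Int.card_Icc]
  simp only [Pi.zero_apply]
  split_ifs <;> omega

lemma card_boundary_slab (i₀ : Fin d) {N H : ℕ} (hH : 0 < H) (hHN : H ≤ N) :
    ((boundaryPairs (occ (slab i₀ N H) (cube 0 (N - 1)))).card : ℝ) ≤
      2 * d * (((H : ℝ) + 2) * ((N : ℝ) + 2) ^ (d - 1) - H * (N : ℝ) ^ (d - 1)) := by
  have h := card_boundaryPairs_Icc_le (0 : Site d)
    (fun i => if i = i₀ then (H : ℤ) - 1 else (N : ℤ) - 1)
  have e : (Finset.Icc ((0 : Site d) - 1)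
      ((fun i => if i = i₀ then (H : ℤ) - 1 else (N : ℤ) - 1) + 1)).card =
      (H + 2) * (N + 2) ^ (d - 1) := by
    rw [Pi.card_Icc, ← prod_ite_eq_mul_pow i₀]
    refine Finset.prod_congr rfl fun i _ => ?_
    rw [Int.card_Icc]
    simp only [Pi.add_apply, Pi.sub_apply, Pi.zero_apply, Pi.one_apply]
    split_ifs <;> omega
  rw [e, ← occ_slab i₀ hH hHN, card_occ_slab i₀ hH hHN] at h
  have hle : H * N ^ (d - 1) ≤ (H + 2) * (N + 2) ^ (d - 1) :=
    Nat.mul_le_mul (by omega) (Nat.pow_le_pow_left (by omega) _)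
  have h' : ((boundaryPairs (occ (slab i₀ N H) (cube 0 (N - 1)))).card : ℝ) ≤
      ((2 * d * ((H + 2) * (N + 2) ^ (d - 1) - H * N ^ (d - 1)) : ℕ) : ℝ) := by
    exact_mod_cast h
  refine h'.trans_eq ?_
  rw [Nat.cast_mul, Nat.cast_sub hle]
  push_cast
  ring

lemma boxDensity_slab (hd : 1 ≤ d) (i₀ : Fin d) {N H : ℕ} (hH : 0 < H) (hHN : H ≤ N) :
    boxDensity (slab i₀ N H) (0, N - 1) = (H : ℝ) / N := by
  have hN : (N : ℝ) ≠ 0 := by exact_mod_cast (by omega : N ≠ 0)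
  rw [boxDensity_eq, card_occ_slab i₀ hH hHN, card_cube, Nat.sub_add_cancel (by omega : 1 ≤ N)]
  push_cast
  rw [← mul_pow_sub_one (by omega : d ≠ 0) (N : ℝ)]
  field_simp

/-- Thick slabs of full density have almost the energy of the segregated state. -/
lemma energyDensity_slab_le (hd : 1 ≤ d) (U : ℝ) (i₀ : Fin d) {N H : ℕ} (hH : 0 < H) (hHN : H ≤ N)
    {r : ℝ} (hr : r ∈ Set.Icc (0 : ℝ) 1) {c : ℝ} (hc : c = (H : ℝ) / N) :
    energyDensity U (r * c) (slab i₀ N H) ≤ (bulkEnergy d r - U * r) * c +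
      |bulkEnergy d r| / (2 * d) *
        (2 * d * ((c + 2 / N) * (1 + 2 / (N : ℝ)) ^ (d - 1) - c)) := by
  have hN : (0 : ℝ) < N := by exact_mod_cast (by omega : 0 < N)
  have hHN' : (H : ℝ) ≤ N := by exact_mod_cast hHN
  have hc0 : 0 ≤ c := by rw [hc]; positivity
  have hc1 : c ≤ 1 := by rw [hc]; exact div_le_one_of_le₀ hHN' hN.le
  have hrc : r * c ∈ Set.Icc (0 : ℝ) 1 :=
    ⟨mul_nonneg hr.1 hc0, mul_le_one₀ hr.2 hc0 hc1⟩
  refine (energyDensity_le_siteEnergy hd U hrc (isPeriod_slab i₀ N H) (K := (0, N - 1))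
    (by simp only; omega)).trans ?_
  have hK := card_cube_pos (0 : Site d) (N - 1)
  have hcard : ((cube (0 : Site d) (N - 1)).card : ℝ) = (N : ℝ) ^ d := by
    rw [card_cube, Nat.sub_add_cancel (by omega : 1 ≤ N)]
    push_cast; rfl
  have hocc : ((occ (slab i₀ N H) (cube 0 (N - 1))).card : ℝ) =
      c * (cube (0 : Site d) (N - 1)).card := by
    have := boxDensity_slab hd i₀ hH hHN
    rw [boxDensity_eq, ← hc] at this
    exact (div_eq_iff hK.ne').1 this
  have k1 := minEnergy_le_bulk hd U (slab i₀ N H) (cube 0 (N - 1)) hr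
  have k2 := card_boundary_slab i₀ hH hHN
  rw [siteEnergy, div_le_iff₀ hK]
  simp only
  rw [mul_assoc, ← hocc]
  refine k1.trans ?_
  have e : 2 * d * (((H : ℝ) + 2) * ((N : ℝ) + 2) ^ (d - 1) - H * (N : ℝ) ^ (d - 1)) =
      (2 * d * ((c + 2 / N) * (1 + 2 / (N : ℝ)) ^ (d - 1) - c)) *
        (cube (0 : Site d) (N - 1)).card := by
    rw [hcard, ← mul_pow_sub_one (by omega : d ≠ 0) (N : ℝ)]
    have e1 : (H : ℝ) = c * N := by rw [hc]; field_simp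
    have e2 : (N : ℝ) + 2 = (1 + 2 / N) * N := by field_simp
    rw [e2, mul_pow, e1]
    field_simp
  rw [e] at k2
  have k3 := mul_le_mul_of_nonneg_left k2 (by positivity : 0 ≤ |bulkEnergy d r| / (2 * d))
  rw [hocc]
  linarith

end Slabs

/-! ### Ground states -/

section GroundStates

variable {d : ℕ}

/-- `m₀` has the least energy among the mixtures with densities `ρe` and `ρc`, and is the only
one with this energy. -/
def IsUniqueGroundState (U ρe ρc : ℝ) (m₀ : (Config d × ℝ) →₀ ℝ) : Prop :=
  IsState ρe ρc m₀ ∧ ∀ m, IsState ρe ρc m →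
    stateEnergy U m₀ ≤ stateEnergy U m ∧ (stateEnergy U m = stateEnergy U m₀ → m = m₀)

lemma IsUniqueGroundState.absoluteEnergy_eq {U ρe ρc : ℝ} {m₀ : (Config d × ℝ) →₀ ℝ}
    (h : IsUniqueGroundState U ρe ρc m₀) : absoluteEnergy d U ρe ρc = stateEnergy U m₀ := by
  refine IsLeast.csInf_eq ⟨⟨m₀, h.1, rfl⟩, ?_⟩
  rintro E ⟨m, hm, rfl⟩
  exact (h.2 m hm).1

lemma IsUniqueGroundState.canonicalGroundStates_eq {U ρe ρc : ℝ} {m₀ : (Config d × ℝ) →₀ ℝ}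
    (h : IsUniqueGroundState U ρe ρc m₀) : canonicalGroundStates d U ρe ρc = {m₀} := by
  ext m
  rw [canonicalGroundStates, h.absoluteEnergy_eq]
  constructor
  · rintro ⟨h1, h2⟩
    exact (h.2 m h1).2 h2
  · rintro rfl
    exact ⟨h.1, rfl⟩

lemma sum_single_add_single {α : Type*} (p q : α) (a b : ℝ) (f : α → ℝ) :
    (Finsupp.single p a + Finsupp.single q b).sum (fun x w => w * f x) = a * f p + b * f q := by
  classical
  rw [Finsupp.sum_add_index' (fun _ => zero_mul _) (fun _ _ _ => add_mul _ _ _),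
    Finsupp.sum_single_index (zero_mul _), Finsupp.sum_single_index (zero_mul _)]

lemma total_eq {α : Type*} (m : α →₀ ℝ) : m.sum (fun _ w => w) = m.sum (fun _ w => w * 1) := by
  simp

lemma isState_segregatedBelow {ρe ρc : ℝ} (h0 : 0 < ρe) (h1 : ρe < ρc) (h2 : ρc ≤ 1) :
    IsState ρe ρc (segregatedBelow d ρe ρc) := by
  classical
  have hc : 0 < ρc := h0.trans h1
  have hsupp : (segregatedBelow d ρe ρc).support ⊆ {(emptyConfig d, 0), (fullConfig d, ρe / ρc)} :=
    Finsupp.support_add.trans (Finset.union_subset_union Finsupp.support_single_subset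
      Finsupp.support_single_subset)
  have hmem : ∀ p ∈ (segregatedBelow d ρe ρc).support,
      p = (emptyConfig d, 0) ∨ p = (fullConfig d, ρe / ρc) := fun p hp => by
    simpa using hsupp hp
  refine ⟨fun p => ?_, ?_, fun p hp => ?_, fun p hp => ?_, ?_, ?_⟩
  · refine add_nonneg ?_ ?_
    · exact (Finsupp.single_nonneg.2 (by linarith : 0 ≤ 1 - ρc)) p
    · exact (Finsupp.single_nonneg.2 hc.le) p
  · rw [total_eq, segregatedBelow, sum_single_add_single (f := fun _ => (1 : ℝ))]
    ring
  · rcases hmem p hp with rfl | rfl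
    · exact periodic_const false
    · exact periodic_const true
  · rcases hmem p hp with rfl | rfl
    · simp
    · exact ⟨by positivity, div_le_one_of_le₀ h1.le hc.le⟩
  · rw [segregatedBelow, sum_single_add_single (f := fun p : Config d × ℝ => p.2)]
    field_simp
    ring
  · rw [segregatedBelow, sum_single_add_single (f := fun p : Config d × ℝ => classicalDensity p.1)]
    rw [classicalDensity_empty, classicalDensity_full]
    ring

/-- The energy of the segregated state is the value of the tangent functional. -/
lemma stateEnergy_segregatedBelow (hd : 1 ≤ d) (U : ℝ) {ρe ρc : ℝ} (h0 : 0 < ρe) (h1 : ρe < ρc) :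
    stateEnergy U (segregatedBelow d ρe ρc) = (fermiLevel d (ρe / ρc) - U) * ρe -
      pressure d (fermiLevel d (ρe / ρc)) * ρc := by
  have hc : 0 < ρc := h0.trans h1
  rw [stateEnergy, segregatedBelow,
    sum_single_add_single (f := fun p : Config d × ℝ => energyDensity U p.2 p.1)]
  rw [energyDensity_empty hd U (by simp), bulkEnergy_zero hd,
    energyDensity_full hd U ⟨by positivity, div_le_one_of_le₀ h1.le hc.le⟩, bulkEnergy]
  field_simp
  ring

/-- The tangent functional, evaluated in a mixture, only depends on the densities. -/
lemma IsState.sum_tangent {ρe ρc : ℝ} {m : (Config d × ℝ) →₀ ℝ} (h : IsState ρe ρc m) (A B : ℝ) :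
    m.sum (fun p w => w * (A * p.2 - B * classicalDensity p.1)) = A * ρe - B * ρc := by
  rw [← h.electrons, ← h.classical]
  simp only [Finsupp.sum, Finset.mul_sum, ← Finset.sum_sub_distrib]
  exact Finset.sum_congr rfl fun p _ => by ring

lemma isUniqueGroundState_segregatedBelow (hd : 1 ≤ d) {U : ℝ} (hU : 4 * (d : ℝ) < U)
    {ρe ρc : ℝ} (h0 : 0 < ρe) (h1 : ρe < ρc) (h2 : ρc ≤ 1) {a : ℝ}
    (ha : IsSurfaceTension d (ρe / ρc) a) (haU : decouplingCost d U < a) :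
    IsUniqueGroundState U ρe ρc (segregatedBelow d ρe ρc) := by
  classical
  have hc : 0 < ρc := h0.trans h1
  have hρ : ρe / ρc ∈ Set.Icc (0 : ℝ) 1 := ⟨by positivity, div_le_one_of_le₀ h1.le hc.le⟩
  refine ⟨isState_segregatedBelow h0 h1 h2, fun m hm => ?_⟩
  rw [stateEnergy_segregatedBelow hd U h0 h1]
  set ρ := ρe / ρc with hρdef
  set s := fermiLevel d ρ with hs
  have hs2 : s ≤ 2 * d := le_of_abs_le (fermiLevel_spec hd hρ).1
  rw [← hm.sum_tangent]
  have hle : ∀ p ∈ m.support, m p * ((s - U) * p.2 - pressure d s * classicalDensity p.1) ≤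
      m p * energyDensity U p.2 p.1 := fun p hp =>
    mul_le_mul_of_nonneg_left (le_energyDensity hd hU hρ ha haU (hm.periodic p hp)
      (hm.mem_Icc p hp)) (hm.nonneg p)
  refine ⟨Finset.sum_le_sum hle, fun heq => ?_⟩
  have heq' := (Finset.sum_eq_sum_iff_of_le hle).1 heq.symm
  set P : Config d × ℝ := (emptyConfig d, 0) with hP
  set R : Config d × ℝ := (fullConfig d, ρ) with hR
  have hne : P ≠ R := fun h => by
    have := congrFun (congrArg Prod.fst h) 0
    simp [hP, hR, emptyConfig, fullConfig] at this
  -- All components of `m` touch the tangent functional.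
  have hsub : m.support ⊆ {P, R} := by
    intro p hp
    have hm0 : m p ≠ 0 := Finsupp.mem_support_iff.1 hp
    have e := mul_left_cancel₀ hm0 (heq' p hp)
    have hr := hm.mem_Icc p hp
    obtain ⟨ω, r⟩ := p
    simp only at e hr
    rw [Finset.mem_insert, Finset.mem_singleton]
    by_cases hω0 : ω = emptyConfig d
    · left
      subst hω0
      rw [classicalDensity_empty, energyDensity_empty hd U hr] at e
      have hb := le_bulkEnergy hd hr (-(2 * d))
      rw [pressure_neg_two_mul] at hb
      have : (U - s - 2 * d) * r ≤ 0 := by linarith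
      have hr0 : r = 0 := le_antisymm (nonpos_of_mul_nonpos_right this (by linarith)) hr.1
      rw [hP, hr0]
    · by_cases hω1 : ω = fullConfig d
      · right
        subst hω1
        rw [classicalDensity_full, energyDensity_full hd U hr] at e
        rw [hR, eq_of_bulkEnergy_eq hd hρ hr (by linarith)]
      · exact absurd e (lt_energyDensity hd hU hρ ha haU (hm.periodic _ hp) hω0 hω1 hr).ne
  -- The weights of the two components are determined by the densities.
  have t1 := hm.total
  have t2 := hm.classical
  rw [Finsupp.sum_of_support_subset _ hsub _ (fun _ _ => rfl), Finset.sum_pair hne] at t1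
  rw [Finsupp.sum_of_support_subset m hsub (fun p w => w * classicalDensity p.1)
    (fun _ _ => zero_mul _), Finset.sum_pair hne] at t2
  simp only [hP, hR, classicalDensity_empty, classicalDensity_full] at t2
  rw [mul_zero, zero_add, mul_one, ← hR] at t2
  rw [t2] at t1
  ext p
  rw [segregatedBelow, Finsupp.add_apply, ← hP, ← hρdef, ← hR]
  by_cases h : p = P
  · subst h
    rw [Finsupp.single_eq_same, Finsupp.single_eq_of_ne hne, add_zero]
    linarith
  · by_cases h' : p = R
    · subst h'
      rw [Finsupp.single_eq_same, Finsupp.single_eq_of_ne hne.symm, zero_add, t2]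
    · rw [Finsupp.single_eq_of_ne h, Finsupp.single_eq_of_ne h', add_zero]
      by_contra hm0
      have := hsub (Finsupp.mem_support_iff.2 hm0)
      simp [h, h'] at this

/-- The energy of the segregated state is approached by periodic configurations. -/
lemma isGLB_periodicEnergies_below (hd : 1 ≤ d) {U : ℝ} (hU : 4 * (d : ℝ) < U)
    {ρe ρc : ℝ} (h0 : 0 < ρe) (h1 : ρe < ρc) (h2 : ρc ≤ 1) {a : ℝ}
    (ha : IsSurfaceTension d (ρe / ρc) a) (haU : decouplingCost d U < a)
    (hne : (periodicEnergies d U ρe ρc).Nonempty) :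
    IsGLB (periodicEnergies d U ρe ρc) (stateEnergy U (segregatedBelow d ρe ρc)) := by
  have hc : 0 < ρc := h0.trans h1
  have hρ : ρe / ρc ∈ Set.Icc (0 : ℝ) 1 := ⟨by positivity, div_le_one_of_le₀ h1.le hc.le⟩
  have hE := stateEnergy_segregatedBelow hd U h0 h1
  constructor
  · rintro E ⟨ω, hω, hωc, rfl⟩
    rw [hE]
    have := le_energyDensity hd hU hρ ha haU hω (r := ρe) ⟨h0.le, by linarith⟩
    rwa [hωc] at this
  · intro b hb
    obtain ⟨_, ω, hω, hωc, -⟩ := hne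
    obtain ⟨p, hp, hper⟩ := exists_isPeriod hω
    -- `ρc` is the fraction `A / B` of occupied sites in a period cell. Slabs of width `A (k + 1)` in
    -- the period `B (k + 1)` have the same density.
    have hdens := classicalDensity_eq_boxDensity hper (K := (0, p - 1)) (by simp only; omega)
    rw [hωc, boxDensity_eq] at hdens
    simp only at hdens
    set A := (occ ω (cube 0 (p - 1))).card
    set B := (cube (0 : Site d) (p - 1)).card with hB
    have hBpos : 0 < B := by exact_mod_cast card_cube_pos (0 : Site d) (p - 1)
    have hAB : A ≤ B := Finset.card_le_card (occ_subset _ _)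
    have hApos : 0 < A := by
      rcases Nat.eq_zero_or_pos A with h | h
      · rw [h, Nat.cast_zero, zero_div] at hdens
        exact absurd hdens hc.ne'
      · exact h
    set r := ρe / ρc with hr
    have hrc : r * ρc = ρe := div_mul_cancel₀ _ hc.ne'
    have key : ∀ k : ℕ, b ≤ (bulkEnergy d r - U * r) * ρc + |bulkEnergy d r| / (2 * d) *
        (2 * d * ((ρc + 2 / ((B * (k + 1) : ℕ) : ℝ)) *
          (1 + 2 / ((B * (k + 1) : ℕ) : ℝ)) ^ (d - 1) - ρc)) := by
      intro k
      have hH : 0 < A * (k + 1) := by positivity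
      have hHN : A * (k + 1) ≤ B * (k + 1) := Nat.mul_le_mul_right _ hAB
      have hck : ρc = ((A * (k + 1) : ℕ) : ℝ) / ((B * (k + 1) : ℕ) : ℝ) := by
        rw [hdens]
        push_cast
        rw [mul_div_mul_right _ _ (by positivity)]
      refine le_trans (hb ⟨slab ⟨0, hd⟩ (B * (k + 1)) (A * (k + 1)),
        (isPeriod_slab _ _ _).periodic (by positivity), ?_, rfl⟩) ?_
      · rw [classicalDensity_eq_boxDensity (isPeriod_slab _ _ _)
          (K := (0, B * (k + 1) - 1)) (by simp only; omega), boxDensity_slab hd _ hH hHN, ← hck]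
      · rw [← hrc]
        exact energyDensity_slab_le hd U _ hH hHN hρ hck
    have hlim0 : Tendsto (fun k : ℕ => 2 / ((B * (k + 1) : ℕ) : ℝ)) atTop (𝓝 0) := by
      refine tendsto_const_nhds.div_atTop (tendsto_natCast_atTop_atTop.comp ?_)
      exact tendsto_atTop_mono (fun k => (Nat.le_succ k).trans (Nat.le_mul_of_pos_left _ hBpos))
        tendsto_id
    have hlim := (((((hlim0.const_add ρc).mul ((hlim0.const_add 1).pow (d - 1))).sub_const
      ρc).const_mul (2 * (d : ℝ))).const_mul (|bulkEnergy d r| / (2 * d))).const_add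
      ((bulkEnergy d r - U * r) * ρc)
    have := ge_of_tendsto' hlim key
    rw [hE]
    refine this.trans_eq ?_
    rw [← hrc]
    unfold bulkEnergy
    simp only [add_zero, one_pow, mul_one, sub_self, mul_zero]
    ring

/-- The particle-hole transformation of the pairs of a configuration and an electronic density. -/
def holeEquiv (d : ℕ) : Config d × ℝ ≃ Config d × ℝ where
  toFun p := (flip p.1, 1 - p.2)
  invFun p := (flip p.1, 1 - p.2)
  left_inv p := by simp [flip_flip]
  right_inv p := by simp [flip_flip]

/-- The particle-hole transformation of the mixtures. -/
def hole (m : (Config d × ℝ) →₀ ℝ) : (Config d × ℝ) →₀ ℝ := m.equivMapDomain (holeEquiv d)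

lemma sum_hole (m : (Config d × ℝ) →₀ ℝ) (f : Config d × ℝ → ℝ → ℝ) :
    (hole m).sum f = m.sum fun p w => f (flip p.1, 1 - p.2) w :=
  Finsupp.sum_equivMapDomain _ _ _

lemma hole_hole (m : (Config d × ℝ) →₀ ℝ) : hole (hole m) = m := by
  ext p
  change m _ = m p
  congr 1
  exact (holeEquiv d).left_inv p

lemma mem_support_hole {m : (Config d × ℝ) →₀ ℝ} {p : Config d × ℝ} (hp : p ∈ (hole m).support) :
    (flip p.1, 1 - p.2) ∈ m.support := by
  rw [Finsupp.mem_support_iff] at hp ⊢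
  exact hp

lemma IsState.hole {ρe ρc : ℝ} {m : (Config d × ℝ) →₀ ℝ} (h : IsState ρe ρc m) :
    IsState (1 - ρe) (1 - ρc) (hole m) := by
  refine ⟨fun p => h.nonneg _, ?_, fun p hp => ?_, fun p hp => ?_, ?_, ?_⟩
  · rw [sum_hole, h.total]
  · have := periodic_flip (h.periodic _ (mem_support_hole hp))
    rwa [flip_flip] at this
  · have := h.mem_Icc _ (mem_support_hole hp)
    exact ⟨by linarith [this.2], by linarith [this.1]⟩
  · rw [sum_hole, ← h.electrons]
    conv_rhs => rw [← h.total]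
    simp only [Finsupp.sum, ← Finset.sum_sub_distrib]
    exact Finset.sum_congr rfl fun p _ => by ring
  · rw [sum_hole, ← h.classical]
    conv_rhs => rw [← h.total]
    simp only [Finsupp.sum, ← Finset.sum_sub_distrib]
    refine Finset.sum_congr rfl fun p hp => ?_
    rw [classicalDensity_flip (h.periodic p hp)]
    ring

lemma energyDensity_hole (hd : 1 ≤ d) (U : ℝ) {ω : Config d} (h : Periodic ω) {r : ℝ}
    (hr : r ∈ Set.Icc (0 : ℝ) 1) : energyDensity U (1 - r) (flip ω) =
      energyDensity U r ω - U * (1 - r) + U * classicalDensity ω := by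
  have := energyDensity_flip hd U h (ρ := 1 - r) ⟨by linarith [hr.2], by linarith [hr.1]⟩
  rw [sub_sub_cancel] at this
  linarith

lemma IsState.stateEnergy_hole (hd : 1 ≤ d) (U : ℝ) {ρe ρc : ℝ} {m : (Config d × ℝ) →₀ ℝ}
    (h : IsState ρe ρc m) :
    stateEnergy U (FalicovKimball.hole m) = stateEnergy U m - U * (1 - ρe) + U * ρc := by
  rw [stateEnergy, sum_hole, stateEnergy]
  have e : U * (1 - ρe) - U * ρc =
      m.sum fun p w => w * (U * (1 - p.2) - U * classicalDensity p.1) := by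
    rw [← h.electrons, ← h.classical]
    conv_lhs => rw [← h.total]
    simp only [Finsupp.sum, ← Finset.sum_sub_distrib, Finset.mul_sum]
    exact Finset.sum_congr rfl fun p _ => by ring
  rw [sub_add, e]
  simp only [Finsupp.sum, ← Finset.sum_sub_distrib]
  refine Finset.sum_congr rfl fun p hp => ?_
  rw [energyDensity_hole hd U (h.periodic p hp) (h.mem_Icc p hp)]
  ring

lemma IsUniqueGroundState.hole (hd : 1 ≤ d) {U ρe ρc : ℝ} {m₀ : (Config d × ℝ) →₀ ℝ}
    (h : IsUniqueGroundState U ρe ρc m₀) :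
    IsUniqueGroundState U (1 - ρe) (1 - ρc) (hole m₀) := by
  refine ⟨h.1.hole, fun m hm => ?_⟩
  have hm' := hm.hole
  rw [sub_sub_cancel, sub_sub_cancel] at hm'
  have e := hm'.stateEnergy_hole hd U
  rw [hole_hole] at e
  rw [e, h.1.stateEnergy_hole hd U]
  obtain ⟨k1, k2⟩ := h.2 _ hm'
  refine ⟨by linarith, fun heq => ?_⟩
  rw [← k2 (by linarith), hole_hole]

lemma periodicEnergies_hole (hd : 1 ≤ d) (U : ℝ) {ρe ρc : ℝ} (hρ : ρe ∈ Set.Icc (0 : ℝ) 1) {E : ℝ}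
    (hE : E ∈ periodicEnergies d U ρe ρc) :
    E - U * (1 - ρe) + U * ρc ∈ periodicEnergies d U (1 - ρe) (1 - ρc) := by
  obtain ⟨ω, hω, hωc, rfl⟩ := hE
  refine ⟨flip ω, periodic_flip hω, ?_, ?_⟩
  · rw [classicalDensity_flip hω, hωc]
  · rw [energyDensity_hole hd U hω hρ, hωc]

lemma isGLB_periodicEnergies_hole (hd : 1 ≤ d) (U : ℝ) {ρe ρc : ℝ} (hρ : ρe ∈ Set.Icc (0 : ℝ) 1)
    {E : ℝ} (hE : IsGLB (periodicEnergies d U ρe ρc) E) :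
    IsGLB (periodicEnergies d U (1 - ρe) (1 - ρc)) (E - U * (1 - ρe) + U * ρc) := by
  have hρ' : 1 - ρe ∈ Set.Icc (0 : ℝ) 1 := ⟨by linarith [hρ.2], by linarith [hρ.1]⟩
  constructor
  · intro F hF
    have := periodicEnergies_hole hd U hρ' hF
    rw [sub_sub_cancel, sub_sub_cancel] at this
    linarith [hE.1 this]
  · intro b hb
    have : b + U * (1 - ρe) - U * ρc ≤ E := hE.2 fun F hF => by
      linarith [hb (periodicEnergies_hole hd U hρ hF)]
    linarith

lemma hole_segregatedBelow {ρe ρc : ℝ} (h : ρc < ρe) (h1 : ρe < 1) :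
    hole (segregatedBelow d (1 - ρe) (1 - ρc)) = segregatedAbove d ρe ρc := by
  have hadd : ∀ m n : (Config d × ℝ) →₀ ℝ, hole (m + n) = hole m + hole n := fun m n => by
    ext p; rfl
  have e1 : flip (emptyConfig d) = fullConfig d := rfl
  have e2 : flip (fullConfig d) = emptyConfig d := rfl
  have hc : 1 - ρc ≠ 0 := (sub_pos.2 (h.trans h1)).ne'
  have e3 : 1 - (1 - ρe) / (1 - ρc) = (ρe - ρc) / (1 - ρc) := by
    field_simp
    ring
  rw [segregatedBelow, segregatedAbove, hadd, hole, hole, Finsupp.equivMapDomain_single,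
    Finsupp.equivMapDomain_single, add_comm]
  simp only [holeEquiv, Equiv.coe_fn_mk, e1, e2, e3, sub_zero, sub_sub_cancel]

end GroundStates

end

end FalicovKimball

theorem theorem1 (d : ℕ) (hd : 1 ≤ d) :
    -- the infinite volume limits exist
    (∀ ω : FalicovKimball.Config d, FalicovKimball.Periodic ω →
      Tendsto (FalicovKimball.boxDensity ω) (FalicovKimball.cubeFilter d)
        (𝓝 (FalicovKimball.classicalDensity ω)) ∧
      ∀ U : ℝ, 4 * (d : ℝ) < U → ∀ ρ ∈ Set.Icc (0 : ℝ) 1,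
        Tendsto (FalicovKimball.boxEnergy U ρ ω) (FalicovKimball.cubeFilter d)
          (𝓝 (FalicovKimball.energyDensity U ρ ω))) ∧
    ∃ a γ : ℝ → ℝ,
      (∀ ρ ∈ Set.Icc (0 : ℝ) 1, a ρ = a (1 - ρ)) ∧
      (∀ ρ ∈ Set.Ioo (0 : ℝ) 1, 0 < a ρ) ∧
      Tendsto (fun U : ℝ => U * γ U) atTop (𝓝 (8 * (d : ℝ) ^ 2)) ∧
      -- (a)
      (∀ (l u : FalicovKimball.Site d) (U : ℝ), 4 * (d : ℝ) < U →
        ∀ (ω : FalicovKimball.BoxConfig (Finset.Icc l u)) (Ne : ℕ),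
          Ne ≤ FalicovKimball.numClassical ω →
          let Nc : ℝ := (FalicovKimball.numClassical ω : ℝ)
          let excess : ℝ := FalicovKimball.groundEnergy U Ne ω -
            Nc * FalicovKimball.energyDensity U ((Ne : ℝ) / Nc) (FalicovKimball.fullConfig d)
          excess ≤ 1 / (2 * (d : ℝ)) *
              |FalicovKimball.energyDensity U ((Ne : ℝ) / Nc) (FalicovKimball.emptyConfig d)| *
              (FalicovKimball.boundarySize ω : ℝ) ∧
          (a ((Ne : ℝ) / Nc) - γ U) * (FalicovKimball.boundarySize ω : ℝ) ≤ excess) ∧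
      -- (b), case of fewer electrons than classical particles
      (∀ ρe ρc : ℝ, 0 < ρe → ρe < ρc → ρc ≤ 1 →
        (∀ U : ℝ, 4 * (d : ℝ) < U → γ U < a (ρe / ρc) →
          FalicovKimball.canonicalGroundStates d U ρe ρc =
            {FalicovKimball.segregatedBelow d ρe ρc} ∧
          ((FalicovKimball.periodicEnergies d U ρe ρc).Nonempty →
            IsGLB (FalicovKimball.periodicEnergies d U ρe ρc)
              (FalicovKimball.absoluteEnergy d U ρe ρc))) ∧
        ∀ᶠ U in atTop, γ U < a (ρe / ρc)) ∧
      -- (b), case of more electrons than classical particles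
      (∀ ρe ρc : ℝ, 0 < ρc → ρc < ρe → ρe < 1 →
        (∀ U : ℝ, 4 * (d : ℝ) < U → γ U < a ((1 - ρe) / (1 - ρc)) →
          FalicovKimball.canonicalGroundStates d U ρe ρc =
            {FalicovKimball.segregatedAbove d ρe ρc} ∧
          ((FalicovKimball.periodicEnergies d U ρe ρc).Nonempty →
            IsGLB (FalicovKimball.periodicEnergies d U ρe ρc)
              (FalicovKimball.absoluteEnergy d U ρe ρc))) ∧
        ∀ᶠ U in atTop, γ U < a ((1 - ρe) / (1 - ρc))) := by
  have hlimits : ∀ ω : FalicovKimball.Config d, FalicovKimball.Periodic ω →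
      Tendsto (FalicovKimball.boxDensity ω) (FalicovKimball.cubeFilter d)
        (𝓝 (FalicovKimball.classicalDensity ω)) ∧
      ∀ U : ℝ, 4 * (d : ℝ) < U → ∀ ρ ∈ Set.Icc (0 : ℝ) 1,
        Tendsto (FalicovKimball.boxEnergy U ρ ω) (FalicovKimball.cubeFilter d)
          (𝓝 (FalicovKimball.energyDensity U ρ ω)) :=
    fun ω hω => ⟨FalicovKimball.tendsto_boxDensity hω,
      fun U _ ρ hρ => FalicovKimball.tendsto_boxEnergy hd U hω hρ⟩
  obtain ⟨a, ha_symm, ha_pos, ha⟩ := FalicovKimball.exists_surfaceTension hd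
  have hev : ∀ ρ ∈ Set.Ioo (0 : ℝ) 1, ∀ᶠ U in atTop, FalicovKimball.decouplingCost d U < a ρ :=
    fun ρ hρ => (FalicovKimball.tendsto_decouplingCost d).eventually_lt_const (ha_pos ρ hρ)
  refine ⟨hlimits, a, FalicovKimball.decouplingCost d, fun ρ _ => ha_symm ρ, ha_pos,
    FalicovKimball.tendsto_mul_decouplingCost d, ?_, ?_, ?_⟩
  · intro l u U hU ω Ne hNe
    exact FalicovKimball.groundEnergy_bounds hd hU ha ω hNe
  · intro ρe ρc h0 h1 h2
    have hc : 0 < ρc := h0.trans h1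
    have hρ : ρe / ρc ∈ Set.Ioo (0 : ℝ) 1 := ⟨by positivity, (div_lt_one hc).2 h1⟩
    have ha' := ha _ ⟨hρ.1.le, hρ.2.le⟩
    refine ⟨fun U hU haU => ?_, hev _ hρ⟩
    have hgs := FalicovKimball.isUniqueGroundState_segregatedBelow hd hU h0 h1 h2 ha' haU
    refine ⟨hgs.canonicalGroundStates_eq, fun hne => ?_⟩
    rw [hgs.absoluteEnergy_eq]
    exact FalicovKimball.isGLB_periodicEnergies_below hd hU h0 h1 h2 ha' haU hne
  · intro ρe ρc h0 h1 h2
    -- Holes have the densities `1 - ρe < 1 - ρc`.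
    have h0' : 0 < 1 - ρe := by linarith
    have h1' : 1 - ρe < 1 - ρc := by linarith
    have h2' : 1 - ρc ≤ 1 := by linarith
    have hc : 0 < 1 - ρc := h0'.trans h1'
    have hρ : (1 - ρe) / (1 - ρc) ∈ Set.Ioo (0 : ℝ) 1 := ⟨by positivity, (div_lt_one hc).2 h1'⟩
    have ha' := ha _ ⟨hρ.1.le, hρ.2.le⟩
    refine ⟨fun U hU haU => ?_, hev _ hρ⟩
    have hbelow := FalicovKimball.isUniqueGroundState_segregatedBelow hd hU h0' h1' h2' ha' haU
    have hgs := hbelow.hole hd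
    rw [FalicovKimball.hole_segregatedBelow h1 h2, sub_sub_cancel, sub_sub_cancel] at hgs
    refine ⟨hgs.canonicalGroundStates_eq, fun hne => ?_⟩
    have hne' : (FalicovKimball.periodicEnergies d U (1 - ρe) (1 - ρc)).Nonempty := by
      obtain ⟨E, hE⟩ := hne
      exact ⟨_, FalicovKimball.periodicEnergies_hole hd U ⟨by linarith, h2.le⟩ hE⟩
    have hglb := FalicovKimball.isGLB_periodicEnergies_hole hd U ⟨h0'.le, by linarith⟩
      (FalicovKimball.isGLB_periodicEnergies_below hd hU h0' h1' h2' ha' haU hne')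
    rw [← hbelow.1.stateEnergy_hole hd U, FalicovKimball.hole_segregatedBelow h1 h2,
      sub_sub_cancel, sub_sub_cancel] at hglb
    rwa [hgs.absoluteEnergy_eq]
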